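/- Let $d\ge 5$. For $\lambda>0$ with $\lambda^2\in\mathbb{N}$ and $f:\mathbb{Z}^d\to\mathbb{C}$ define the discrete spherical average $$A_\lambda f(n)=N_\lambda^{-1}\sum_{m\in\mathbb{Z}^d,\ |m|=\lambda} f(n-m),\qquad N_\lambda=\#\{m\in\mathbb{Z}^d:|m|=\lambda\},$$ where $|\cdot|$ is the Euclidean norm. For $f\in\ell^2(\mathbb{Z}^d)$ let $\widehat f(\alpha)=\sum_{n\in\mathbb{Z}^d}f(n)e^{-2\pi i n\cdot\alpha}$, with convergence in $L^2(\mathbb{T}^d)$, $\mathbb{T}=\mathbb{R}/\mathbb{Z}$. For $\eta>0$ put $q_\eta=\operatorname{lcm}\{q\in\mathbb{N}:1\le q\le\eta^{-2}\}$ (so $q_\eta=1$ if $\eta>1$), and for $L>0$ put $$\Omega_{\eta,L}=\{\alpha\in\mathbb{T}^d:\ \alpha\in[-L^{-1},L^{-1}]^d+(q_\eta^{-1}\mathbb{Z})^d\}.$$ Then there is a constant $C>0$ depending only on $d$ such that for all $\eta>0$, all real $L\ge q_\eta^4$ and all $f\in\ell^2(\mathbb{Z}^d)$ for which $\widehat f$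 is supported off $\Omega_{\eta,L}$ (that is, $\widehat f=0$ almost everywhere on $\Omega_{\eta,L}$), $$\Bigl\|\sup_{\lambda\ge\eta^{-2}L,\ \lambda^2\in\mathbb{N}}|A_\lambda f|\Bigr\|_{\ell^2(\mathbb{Z}^d)}\le C\,\eta\,\|f\|_{\ell^2(\mathbb{Z}^d)}.$$ -/

import Mathlib

open MeasureTheory
open scoped ENNReal

noncomputable section

/-- The complex Hilbert space `ℓ²(ℤ^d)`. -/
abbrev LatticeL2 (d : ℕ) : Type := lp (fun _ : Fin d → ℤ => ℂ) 2

/-- Haar probability measure on the torus `𝕋^d = (ℝ/ℤ)^d`. -/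
abbrev torusHaar (d : ℕ) : Measure (UnitAddTorus (Fin d)) :=
  Measure.pi fun _ => AddCircle.haarAddCircle

/-- The Fourier transform `f̂(α) = ∑ₙ f(n) e^{-2πi n·α}` of `f ∈ ℓ²(ℤ^d)`, the series being
summed in `L²(𝕋^d)`. -/
def latticeFourier {d : ℕ} (f : LatticeL2 d) : Lp ℂ 2 (torusHaar d) :=
  ∑' n : Fin d → ℤ, f n • UnitAddTorus.mFourierLp 2 (-n)

/-- The series defining the Fourier transform converges in `L²(𝕋^d)`. -/
theorem hasSum_latticeFourier {d : ℕ} (f : LatticeL2 d) :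
    HasSum (fun n : Fin d → ℤ => (f n • UnitAddTorus.mFourierLp 2 (-n) : Lp ℂ 2 (torusHaar d)))
      (latticeFourier f) := by
  refine Summable.hasSum ?_
  have hO : Orthonormal ℂ
      (fun n : Fin d → ℤ => (UnitAddTorus.mFourierLp 2 (-n) : Lp ℂ 2 (torusHaar d))) :=
    UnitAddTorus.orthonormal_mFourier.comp _ neg_injective
  exact (hO.orthogonalFamily.summable_of_lp f)

/-- The points of `ℤ^d` of Euclidean norm `r` form a finite set. -/
theorem latticeSphere_finite (d : ℕ) (r : ℝ) :
    {m : Fin d → ℤ | √(∑ i, (m i : ℝ) ^ 2) = r}.Finite := by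
  refine (Set.finite_Icc (fun _ => -⌈r⌉ : Fin d → ℤ) (fun _ => ⌈r⌉)).subset ?_
  intro m hm
  have key : ∀ i, |(m i : ℝ)| ≤ (⌈r⌉ : ℝ) := fun i => by
    refine le_trans ?_ (Int.le_ceil r)
    rw [← (hm : _ = r)]
    refine Real.abs_le_sqrt ?_
    exact Finset.single_le_sum (f := fun i => (m i : ℝ) ^ 2) (fun j _ => sq_nonneg _)
      (Finset.mem_univ i)
  exact ⟨fun i => by exact_mod_cast (abs_le.mp (key i)).1,
    fun i => by exact_mod_cast (abs_le.mp (key i)).2⟩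

/-- The discrete sphere `{m ∈ ℤ^d : |m| = r}`. -/
def latticeSphere (d : ℕ) (r : ℝ) : Finset (Fin d → ℤ) :=
  (latticeSphere_finite d r).toFinset

/-- The discrete spherical average `A_r f(n) = N_r⁻¹ ∑_{|m| = r} f(n - m)`, where
`N_r = #{m ∈ ℤ^d : |m| = r}`. -/
def sphericalAverage {d : ℕ} (r : ℝ) (f : (Fin d → ℤ) → ℂ) (n : Fin d → ℤ) : ℂ :=
  ((latticeSphere d r).card : ℂ)⁻¹ * ∑ m ∈ latticeSphere d r, f (n - m)

/-- `sup |A_r f(n)|` over all `r ≥ R` with `r² ∈ ℕ`, as an extended non-negative real. -/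
def sphericalMaximal {d : ℕ} (R : ℝ) (f : (Fin d → ℤ) → ℂ) (n : Fin d → ℤ) : ℝ≥0∞ :=
  ⨆ (r : ℝ) (_ : R ≤ r) (_ : ∃ k : ℕ, r ^ 2 = k), ‖sphericalAverage r f n‖ₑ

/-- The `ℓ²(ℤ^d)` norm (possibly `∞`) of a `[0, ∞]`-valued function. -/
def latticeL2Norm {d : ℕ} (g : (Fin d → ℤ) → ℝ≥0∞) : ℝ≥0∞ :=
  (∑' n, g n ^ 2) ^ (1 / 2 : ℝ)

/-- `q_η = lcm {q ∈ ℕ : 1 ≤ q ≤ η⁻²}` (equal to `1` when `η > 1`). -/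
def lcmUpTo (η : ℝ) : ℕ := (Finset.Icc 1 ⌊η ^ (-2 : ℤ)⌋₊).lcm id

/-- The image `Ω_{η,L}` in `𝕋^d` of `[-L⁻¹, L⁻¹]^d + (q_η⁻¹ ℤ)^d`. -/
def majorArcs (d : ℕ) (η L : ℝ) : Set (UnitAddTorus (Fin d)) :=
  {α | ∃ (β : Fin d → ℝ) (l : Fin d → ℤ), (∀ i, (β i : UnitAddCircle) = α i) ∧
    ∀ i, β i - (l i : ℝ) / (lcmUpTo η : ℝ) ∈ Set.Icc (-L⁻¹) L⁻¹}

end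

/-! Write e(x) = exp(2πix) and N_r for the number of lattice points of norm r. For r² = k and Λ =
2^j ≤ r < 2Λ, orthogonality (`integral_circleOp`) gives N_r A_r f = Λ^d exp(2πk/Λ²) ∫₀¹ e(-kt)
T_{Λ,t} f dt, where T_{Λ,t} is convolution with Λ^{-d} exp(-2π|m|²/Λ²) e(|m|²t). Taking absolute
values removes k, so the supremum over r becomes one over dyadic Λ. Dirichlet's theorem covers [0,1]
by arcs t = a/q + u/Λ² with q ≤ Λ and q|u| ≤ Λ, and the Jacobian Λ^{-2} cancels Λ^d/N_r as soon as
N_r ≳ r^{d-2}. By Minkowski, the maximal function is controlled by a sum over a/q and an integral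
over u of dyadic maximal functions in which a/q and u are fixed
(`latticeL2Norm_sphericalMaximal_le`).

On one arc the symbol of T is a product of one-dimensional theta series. By Poisson summation each
factor is, to leading order, a normalised Gauss sum times (2(1-iu))^{-1/2} times a Gaussian in
Λ·dist(α, q⁻¹ℤ). Up to errors that are square-summable over dyadic Λ, the symbol is a scale-free
factor times the symbol of positive Gaussian averages over (qℤ)^d, and the maximal function of these
averages is bounded uniformly in q (`latticeL2Norm_maximal_le`, `progKernel_maximal`). Hence one arc
costs O(q^{-d/2} (1+u²)^{-d/4} (1+|u|)) (`arcOp_maximal_le`). For d ≥ 5 this is integrable in u and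
summable over a/q, and the denominators q > η⁻² contribute a tail of ∑ q^{-3/2}, which is O(η).

If q ≤ η⁻², then q divides q_η, so on the spectrum of f some coordinate of α lies farther than 1/L
from q⁻¹ℤ. The theta factor of that coordinate gains (1+|u|)L/Λ, and Λ ≥ η⁻²L/2 turns this into a
gain of 2η² (`arcOp_maximal_le_of_spectrum`).

The bound N_r ≳ r^{d-2} (`card_latticeSphere_ge`) comes from the same arcs with f = 1 and Λ = √k:
N_r is a singular integral times a singular series, with a power-saving error. The series is bounded
below through its Euler product. The integral is non-zero because otherwise the spheres would have
too few points to fill a cube. -/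

noncomputable section

/-! ### Quadratic Gauss sums -/

/-- The quadratic Gauss sum `∑ e((a r² + r n) / q)` over `r` modulo `q`. -/
def quadGauss (q : ℕ) [NeZero q] (a n : ZMod q) : ℂ :=
  ∑ r : ZMod q, ZMod.stdAddChar (a * r ^ 2 + r * n)

theorem norm_stdAddChar {q : ℕ} [NeZero q] (x : ZMod q) : ‖ZMod.stdAddChar x‖ = 1 := by
  rw [ZMod.stdAddChar_apply]; exact Circle.norm_coe _

/-- Weyl differencing: substituting r = s + h makes the phase linear in s, and the sum over s
detects 2ah = 0. -/
theorem quadGauss_mul_conj (q : ℕ) [NeZero q] (a n : ZMod q) :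
    quadGauss q a n * (starRingEnd ℂ) (quadGauss q a n) =
      ∑ h : ZMod q, ZMod.stdAddChar (a * h ^ 2 + h * n) *
        ((if 2 * a * h = 0 then q else 0 : ℕ) : ℂ) := by
  have hconj : ∀ x : ZMod q, (starRingEnd ℂ) (ZMod.stdAddChar x) = ZMod.stdAddChar (-x) := by
    intro x
    rw [AddChar.map_neg_eq_conj]
  unfold quadGauss
  rw [map_sum, Finset.sum_mul_sum, Finset.sum_comm]
  have : ∀ s : ZMod q, ∑ r : ZMod q, ZMod.stdAddChar (a * r ^ 2 + r * n) *
        (starRingEnd ℂ) (ZMod.stdAddChar (a * s ^ 2 + s * n)) =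
      ∑ h : ZMod q, ZMod.stdAddChar (a * h ^ 2 + h * n) * ZMod.stdAddChar (s * (2 * a * h)) := by
    intro s
    rw [← Equiv.sum_comp (Equiv.addLeft s)]
    refine Finset.sum_congr rfl fun h _ => ?_
    rw [hconj, ← AddChar.map_add_eq_mul, ← AddChar.map_add_eq_mul]
    congr 1
    simp only [Equiv.coe_addLeft]
    ring
  rw [Finset.sum_congr rfl fun s _ => this s, Finset.sum_comm]
  refine Finset.sum_congr rfl fun h _ => ?_
  rw [← Finset.mul_sum, AddChar.sum_mulShift _ (ZMod.isPrimitive_stdAddChar q), ZMod.card]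

theorem normSq_quadGauss_le (q : ℕ) [NeZero q] (a n : ZMod q) (ha : IsUnit a) :
    ‖quadGauss q a n‖ ^ 2 ≤ q * ((Finset.univ.filter fun h : ZMod q => 2 * h = 0).card : ℝ) := by
  have h1 : (‖quadGauss q a n‖ ^ 2 : ℝ) = ‖quadGauss q a n * (starRingEnd ℂ) (quadGauss q a n)‖ := by
    rw [norm_mul, RCLike.norm_conj, sq]
  rw [h1, quadGauss_mul_conj]
  refine (norm_sum_le _ _).trans ?_
  have h2 : ∀ h : ZMod q, ‖ZMod.stdAddChar (a * h ^ 2 + h * n) *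
        ((if 2 * a * h = 0 then q else 0 : ℕ) : ℂ)‖ = if 2 * h = 0 then (q : ℝ) else 0 := by
    intro h
    rw [norm_mul, norm_stdAddChar, one_mul, Complex.norm_natCast]
    have : 2 * a * h = 0 ↔ 2 * h = 0 := by
      rw [show 2 * a * h = a * (2 * h) by ring]
      exact ha.mul_right_eq_zero
    simp only [this]
    split_ifs <;> simp
  rw [Finset.sum_congr rfl fun h _ => h2 h, ← Finset.sum_filter, Finset.sum_const, nsmul_eq_mul,
    mul_comm]

theorem norm_quadGauss_le (q : ℕ) [NeZero q] (a n : ZMod q) (ha : IsUnit a) :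
    ‖quadGauss q a n‖ ≤ √2 * √q := by
  rw [← Real.sqrt_mul (by norm_num)]
  refine Real.le_sqrt_of_sq_le ((normSq_quadGauss_le q a n ha).trans ?_)
  rw [mul_comm]
  gcongr
  have := IsAddCyclic.card_nsmul_eq_zero_le (α := ZMod q) (n := 2) (by norm_num)
  simp only [nsmul_eq_mul, Nat.cast_ofNat] at this
  exact_mod_cast this

/-- Doubling is injective for odd q, so only h = 0 survives. The constant 1 in place of √2 is what
keeps the Euler factors at small odd primes away from zero. -/
theorem norm_quadGauss_le_of_odd (q : ℕ) [NeZero q] (hq : Odd q) (a n : ZMod q) (ha : IsUnit a) :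
    ‖quadGauss q a n‖ ≤ √q := by
  refine Real.le_sqrt_of_sq_le ((normSq_quadGauss_le q a n ha).trans ?_)
  have h2 : IsUnit (2 : ZMod q) := by
    have := (ZMod.isUnit_iff_coprime 2 q).2 (Nat.coprime_two_left.2 hq)
    exact_mod_cast this
  have : (Finset.univ.filter fun h : ZMod q => 2 * h = 0) = {0} := by
    ext h; simp [h2.mul_right_eq_zero]
  rw [this]; simp

/-- Since r² = r modulo 2, this is the complete sum of a non-trivial character. It compensates at p
= 2 for the lost factor √2. -/
theorem quadGauss_two (a : ZMod 2) (ha : IsUnit a) : quadGauss 2 a 0 = 0 := by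
  have h1 : a = 1 := by
    revert ha; revert a; decide
  subst h1
  have h := AddChar.sum_mulShift (ψ := ZMod.stdAddChar (N := 2)) 1 (ZMod.isPrimitive_stdAddChar 2)
  rw [if_neg one_ne_zero] at h
  unfold quadGauss
  rw [Nat.cast_zero] at h
  rw [← h]
  refine Finset.sum_congr rfl fun r _ => ?_
  congr 1
  revert r; decide

/-! ### Poisson summation for theta series near a rational point -/

open Complex

/-- `∑ k⁻²` over the non-zero integers `k`. -/
def invSqSum : ℝ := ∑' k : ℤ, 1 / (k : ℝ) ^ 2

theorem invSqSum_nonneg : 0 ≤ invSqSum := tsum_nonneg fun k => by positivity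

theorem norm_cexp_neg_mul_ofReal_sq (b : ℂ) (x : ℝ) :
    ‖cexp (-b * (x : ℂ) ^ 2)‖ = Real.exp (-b.re * x ^ 2) := by
  rw [Complex.norm_exp]
  congr 1
  rw [← ofReal_pow, re_mul_ofReal, neg_re]

theorem real_exp_neg_le_one_div {y : ℝ} (hy : 0 < y) : Real.exp (-y) ≤ 1 / y := by
  rw [Real.exp_neg, ← one_div]
  exact one_div_le_one_div_of_le hy ((by linarith [Real.add_one_le_exp y]))

/-- A Gaussian sum differs from its dominant term by a quadratically small tail. -/
theorem norm_tsum_gaussian_sub_le {b : ℂ} (hb : 0 < b.re) {g : ℤ → ℂ} {M : ℝ}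
    (hg : ∀ n, ‖g n‖ ≤ M) (y : ℝ) :
    Summable (fun n : ℤ => g n * cexp (-b * ((y + n : ℝ) : ℂ) ^ 2)) ∧
    ‖(∑' n : ℤ, g n * cexp (-b * ((y + n : ℝ) : ℂ) ^ 2)) -
        g (-round y) * cexp (-b * ((y - round y : ℝ) : ℂ) ^ 2)‖ ≤ M * (4 * invSqSum / b.re) := by
  have hM : 0 ≤ M := (norm_nonneg _).trans (hg 0)
  set F : ℤ → ℂ := fun n => g n * cexp (-b * ((y + n : ℝ) : ℂ) ^ 2) with hF
  set x := y - round y with hx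
  have hx2 : |x| ≤ 1 / 2 := abs_sub_round y
  set e : ℤ ≃ ℤ := Equiv.subRight (round y) with he
  have hFe : ∀ k : ℤ, F (e k) = g (k - round y) * cexp (-b * ((x + k : ℝ) : ℂ) ^ 2) := by
    intro k
    simp only [hF, he, Equiv.subRight_apply, hx]
    congr 5
    push_cast; ring
  -- After recentring at the dominant index, |x| ≤ 1/2 gives |x + k| ≥ |k|/2 for k ≠ 0, and exp(-y)
  -- ≤ 1/y then bounds the Gaussian by 4 / (Re b · k²).
  have hb1 : ∀ k : ℤ, k ≠ 0 → ‖F (e k)‖ ≤ M * (4 / b.re) * (1 / (k : ℝ) ^ 2) := by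
    intro k hk
    rw [hFe, norm_mul, norm_cexp_neg_mul_ofReal_sq]
    have hk1 : (1 : ℝ) ≤ |(k : ℝ)| := by exact_mod_cast Int.one_le_abs hk
    have hk2 : |(k : ℝ)| / 2 ≤ |x + k| := by
      have := abs_sub_abs_le_abs_sub (k : ℝ) (-x)
      rw [abs_neg, sub_neg_eq_add, add_comm] at this
      linarith
    have hk3 : (k : ℝ) ^ 2 / 4 ≤ (x + k) ^ 2 := by
      rw [← sq_abs (k : ℝ), ← sq_abs (x + k)]
      nlinarith [abs_nonneg (k : ℝ)]
    have hkpos : 0 < (k : ℝ) ^ 2 := by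
      rw [← sq_abs]; positivity
    have h1 : Real.exp (-b.re * (x + k) ^ 2) ≤ 1 / (b.re * ((k : ℝ) ^ 2 / 4)) := by
      refine le_trans ?_ (real_exp_neg_le_one_div (by positivity))
      apply Real.exp_le_exp.2
      nlinarith
    calc _ ≤ M * (1 / (b.re * ((k : ℝ) ^ 2 / 4))) := by
          gcongr; exact hg _
      _ = _ := by field_simp
  have hS : Summable fun k : ℤ => 1 / (k : ℝ) ^ 2 :=
    Real.summable_one_div_int_pow.2 (by norm_num)
  set H : ℤ → ℂ := fun k => if k = 0 then 0 else F (e k) with hH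
  have hHb : ∀ k, ‖H k‖ ≤ M * (4 / b.re) * (1 / (k : ℝ) ^ 2) := by
    intro k
    simp only [hH]
    split_ifs with h
    · simp [h]
    · exact hb1 k h
  have hHs : Summable H := Summable.of_norm_bounded (hS.mul_left _) hHb
  have hsum : Summable (fun k => F (e k)) := by
    have : (fun k => F (e k)) = fun k => H k + if k = 0 then F (e 0) else 0 := by
      ext k; simp only [hH]; split_ifs with h <;> simp [h]
    rw [this]
    exact hHs.add (summable_of_hasFiniteSupport (Set.Finite.subset (Set.finite_singleton 0)
      (by intro k; simp; tauto)))
  have hsumF : Summable F := (e.summable_iff).1 hsum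
  refine ⟨hsumF, ?_⟩
  have h0 : F (e 0) = g (-round y) * cexp (-b * ((y - round y : ℝ) : ℂ) ^ 2) := by
    rw [hFe]; simp [hx]
  rw [← h0, ← e.tsum_eq, hsum.tsum_eq_add_tsum_ite 0, add_sub_cancel_left]
  calc ‖∑' k, H k‖ ≤ ∑' k : ℤ, M * (4 / b.re) * (1 / (k : ℝ) ^ 2) :=
        tsum_of_norm_bounded (hS.mul_left _).hasSum hHb
    _ = _ := by rw [tsum_mul_left]; unfold invSqSum; ring

/-- The summand `e(w m² - m α)` of a theta series. -/
def thetaTerm (w : ℂ) (α : ℝ) (m : ℤ) : ℂ :=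
  cexp (2 * Real.pi * I * (w * m ^ 2 - m * α))

theorem norm_thetaTerm (w : ℂ) (α : ℝ) (m : ℤ) :
    ‖thetaTerm w α m‖ = Real.exp (-(2 * Real.pi * w.im) * (0 + m : ℝ) ^ 2) := by
  unfold thetaTerm
  rw [Complex.norm_exp]
  congr 1
  have : (2 * Real.pi * I * (w * m ^ 2 - m * α) : ℂ) =
      ((2 * Real.pi : ℝ) : ℂ) * (I * (w * ((m ^ 2 : ℝ) : ℂ) - ((m * α : ℝ) : ℂ))) := by
    push_cast; ring
  rw [this, re_ofReal_mul, I_mul_re, sub_im, im_mul_ofReal, ofReal_im]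
  ring

theorem summable_norm_thetaTerm {w : ℂ} (hw : 0 < w.im) (α : ℝ) :
    Summable fun m => ‖thetaTerm w α m‖ := by
  have h := (norm_tsum_gaussian_sub_le (b := ((2 * Real.pi * w.im : ℝ) : ℂ))
    (by rw [ofReal_re]; positivity) (g := fun _ => 1) (M := 1) (by simp) 0).1.norm
  refine h.congr fun m => ?_
  rw [norm_mul, norm_one, one_mul, norm_cexp_neg_mul_ofReal_sq, norm_thetaTerm, ofReal_re]

/-- Poisson summation for the theta series near the rational point `a / q`. -/
theorem tsum_thetaTerm_eq (q : ℕ) [NeZero q] (a : ℤ) {z : ℂ} (hz : 0 < z.re) (α : ℝ) :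
    ∑' m, thetaTerm (a / q + I * z) α m =
      1 / (2 * z * q ^ 2) ^ (1 / 2 : ℂ) * ∑' n : ℤ, quadGauss q a n *
        cexp (-(Real.pi / (2 * z * q ^ 2)) * ((q * α + n : ℝ) : ℂ) ^ 2) := by
  have hq0 : (q : ℂ) ≠ 0 := by exact_mod_cast NeZero.ne q
  have hqpos : (0 : ℝ) < q := by exact_mod_cast Nat.pos_of_ne_zero (NeZero.ne q)
  have hz0 : z ≠ 0 := by rintro rfl; simp at hz
  have hA : 0 < (2 * z * q ^ 2 : ℂ).re := by
    have : (2 * z * q ^ 2 : ℂ) = ((2 * q ^ 2 : ℝ) : ℂ) * z := by push_cast; ring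
    rw [this, re_ofReal_mul]; positivity
  have hbre : 0 < (Real.pi / (2 * z * q ^ 2) : ℂ).re := by
    rw [div_eq_mul_inv, re_ofReal_mul, inv_re]
    have : (2 * z * q ^ 2 : ℂ) ≠ 0 := by intro h; rw [h] at hA; simp at hA
    have := normSq_pos.2 this
    positivity
  have hw : 0 < (a / q + I * z : ℂ).im := by
    have h : (a / q + I * z : ℂ) = ((a / q : ℝ) : ℂ) + I * z := by push_cast; rfl
    rw [h, add_im, ofReal_im, I_mul_im]; simpa using hz
  have hsum : Summable (thetaTerm (a / q + I * z) α) := (summable_norm_thetaTerm hw α).of_norm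
  -- Split m = nq + r. On one residue class e(am²/q) depends only on r, so the sum over n is a pure
  -- Gaussian sum, to which Poisson summation applies. Summing over r afterwards rebuilds the Gauss
  -- sum.
  set e : Fin q × ℤ ≃ ℤ := (Equiv.prodComm (Fin q) ℤ).trans (Int.divModEquiv q).symm with he
  have hev : ∀ (r : Fin q) (n : ℤ), e (r, n) = n * q + ((r : ℕ) : ℤ) := fun r n => rfl
  have hr : ∀ r : Fin q, ∑' n : ℤ, thetaTerm (a / q + I * z) α (e (r, n)) =
      1 / (2 * z * q ^ 2) ^ (1 / 2 : ℂ) * ∑' n : ℤ,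
        ZMod.stdAddChar (((a * (r : ℕ) ^ 2 + (r : ℕ) * n : ℤ)) : ZMod q) *
        cexp (-(Real.pi / (2 * z * q ^ 2)) * ((q * α + n : ℝ) : ℂ) ^ 2) := by
    intro r
    set K : ℂ := cexp (2 * Real.pi * I * ((a / q + I * z) * (r : ℕ) ^ 2 - (r : ℕ) * α)) with hK
    have h1 : ∀ n : ℤ, thetaTerm (a / q + I * z) α (e (r, n)) =
        K * cexp (-Real.pi * (2 * z * q ^ 2) * n ^ 2 +
          2 * Real.pi * (-2 * z * q * (r : ℕ) - I * q * α) * n) := by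
      intro n
      rw [hev, thetaTerm, hK, ← Complex.exp_add]
      have : (2 * Real.pi * I * ((a / q + I * z) * ((n * q + ((r : ℕ) : ℤ) : ℤ) : ℂ) ^ 2 -
            ((n * q + ((r : ℕ) : ℤ) : ℤ) : ℂ) * α) : ℂ) =
          (2 * Real.pi * I * ((a / q + I * z) * (r : ℕ) ^ 2 - (r : ℕ) * α) +
          (-Real.pi * (2 * z * q ^ 2) * n ^ 2 +
          2 * Real.pi * (-2 * z * q * (r : ℕ) - I * q * α) * n)) +
          ((a * (n ^ 2 * q + 2 * n * (r : ℕ)) : ℤ) : ℂ) * (2 * Real.pi * I) := by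
        push_cast
        field_simp
        ring_nf
        rw [I_sq]; ring
      rw [this]
      exact Complex.exp_periodic.int_mul _ _
    rw [tsum_congr h1, tsum_mul_left, Complex.tsum_exp_neg_quadratic hA, mul_left_comm,
      ← tsum_mul_left]
    congr 1
    refine tsum_congr fun n => ?_
    rw [ZMod.stdAddChar_coe, hK, ← Complex.exp_add, ← Complex.exp_add]
    congr 1
    push_cast
    field_simp
    ring_nf
    rw [I_pow_three, I_sq, I_pow_four]
    ring
  have hse : Summable fun p => thetaTerm (a / q + I * z) α (e p) := (e.summable_iff).2 hsum
  rw [← e.tsum_eq, hse.tsum_prod, tsum_fintype, Finset.sum_congr rfl fun r _ => hr r,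
    ← Finset.mul_sum, ← Summable.tsum_finsetSum fun r _ =>
      (norm_tsum_gaussian_sub_le hbre (M := 1) (fun n => (norm_stdAddChar _).le) (q * α)).1]
  congr 1
  refine tsum_congr fun n => ?_
  rw [← Finset.sum_mul]
  congr 1
  unfold quadGauss
  obtain ⟨k, rfl⟩ : ∃ k, q = k + 1 := ⟨q - 1, by have := NeZero.ne q; omega⟩
  refine Finset.sum_congr rfl fun r _ => ?_
  congr 1
  push_cast
  rw [show (((r : Fin (k + 1)) : ℕ) : ZMod (k + 1)) = r from Fin.cast_val_eq_self r]

/-! ### The theta multiplier on a Dirichlet arc -/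

/-- The theta series at `a / q + (u + i) / Λ²`, divided by `Λ`. -/
def normTheta (Λ : ℝ) (q : ℕ) (a : ℤ) (u α : ℝ) : ℂ :=
  (Λ : ℂ)⁻¹ * ∑' m, thetaTerm (a / q + I * ((1 - I * u) / Λ ^ 2)) α m

/-- The archimedean factor `(2 (1 - i u))^(-1/2)`. -/
def arcFactor (u : ℝ) : ℂ := 1 / (2 * (1 - I * u)) ^ (1 / 2 : ℂ)

/-- The size `q^(-1/2) (1 + u²)^(-1/4)` of `normTheta` on the arc around `a / q`. -/
def arcDecay (q : ℕ) (u : ℝ) : ℝ := (q : ℝ) ^ (-(1 / 2) : ℝ) * (1 + u ^ 2) ^ (-(1 / 4) : ℝ)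

/-- The Gaussian `exp (- π Λ² x² / (2 (1 - i u) q²))`. -/
def arcGauss (Λ : ℝ) (q : ℕ) (u x : ℝ) : ℂ :=
  cexp (-((Real.pi * Λ ^ 2 / (2 * q ^ 2) : ℝ) / (1 - I * u)) * (x : ℂ) ^ 2)

theorem one_sub_I_mul_ne_zero (u : ℝ) : (1 - I * u : ℂ) ≠ 0 := by
  intro h; have := congrArg Complex.re h; simp at this

theorem norm_one_sub_I_mul (u : ℝ) : ‖(1 - I * u : ℂ)‖ = (1 + u ^ 2) ^ (1 / 2 : ℝ) := by
  rw [← Real.sqrt_eq_rpow, Complex.norm_def, normSq_apply]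
  congr 1
  simp; ring

theorem norm_arcFactor (u : ℝ) : ‖arcFactor u‖ = (2 : ℝ) ^ (-(1 / 2) : ℝ) * (1 + u ^ 2) ^ (-(1 / 4) : ℝ) := by
  have h0 : (2 * (1 - I * u) : ℂ) ≠ 0 := mul_ne_zero two_ne_zero (one_sub_I_mul_ne_zero u)
  unfold arcFactor
  rw [norm_div, norm_one, Complex.norm_cpow_of_ne_zero h0, norm_mul, norm_one_sub_I_mul]
  have hp : (0 : ℝ) ≤ 1 + u ^ 2 := by positivity
  have : ((1 / 2 : ℂ)).im = 0 := by simp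
  rw [this, mul_zero, Real.exp_zero, div_one, show ((1 / 2 : ℂ)).re = 1 / 2 by simp,
    Real.mul_rpow (by positivity) (by positivity), ← Real.rpow_mul hp, RCLike.norm_ofNat,
    Real.rpow_neg (by positivity), Real.rpow_neg hp, one_div, mul_inv]
  norm_num

theorem arcDecay_pos (q : ℕ) [NeZero q] (u : ℝ) : 0 < arcDecay q u := by
  have : (0 : ℝ) < q := by exact_mod_cast Nat.pos_of_ne_zero (NeZero.ne q)
  unfold arcDecay; positivity

theorem re_ofReal_div_one_sub (c u : ℝ) : ((c : ℂ) / (1 - I * u)).re = c / (1 + u ^ 2) := by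
  rw [div_eq_mul_inv, re_ofReal_mul, inv_re, normSq_apply]
  simp; ring

theorem normTheta_eq {Λ : ℝ} (hΛ : 0 < Λ) (q : ℕ) [NeZero q] (a : ℤ) (u α : ℝ) :
    normTheta Λ q a u α = arcFactor u * (q : ℂ)⁻¹ * ∑' n : ℤ, quadGauss q a n *
      cexp (-((Real.pi * Λ ^ 2 / (2 * q ^ 2) : ℝ) / (1 - I * u)) * ((q * α + n : ℝ) : ℂ) ^ 2) := by
  have hqpos : (0 : ℝ) < q := by exact_mod_cast Nat.pos_of_ne_zero (NeZero.ne q)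
  have hq0 : (q : ℂ) ≠ 0 := by exact_mod_cast NeZero.ne q
  have hΛ0 : (Λ : ℂ) ≠ 0 := by exact_mod_cast hΛ.ne'
  have h1 := one_sub_I_mul_ne_zero u
  unfold normTheta
  have hz : 0 < ((1 - I * u) / Λ ^ 2 : ℂ).re := by
    rw [← ofReal_pow, div_ofReal_re]
    simp; positivity
  rw [tsum_thetaTerm_eq q a hz]
  have hb : (Real.pi / (2 * ((1 - I * u) / Λ ^ 2) * q ^ 2) : ℂ) =
      (Real.pi * Λ ^ 2 / (2 * q ^ 2) : ℝ) / (1 - I * u) := by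
    push_cast; field_simp
  rw [hb, ← mul_assoc]
  congr 1
  have hm : (2 * ((1 - I * u) / Λ ^ 2) * q ^ 2 : ℂ) = (((q / Λ) ^ 2 : ℝ) : ℂ) * (2 * (1 - I * u)) := by
    push_cast; field_simp
  -- The positive real factor (q/Λ)² may leave the complex square root without a branch problem.
  have hc : (2 * ((1 - I * u) / Λ ^ 2) * q ^ 2 : ℂ) ^ (1 / 2 : ℂ) =
      ((q / Λ : ℝ) : ℂ) * (2 * (1 - I * u)) ^ (1 / 2 : ℂ) := by
    have h20 : (2 * (1 - I * u) : ℂ) ≠ 0 := mul_ne_zero two_ne_zero h1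
    have hr : 0 < q / Λ := by positivity
    have hr0 : (((q / Λ) ^ 2 : ℝ) : ℂ) ≠ 0 := by exact_mod_cast (pow_pos hr 2).ne'
    rw [hm, cpow_def_of_ne_zero (mul_ne_zero hr0 h20), cpow_def_of_ne_zero h20,
      Complex.log_ofReal_mul (pow_pos hr 2) h20, add_mul, Complex.exp_add, Real.log_pow]
    congr 1
    rw [show (((2 : ℕ) * Real.log (q / Λ) : ℝ) : ℂ) * (1 / 2) = ((Real.log (q / Λ) : ℝ) : ℂ) by
      push_cast; ring, ← Complex.ofReal_exp, Real.exp_log hr]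
  rw [hc, arcFactor]
  push_cast
  field_simp

/-- The constant in the approximation of `normTheta` by its dominant term. -/
def thetaConst : ℝ := 8 * invSqSum / Real.pi

theorem thetaConst_nonneg : 0 ≤ thetaConst := by
  have := invSqSum_nonneg
  unfold thetaConst; positivity

/-- Only the dual frequency nearest to -qα matters; the others cost the inverse real part of the
Gaussian parameter, which is O((q(1+|u|)/Λ)²). On a Dirichlet arc q(1+|u|)/Λ ≤ 2, so the error never
exceeds the size of the main term by more than a constant. -/
theorem norm_normTheta_sub_le {Λ : ℝ} (hΛ : 0 < Λ) (q : ℕ) [NeZero q] (a : ℤ)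
    (ha : IsUnit (a : ZMod q)) (u α : ℝ) :
    ‖normTheta Λ q a u α - arcFactor u * (q : ℂ)⁻¹ * (quadGauss q a (-round (q * α) : ℤ) *
      arcGauss Λ q u (q * α - round (q * α)))‖ ≤
      thetaConst * arcDecay q u * (q * (1 + |u|) / Λ) ^ 2 := by
  have hqpos : (0 : ℝ) < q := by exact_mod_cast Nat.pos_of_ne_zero (NeZero.ne q)
  have hb := re_ofReal_div_one_sub (Real.pi * Λ ^ 2 / (2 * q ^ 2)) u
  have hb0 : 0 < ((Real.pi * Λ ^ 2 / (2 * q ^ 2) : ℝ) / (1 - I * u) : ℂ).re := by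
    rw [hb]; have := Real.pi_pos; positivity
  have h := (norm_tsum_gaussian_sub_le hb0 (fun n : ℤ => norm_quadGauss_le q a n ha) (q * α)).2
  rw [normTheta_eq hΛ, arcGauss, ← mul_sub, norm_mul, norm_mul, norm_arcFactor, norm_inv,
    Complex.norm_natCast]
  refine (mul_le_mul_of_nonneg_left h (by positivity)).trans ?_
  rw [hb]
  have hq : (q : ℝ)⁻¹ * √q = (q : ℝ) ^ (-(1 / 2) : ℝ) := by
    rw [Real.sqrt_eq_rpow, ← Real.rpow_neg_one, ← Real.rpow_add hqpos]; norm_num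
  have h2 : (2 : ℝ) ^ (-(1 / 2) : ℝ) * √2 = 1 := by
    rw [Real.sqrt_eq_rpow, ← Real.rpow_add (by norm_num)]; norm_num
  have hZ := invSqSum_nonneg
  have hu : 1 + u ^ 2 ≤ (1 + |u|) ^ 2 := by nlinarith [sq_abs u, abs_nonneg u]
  calc _ = ((2 : ℝ) ^ (-(1 / 2) : ℝ) * √2) * ((q : ℝ)⁻¹ * √q) * (1 + u ^ 2) ^ (-(1 / 4) : ℝ) *
        (8 * invSqSum / Real.pi) * (q ^ 2 * (1 + u ^ 2) / Λ ^ 2) := by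
        have := Real.pi_pos
        field_simp; ring
    _ ≤ (8 * invSqSum / Real.pi) * arcDecay q u * (q ^ 2 * (1 + |u|) ^ 2 / Λ ^ 2) := by
        rw [hq, h2, arcDecay, one_mul, mul_comm (8 * invSqSum / Real.pi)]
        have := Real.pi_pos
        gcongr
    _ = _ := by rw [thetaConst]; ring

theorem norm_arcFactor_mul_quadGauss_le (q : ℕ) [NeZero q] (a : ZMod q) (ha : IsUnit a)
    (n : ZMod q) (u : ℝ) : ‖arcFactor u * (q : ℂ)⁻¹ * quadGauss q a n‖ ≤ arcDecay q u := by
  have hqpos : (0 : ℝ) < q := by exact_mod_cast Nat.pos_of_ne_zero (NeZero.ne q)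
  rw [norm_mul, norm_mul, norm_arcFactor, norm_inv, Complex.norm_natCast]
  have h := norm_quadGauss_le q a n ha
  refine (mul_le_mul_of_nonneg_left h (by positivity)).trans (le_of_eq ?_)
  have hq : (q : ℝ)⁻¹ * √q = (q : ℝ) ^ (-(1 / 2) : ℝ) := by
    rw [Real.sqrt_eq_rpow, ← Real.rpow_neg_one, ← Real.rpow_add hqpos]; norm_num
  have h2 : (2 : ℝ) ^ (-(1 / 2) : ℝ) * √2 = 1 := by
    rw [Real.sqrt_eq_rpow, ← Real.rpow_add (by norm_num)]; norm_num
  rw [arcDecay, ← hq]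
  linear_combination ((q : ℝ)⁻¹ * √q * (1 + u ^ 2) ^ (-(1 / 4) : ℝ)) * h2

theorem norm_arcGauss (Λ : ℝ) (q : ℕ) (u x : ℝ) :
    ‖arcGauss Λ q u x‖ = Real.exp (-(Real.pi / 2 * (Λ * |x| / q) ^ 2 / (1 + u ^ 2))) := by
  rw [arcGauss, norm_cexp_neg_mul_ofReal_sq, re_ofReal_div_one_sub]
  congr 1
  rw [div_pow, mul_pow, sq_abs]
  ring

theorem norm_arcGauss_le_one (Λ : ℝ) (q : ℕ) (u x : ℝ) : ‖arcGauss Λ q u x‖ ≤ 1 := by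
  rw [norm_arcGauss, Real.exp_le_one_iff, neg_nonpos]
  have := Real.pi_pos
  positivity

theorem norm_arcGauss_le_div {Λ : ℝ} (q : ℕ) (u x : ℝ) (hY : 0 < Λ * |x| / q) :
    ‖arcGauss Λ q u x‖ ≤ (1 + |u|) * (Λ * |x| / q)⁻¹ := by
  rw [norm_arcGauss]
  set Y := Λ * |x| / q
  have hu : 1 + u ^ 2 ≤ (1 + |u|) ^ 2 := by nlinarith [sq_abs u, abs_nonneg u]
  have hu0 : 0 < 1 + |u| := by positivity
  set s := Real.pi / 2 * Y ^ 2 / (1 + u ^ 2)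
  have hs : (Y / (1 + |u|)) ^ 2 ≤ s := by
    rw [div_pow]
    have h3 := Real.pi_gt_three
    have : Y ^ 2 ≤ Real.pi / 2 * Y ^ 2 := by nlinarith [sq_nonneg Y]
    exact div_le_div₀ (by positivity) this (by positivity) hu
  have h1 : Y / (1 + |u|) ≤ Real.exp s := by
    nlinarith [Real.add_one_le_exp s, sq_nonneg (Y / (1 + |u|) - 1)]
  rw [Real.exp_neg, ← div_eq_mul_inv, ← inv_div]
  exact inv_anti₀ (by positivity) h1

theorem norm_cexp_neg_sub_one_le {w : ℂ} (hw : ‖w‖ ≤ 1) : ‖cexp (-w) - 1‖ ≤ 2 * ‖w‖ := by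
  have := Complex.norm_exp_sub_one_le (x := -w) (by rwa [norm_neg])
  rwa [norm_neg] at this

/-- For small Y = Λ|x|/q both Gaussians are within O(Y²) of 1, and for large Y each is O((1+|u|)/Y).
The decay at both ends makes the differences square-summable over dyadic Λ. -/
theorem norm_arcGauss_sub_le {Λ : ℝ} (hΛ : 0 < Λ) (q : ℕ) [NeZero q] (u x : ℝ) :
    ‖arcGauss Λ q u x - arcGauss Λ q 0 x‖ ≤
      8 * ((1 + |u|) * min (Λ * |x| / q) (Λ * |x| / q)⁻¹) := by
  have hqpos : (0 : ℝ) < q := by exact_mod_cast Nat.pos_of_ne_zero (NeZero.ne q)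
  have hu1 : 1 ≤ 1 + |u| := by linarith [abs_nonneg u]
  set Y := Λ * |x| / q with hYd
  rcases eq_or_ne x 0 with rfl | hx
  · simp [arcGauss, hYd]
  have hY : 0 < Y := by have := abs_pos.2 hx; positivity
  have hG1 := norm_arcGauss_le_div q u x hY
  have hG2 := norm_arcGauss_le_div q 0 x hY
  have hN1 := norm_arcGauss_le_one Λ q u x
  have hN2 := norm_arcGauss_le_one Λ q 0 x
  rw [abs_zero, add_zero, one_mul] at hG2
  have htri := norm_sub_le (arcGauss Λ q u x) (arcGauss Λ q 0 x)
  have hlarge : ‖arcGauss Λ q u x - arcGauss Λ q 0 x‖ ≤ 8 * ((1 + |u|) * Y⁻¹) := by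
    have hYi : 0 < Y⁻¹ := inv_pos.2 hY
    nlinarith
  have hsmall : ‖arcGauss Λ q u x - arcGauss Λ q 0 x‖ ≤ 8 * Y := by
    by_cases h : Real.pi / 2 * Y ^ 2 ≤ 1
    · have key : ∀ v : ℝ, ‖arcGauss Λ q v x - 1‖ ≤ 2 * (Real.pi / 2 * Y ^ 2) := by
        intro v
        set w : ℂ := ((Real.pi * Λ ^ 2 / (2 * q ^ 2) : ℝ) / (1 - I * v)) * (x : ℂ) ^ 2 with hw
        have hwn : ‖w‖ ≤ Real.pi / 2 * Y ^ 2 := by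
          rw [hw, norm_mul, norm_div, norm_pow, Complex.norm_real, Complex.norm_real,
            norm_one_sub_I_mul, Real.norm_eq_abs, Real.norm_eq_abs]
          have h1 : 1 ≤ (1 + v ^ 2) ^ (1 / 2 : ℝ) :=
            Real.one_le_rpow (by nlinarith [sq_nonneg v]) (by norm_num)
          have h2 : |Real.pi * Λ ^ 2 / (2 * q ^ 2)| = Real.pi * Λ ^ 2 / (2 * q ^ 2) :=
            abs_of_nonneg (by have := Real.pi_pos; positivity)
          rw [h2]
          calc _ ≤ Real.pi * Λ ^ 2 / (2 * q ^ 2) * |x| ^ 2 := by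
                exact mul_le_mul_of_nonneg_right
                  (div_le_self (by have := Real.pi_pos; positivity) h1) (by positivity)
            _ = _ := by rw [hYd]; field_simp
        have := norm_cexp_neg_sub_one_le (hwn.trans h)
        rw [arcGauss, neg_mul]
        exact this.trans (by gcongr)
      have h3 := norm_sub_le (arcGauss Λ q u x - 1) (arcGauss Λ q 0 x - 1)
      rw [sub_sub_sub_cancel_right] at h3
      have h4 := key u
      have h5 := key 0
      have hp := Real.pi_gt_three
      have hp4 := Real.pi_le_four
      have hY1 : Y ≤ 1 := by nlinarith
      have : Real.pi * Y ^ 2 ≤ 4 * Y := by nlinarith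
      linarith
    · push Not at h
      have hp4 := Real.pi_le_four
      have : 1 / 2 ≤ Y := by nlinarith
      linarith
  rcases min_choice Y Y⁻¹ with h | h <;> rw [h]
  · nlinarith
  · exact hlarge

theorem arc_delta_le_two {Λ : ℝ} {q : ℕ} {u : ℝ} (hΛ : 0 < Λ) (hqΛ : q ≤ Λ)
    (huΛ : q * |u| ≤ Λ) : q * (1 + |u|) / Λ ≤ 2 := by
  rw [div_le_iff₀ hΛ]; linarith

section ArcEstimates

variable {Λ : ℝ} {q : ℕ} [NeZero q] {a : ℤ} {u : ℝ}

theorem norm_normTheta_le (hΛ : 0 < Λ) (ha : IsUnit (a : ZMod q)) (hqΛ : q ≤ Λ)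
    (huΛ : q * |u| ≤ Λ) (α : ℝ) :
    ‖normTheta Λ q a u α‖ ≤ (1 + 4 * thetaConst) * arcDecay q u := by
  have h := norm_normTheta_sub_le hΛ q a ha u α
  have h1 := norm_arcFactor_mul_quadGauss_le q a ha (-round (q * α) : ℤ) u
  have h2 := norm_arcGauss_le_one Λ q u (q * α - round (q * α))
  have hd := arc_delta_le_two hΛ hqΛ huΛ
  have hd0 : 0 ≤ q * (1 + |u|) / Λ := by positivity
  have hB := arcDecay_pos q u
  have hT := thetaConst_nonneg
  rw [← mul_assoc] at h
  have h3 := norm_le_norm_add_norm_sub' (normTheta Λ q a u α)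
    (arcFactor u * (q : ℂ)⁻¹ * quadGauss q a (-round (q * α) : ℤ) *
      arcGauss Λ q u (q * α - round (q * α)))
  rw [norm_mul (_ * _ * _)] at h3
  have h4 := mul_le_mul h1 h2 (norm_nonneg _) hB.le
  have h5 : (q * (1 + |u|) / Λ) ^ 2 ≤ 4 := by nlinarith
  have h6 := mul_le_mul_of_nonneg_left h5 (mul_nonneg hT hB.le)
  linarith

/-- Away from q⁻¹ℤ the Gaussian itself is small. This is the gain exploited for denominators q ≤
η⁻². -/
theorem norm_normTheta_le_decay (hΛ : 0 < Λ) (ha : IsUnit (a : ZMod q)) (hqΛ : q ≤ Λ)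
    (huΛ : q * |u| ≤ Λ) {α : ℝ} (hα : 0 < |q * α - round (q * α)|) :
    ‖normTheta Λ q a u α‖ ≤ (1 + 2 * thetaConst) * arcDecay q u *
      ((1 + |u|) * (Λ * |q * α - round (q * α)| / q)⁻¹ + q * (1 + |u|) / Λ) := by
  have hqpos : (0 : ℝ) < q := by exact_mod_cast Nat.pos_of_ne_zero (NeZero.ne q)
  have h := norm_normTheta_sub_le hΛ q a ha u α
  have h1 := norm_arcFactor_mul_quadGauss_le q a ha (-round (q * α) : ℤ) u
  have h2 := norm_arcGauss_le_div q u (q * α - round (q * α)) (Λ := Λ) (by positivity)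
  have hd := arc_delta_le_two hΛ hqΛ huΛ
  have hd0 : 0 ≤ q * (1 + |u|) / Λ := by positivity
  have hB := arcDecay_pos q u
  have hT := thetaConst_nonneg
  rw [← mul_assoc] at h
  have h3 := norm_le_norm_add_norm_sub' (normTheta Λ q a u α)
    (arcFactor u * (q : ℂ)⁻¹ * quadGauss q a (-round (q * α) : ℤ) *
      arcGauss Λ q u (q * α - round (q * α)))
  rw [norm_mul (_ * _ * _)] at h3
  have h4 := mul_le_mul h1 h2 (norm_nonneg _) hB.le
  set δ := q * (1 + |u|) / Λ
  set m := (1 + |u|) * (Λ * |q * α - round (q * α)| / q)⁻¹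
  have hm : 0 ≤ m := by positivity
  have h5 : δ ^ 2 ≤ 2 * δ := by nlinarith
  have h6 := mul_le_mul_of_nonneg_left h5 (mul_nonneg hT hB.le)
  have h7 : 0 ≤ thetaConst * arcDecay q u * m := by positivity
  have h8 : 0 ≤ arcDecay q u * δ := by positivity
  nlinarith

/-- The periodic Gaussian multiplier of the averages over `q ℤ` at scale `Λ`. -/
def progTheta (Λ : ℝ) (q : ℕ) (α : ℝ) : ℂ := normTheta (Λ / q) 1 0 0 (q * α)

theorem quadGauss_one (a n : ZMod 1) : quadGauss 1 a n = 1 := by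
  unfold quadGauss
  rw [Fintype.sum_subsingleton _ 0, Subsingleton.elim (a * 0 ^ 2 + 0 * n) 0, AddChar.map_zero_eq_one]

theorem arcDecay_one_zero : arcDecay 1 0 = 1 := by simp [arcDecay]

theorem norm_progTheta_sub_le (hΛ : 0 < Λ) (α : ℝ) :
    ‖progTheta Λ q α - arcFactor 0 * arcGauss Λ q 0 (q * α - round (q * α))‖ ≤
      thetaConst * (q / Λ) ^ 2 := by
  have hqpos : (0 : ℝ) < q := by exact_mod_cast Nat.pos_of_ne_zero (NeZero.ne q)
  have h := norm_normTheta_sub_le (Λ := Λ / q) (by positivity) 1 0 (isUnit_of_subsingleton _) 0 (q * α)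
  rw [quadGauss_one, arcDecay_one_zero] at h
  simp only [Nat.cast_one, one_mul, inv_one, mul_one, abs_zero, add_zero, one_div_div] at h
  have hg : ∀ x : ℝ, arcGauss (Λ / q) 1 0 x = arcGauss Λ q 0 x := by
    intro x
    rw [arcGauss, arcGauss, show Real.pi * (Λ / q) ^ 2 / (2 * ((1 : ℕ) : ℝ) ^ 2) =
      Real.pi * Λ ^ 2 / (2 * q ^ 2) by push_cast; field_simp]
  rwa [hg] at h

theorem norm_progTheta_le (hΛ : 0 < Λ) (hqΛ : q ≤ Λ) (α : ℝ) :
    ‖progTheta Λ q α‖ ≤ 1 + 4 * thetaConst := by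
  have hqpos : (0 : ℝ) < q := by exact_mod_cast Nat.pos_of_ne_zero (NeZero.ne q)
  have h := norm_normTheta_le (Λ := Λ / q) (q := 1) (a := 0) (u := 0) (by positivity)
    (isUnit_of_subsingleton _) (by rw [Nat.cast_one, le_div_iff₀ hqpos]; linarith)
    (by simp; positivity) (q * α)
  rwa [arcDecay_one_zero, mul_one] at h

theorem norm_arcFactor_zero : ‖arcFactor 0‖ = (√2)⁻¹ := by
  rw [norm_arcFactor, Real.sqrt_eq_rpow, ← Real.rpow_neg (by norm_num)]
  simp

theorem norm_arcRatio_mul_quadGauss_le (ha : IsUnit (a : ZMod q)) (n : ZMod q) :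
    ‖arcFactor u / arcFactor 0 * (q : ℂ)⁻¹ * quadGauss q a n‖ ≤ 2 * arcDecay q u := by
  have h := norm_arcFactor_mul_quadGauss_le q a ha n u
  rw [show arcFactor u / arcFactor 0 * (q : ℂ)⁻¹ * quadGauss q a n =
    (arcFactor u * (q : ℂ)⁻¹ * quadGauss q a n) / arcFactor 0 by ring, norm_div,
    norm_arcFactor_zero, div_inv_eq_mul, mul_comm]
  have h2 : √2 ≤ 2 := by rw [Real.sqrt_le_left (by norm_num)]; norm_num
  exact mul_le_mul h2 h (norm_nonneg _) (by norm_num)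

/-- The parameter u is moved out of the Gaussian into a scalar factor. What remains depends on Λ
only through `progTheta`, the symbol of a positive kernel, so a maximal theorem for positive
averages can be used. -/
theorem norm_normTheta_sub_progTheta_le (hΛ : 0 < Λ) (ha : IsUnit (a : ZMod q)) (hqΛ : q ≤ Λ)
    (huΛ : q * |u| ≤ Λ) (α : ℝ) :
    ‖normTheta Λ q a u α - arcFactor u / arcFactor 0 * (q : ℂ)⁻¹ *
        quadGauss q a (-round (q * α) : ℤ) * progTheta Λ q α‖ ≤
      (8 + 4 * thetaConst) * arcDecay q u *
      ((1 + |u|) * (min (Λ * |q * α - round (q * α)| / q) (Λ * |q * α - round (q * α)| / q)⁻¹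
        + q / Λ)) := by
  have hqpos : (0 : ℝ) < q := by exact_mod_cast Nat.pos_of_ne_zero (NeZero.ne q)
  have h1 := norm_normTheta_sub_le hΛ q a ha u α
  have h2 := norm_arcFactor_mul_quadGauss_le q a ha (-round (q * α) : ℤ) u
  have h3 := norm_arcGauss_sub_le hΛ q u (q * α - round (q * α))
  have h4 := norm_arcRatio_mul_quadGauss_le (u := u) ha (-round (q * α) : ℤ)
  have h5 := norm_progTheta_sub_le (q := q) hΛ α
  have hd := arc_delta_le_two hΛ hqΛ huΛ
  have hd0 : 0 ≤ q * (1 + |u|) / Λ := by positivity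
  have hB := arcDecay_pos q u
  have hT := thetaConst_nonneg
  have hf0 : arcFactor 0 ≠ 0 := by
    rw [← norm_ne_zero_iff, norm_arcFactor_zero]; positivity
  set G := quadGauss q a (-round (q * α) : ℤ)
  set x := q * α - round (q * α)
  -- Three errors: theta series against its main term, Gaussian at u against Gaussian at 0, and the
  -- same main-term approximation for `progTheta`.
  have e1 : normTheta Λ q a u α - arcFactor u / arcFactor 0 * (q : ℂ)⁻¹ * G * progTheta Λ q α =
      (normTheta Λ q a u α - arcFactor u * (q : ℂ)⁻¹ * (G * arcGauss Λ q u x)) +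
      (arcFactor u * (q : ℂ)⁻¹ * G) * (arcGauss Λ q u x - arcGauss Λ q 0 x) -
      (arcFactor u / arcFactor 0 * (q : ℂ)⁻¹ * G) *
        (progTheta Λ q α - arcFactor 0 * arcGauss Λ q 0 x) := by
    field_simp
    ring
  rw [e1]
  refine (norm_sub_le _ _).trans ((add_le_add_left (norm_add_le _ _) _).trans ?_)
  rw [norm_mul (_ * _ * _), norm_mul (_ * _ * _)]
  have h6 := mul_le_mul h2 h3 (norm_nonneg _) hB.le
  have h7 := mul_le_mul h4 h5 (norm_nonneg _) (by positivity)
  set m := min (Λ * |x| / q) (Λ * |x| / q)⁻¹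
  have hm : 0 ≤ m := by simp only [m]; positivity
  set s := (q : ℝ) / Λ with hs
  have hs0 : 0 ≤ s := by positivity
  have hs1 : s ≤ 1 := by rw [hs, div_le_one hΛ]; exact hqΛ
  have hds : q * (1 + |u|) / Λ = (1 + |u|) * s := by rw [hs]; ring
  rw [hds] at h1 hd hd0
  have hu1 : 1 ≤ 1 + |u| := by linarith [abs_nonneg u]
  have h8 : ((1 + |u|) * s) ^ 2 ≤ 2 * ((1 + |u|) * s) := by nlinarith
  have h9 : s ^ 2 ≤ (1 + |u|) * s := by nlinarith
  have h10 := mul_le_mul_of_nonneg_left h8 (mul_nonneg hT hB.le)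
  have h11 := mul_le_mul_of_nonneg_left h9 (mul_nonneg hT hB.le)
  have h12 : 0 ≤ thetaConst * arcDecay q u * ((1 + |u|) * m) := by positivity
  have h13 : 0 ≤ arcDecay q u * ((1 + |u|) * s) := by positivity
  nlinarith

end ArcEstimates

end

/-! ### The ℓ² norm of non-negative functions and an abstract maximal inequality -/

noncomputable section

open scoped NNReal

section LatticeNorm

variable {d : ℕ}

theorem latticeL2Norm_sq (g : (Fin d → ℤ) → ℝ≥0∞) : latticeL2Norm g ^ 2 = ∑' n, g n ^ 2 := by
  rw [latticeL2Norm, ← ENNReal.rpow_two, ← ENNReal.rpow_mul]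
  norm_num

theorem latticeL2Norm_le_iff {g : (Fin d → ℤ) → ℝ≥0∞} {c : ℝ≥0∞} :
    latticeL2Norm g ≤ c ↔ ∑' n, g n ^ 2 ≤ c ^ 2 := by
  rw [← latticeL2Norm_sq]
  exact (ENNReal.pow_le_pow_left_iff two_ne_zero).symm

theorem latticeL2Norm_mono {f g : (Fin d → ℤ) → ℝ≥0∞} (h : ∀ n, f n ≤ g n) :
    latticeL2Norm f ≤ latticeL2Norm g := by
  rw [latticeL2Norm_le_iff, latticeL2Norm_sq]
  exact ENNReal.tsum_le_tsum fun n => pow_le_pow_left₀ (zero_le) (h n) 2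

theorem latticeL2Norm_const_mul (c : ℝ≥0∞) (g : (Fin d → ℤ) → ℝ≥0∞) :
    latticeL2Norm (fun n => c * g n) = c * latticeL2Norm g := by
  have h : latticeL2Norm (fun n => c * g n) ^ 2 = (c * latticeL2Norm g) ^ 2 := by
    simp only [mul_pow, latticeL2Norm_sq, ENNReal.tsum_mul_left]
  exact le_antisymm ((ENNReal.pow_le_pow_left_iff two_ne_zero).1 h.le)
    ((ENNReal.pow_le_pow_left_iff two_ne_zero).1 h.ge)

theorem tsum_mul_le_latticeL2Norm (f g : (Fin d → ℤ) → ℝ≥0∞) :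
    ∑' n, f n * g n ≤ latticeL2Norm f * latticeL2Norm g := by
  have h := ENNReal.lintegral_mul_le_Lp_mul_Lq (Measure.count (α := Fin d → ℤ))
    Real.HolderConjugate.two_two (f := f) (g := g)
    (measurable_of_countable _).aemeasurable (measurable_of_countable _).aemeasurable
  simp only [lintegral_count, Pi.mul_apply, ENNReal.rpow_two] at h
  exact h

/-- Minkowski's integral inequality: expand the square as a double integral and apply Cauchy–Schwarz
in n to each pair x, y. -/
theorem latticeL2Norm_lintegral_le {X : Type*} [MeasurableSpace X] (μ : Measure X)
    {G : X → (Fin d → ℤ) → ℝ≥0∞} (hG : ∀ n, Measurable fun x => G x n) :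
    latticeL2Norm (fun n => ∫⁻ x, G x n ∂μ) ≤ ∫⁻ x, latticeL2Norm (G x) ∂μ := by
  have hm : Measurable fun x => latticeL2Norm (G x) := by
    unfold latticeL2Norm
    exact (Measurable.tsum fun n => (hG n).pow_const 2).pow_const _
  rw [latticeL2Norm_le_iff]
  calc ∑' n, (∫⁻ x, G x n ∂μ) ^ 2 = ∑' n, ∫⁻ x, ∫⁻ y, G x n * G y n ∂μ ∂μ := by
        refine tsum_congr fun n => ?_
        simp_rw [lintegral_const_mul _ (hG n)]
        rw [lintegral_mul_const _ (hG n), sq]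
    _ = ∫⁻ x, ∑' n, ∫⁻ y, G x n * G y n ∂μ ∂μ := by
        rw [lintegral_tsum]
        intro n
        simp_rw [lintegral_const_mul _ (hG n)]
        exact ((hG n).mul_const _).aemeasurable
    _ = ∫⁻ x, ∫⁻ y, ∑' n, G x n * G y n ∂μ ∂μ := by
        refine lintegral_congr fun x => ?_
        rw [lintegral_tsum]
        exact fun n => ((hG n).const_mul _).aemeasurable
    _ ≤ ∫⁻ x, ∫⁻ y, latticeL2Norm (G x) * latticeL2Norm (G y) ∂μ ∂μ :=
        lintegral_mono fun x => lintegral_mono fun y => tsum_mul_le_latticeL2Norm _ _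
    _ = _ := by
        simp_rw [lintegral_const_mul _ hm]
        rw [lintegral_mul_const _ hm, sq]

theorem latticeL2Norm_tsum_le {ι : Type*} [Countable ι] (G : ι → (Fin d → ℤ) → ℝ≥0∞) :
    latticeL2Norm (fun n => ∑' i, G i n) ≤ ∑' i, latticeL2Norm (G i) := by
  let _ : MeasurableSpace ι := ⊤
  have h := latticeL2Norm_lintegral_le (Measure.count (α := ι)) (G := G)
    (fun n => measurable_of_countable _)
  simpa only [lintegral_count] using h

theorem latticeL2Norm_add_le (f g : (Fin d → ℤ) → ℝ≥0∞) :
    latticeL2Norm (fun n => f n + g n) ≤ latticeL2Norm f + latticeL2Norm g := by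
  have h := latticeL2Norm_tsum_le (fun b : Bool => if b then f else g)
  simpa [tsum_fintype] using h

theorem latticeL2Norm_iSup_le {ι : Type*} [Countable ι] (G : ι → (Fin d → ℤ) → ℝ≥0∞) :
    latticeL2Norm (fun n => ⨆ i, G i n) ^ 2 ≤ ∑' i, latticeL2Norm (G i) ^ 2 := by
  simp_rw [latticeL2Norm_sq]
  rw [ENNReal.tsum_comm]
  refine ENNReal.tsum_le_tsum fun n => ?_
  have : ⨆ i, G i n ≤ (∑' i, G i n ^ 2) ^ (1 / 2 : ℝ) := by
    refine iSup_le fun i => ?_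
    rw [one_div, ENNReal.le_rpow_inv_iff (by norm_num), ENNReal.rpow_two]
    exact ENNReal.le_tsum i
  rwa [one_div, ENNReal.le_rpow_inv_iff (by norm_num), ENNReal.rpow_two] at this

theorem latticeL2Norm_translate (f : (Fin d → ℤ) → ℝ≥0∞) (m : Fin d → ℤ) :
    latticeL2Norm (fun n => f (n - m)) = latticeL2Norm f := by
  unfold latticeL2Norm
  rw [← (Equiv.subRight m).tsum_eq fun n => f n ^ 2]
  rfl

/-- Convolution of `[0, ∞]`-valued functions on `ℤ^d`. -/
def latticeConv (p f : (Fin d → ℤ) → ℝ≥0∞) (n : Fin d → ℤ) : ℝ≥0∞ := ∑' m, p m * f (n - m)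

theorem latticeConv_eq (p f : (Fin d → ℤ) → ℝ≥0∞) (n : Fin d → ℤ) :
    latticeConv p f n = ∑' m, p (n - m) * f m := by
  unfold latticeConv
  rw [← (Equiv.subLeft n).tsum_eq]
  simp

theorem latticeL2Norm_latticeConv_le (p f : (Fin d → ℤ) → ℝ≥0∞) :
    latticeL2Norm (latticeConv p f) ≤ (∑' m, p m) * latticeL2Norm f := by
  refine (latticeL2Norm_tsum_le fun m n => p m * f (n - m)).trans (le_of_eq ?_)
  simp_rw [latticeL2Norm_const_mul, latticeL2Norm_translate, ENNReal.tsum_mul_right]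

/-- The bootstrapping step for `latticeL2Norm_maximal_le`. -/
theorem latticeL2Norm_finiteMaximal_bootstrap {p : ℕ → (Fin d → ℤ) → ℝ≥0∞} {A : ℝ≥0}
    (hsymm : ∀ j m, p j (-m) = p j m) (hmass : ∀ j, ∑' m, p j m ≤ A)
    (hconv : ∀ j k, j ≤ k → ∀ m, latticeConv (p j) (p k) m ≤ A * p (k + 1) m) (N : ℕ) {K : ℝ≥0}
    (hK : ∀ f, latticeL2Norm (fun n => (Finset.range (N + 1)).sup fun j => latticeConv (p j) f n) ≤
      K * latticeL2Norm f) (f : (Fin d → ℤ) → ℝ≥0∞) :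
    latticeL2Norm (fun n => (Finset.range (N + 1)).sup fun j => latticeConv (p j) f n) ≤
      (K / 4 + 9 * A / 4 : ℝ≥0) * latticeL2Norm f := by
  set K' : ℝ≥0 := K / 4 + 9 * A / 4 with hK'
  -- The final cancellation needs the norm of F to be finite, hence that of f. If the latter is
  -- infinite, the claim is trivial unless K' = 0, and then K = 0 too.
  rcases eq_or_ne (latticeL2Norm f) ∞ with hf | hf
  · rcases eq_or_ne K' 0 with h0 | h0
    · have hK0 : K = 0 := by
        have h1 : K / 4 ≤ K' := by rw [hK']; exact le_add_of_nonneg_right (zero_le)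
        rw [h0] at h1
        simpa using h1
      refine (hK f).trans ?_
      rw [h0, hK0]
    · rw [hf, ENNReal.mul_top (by exact_mod_cast h0)]; exact le_top
  set M : ((Fin d → ℤ) → ℝ≥0∞) → (Fin d → ℤ) → ℝ≥0∞ :=
    fun f n => (Finset.range (N + 1)).sup fun j => latticeConv (p j) f n with hM
  set F := M f with hF
  have hFtop : latticeL2Norm F ≠ ∞ := ne_top_of_le_ne_top (ENNReal.mul_ne_top (by simp) hf) (hK f)
  -- Linearisation: J(n) is an index at which the finite maximum is attained.
  have hex : ∀ n, ∃ j ∈ Finset.range (N + 1), F n = latticeConv (p j) f n := fun n =>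
    Finset.exists_mem_eq_sup _ ⟨0, by simp⟩ _
  choose J hJ hJF using hex
  -- H is the adjoint of the linearised operator applied to F, so that ‖F‖² = ⟨f, H⟩.
  set H : (Fin d → ℤ) → ℝ≥0∞ := fun m => ∑' n, F n * p (J n) (n - m) with hH
  have h1 : latticeL2Norm F ^ 2 ≤ latticeL2Norm f * latticeL2Norm H := by
    refine le_trans (le_of_eq ?_) (tsum_mul_le_latticeL2Norm f H)
    rw [latticeL2Norm_sq]
    calc ∑' n, F n ^ 2 = ∑' n, ∑' m, f m * (F n * p (J n) (n - m)) := by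
          refine tsum_congr fun n => ?_
          rw [sq]
          nth_rw 2 [hJF n]
          rw [latticeConv_eq, ← ENNReal.tsum_mul_left]
          exact tsum_congr fun m => by ring
      _ = _ := by
          rw [ENNReal.tsum_comm]
          exact tsum_congr fun m => by rw [hH, ENNReal.tsum_mul_left]
  -- The kernel of the linearised operator times its adjoint is bounded by two kernels, each
  -- depending on only one of J(n), J(n'). Applied to F, each is again a value of the maximal
  -- function, now at the index J(n) + 1.
  have hker : ∀ n n', ∑' m, p (J n) (n - m) * p (J n') (n' - m) ≤
      A * (p (J n + 1) (n - n') + p (J n' + 1) (n - n')) := by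
    have aux : ∀ j k, j ≤ k → ∀ n n', ∑' m, p j (n - m) * p k (n' - m) ≤ A * p (k + 1) (n - n') := by
      intro j k hjk n n'
      refine le_trans (le_of_eq ?_) (hconv j k hjk (n - n'))
      unfold latticeConv
      rw [← (Equiv.subLeft n).tsum_eq]
      refine tsum_congr fun r => ?_
      simp only [Equiv.subLeft_apply, sub_sub_cancel]
      rw [← hsymm k (n - n' - r)]
      congr 2
      abel
    intro n n'
    rcases le_total (J n) (J n') with h | h
    · exact (aux _ _ h n n').trans (by gcongr; exact le_add_self)
    · have := aux _ _ h n' n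
      rw [← neg_sub n n', hsymm] at this
      refine le_trans (le_of_eq ?_) (this.trans (by gcongr; exact le_self_add))
      exact tsum_congr fun m => mul_comm _ _
  have h2 : latticeL2Norm H ^ 2 ≤ 2 * A * (K + A) * latticeL2Norm F ^ 2 := by
    rw [latticeL2Norm_sq]
    -- The shift leaves the range only when J(n) = N; one extra convolution pays for that.
    have hnext : ∀ n, latticeConv (p (J n + 1)) F n ≤ M F n + latticeConv (p (N + 1)) F n := by
      intro n
      rcases Nat.lt_or_ge (J n) N with h | h
      · refine le_trans ?_ le_self_add
        exact Finset.le_sup (f := fun j => latticeConv (p j) F n) (by simp; omega)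
      · have : J n = N := by have := Finset.mem_range.1 (hJ n); omega
        rw [this]; exact le_add_self
    calc ∑' m, H m ^ 2 = ∑' m, ∑' n, ∑' n', F n * F n' * (p (J n) (n - m) * p (J n') (n' - m)) := by
          refine tsum_congr fun m => ?_
          rw [sq, hH, ← ENNReal.tsum_mul_right]
          refine tsum_congr fun n => ?_
          rw [← ENNReal.tsum_mul_left]
          exact tsum_congr fun n' => by ring
      _ = ∑' n, ∑' n', F n * F n' * ∑' m, (p (J n) (n - m) * p (J n') (n' - m)) := by
          rw [ENNReal.tsum_comm]
          refine tsum_congr fun n => ?_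
          rw [ENNReal.tsum_comm]
          exact tsum_congr fun n' => by rw [ENNReal.tsum_mul_left]
      _ ≤ ∑' n, ∑' n', F n * F n' * (A * (p (J n + 1) (n - n') + p (J n' + 1) (n - n'))) :=
          ENNReal.tsum_le_tsum fun n => ENNReal.tsum_le_tsum fun n' => by
            gcongr; exact hker n n'
      _ = ∑' n, ∑' n', A * (F n * (p (J n + 1) (n - n') * F n')) +
          ∑' n, ∑' n', A * (F n' * (p (J n' + 1) (n' - n) * F n)) := by
          rw [← ENNReal.tsum_add]
          refine tsum_congr fun n => ?_
          rw [← ENNReal.tsum_add]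
          refine tsum_congr fun n' => ?_
          rw [← hsymm (J n' + 1) (n' - n), neg_sub]
          ring
      _ = 2 * (A * ∑' n, F n * latticeConv (p (J n + 1)) F n) := by
          rw [ENNReal.tsum_comm (f := fun n n' => A * (F n' * (p (J n' + 1) (n' - n) * F n))),
            ← two_mul]
          congr 1
          rw [← ENNReal.tsum_mul_left]
          refine tsum_congr fun n => ?_
          rw [ENNReal.tsum_mul_left, ENNReal.tsum_mul_left, latticeConv_eq]
      _ ≤ 2 * (A * (latticeL2Norm F * latticeL2Norm (fun n => M F n + latticeConv (p (N + 1)) F n))) := by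
          gcongr
          refine (ENNReal.tsum_le_tsum fun n => ?_).trans (tsum_mul_le_latticeL2Norm _ _)
          gcongr; exact hnext n
      _ ≤ 2 * (A * (latticeL2Norm F * (K * latticeL2Norm F + A * latticeL2Norm F))) := by
          gcongr
          refine (latticeL2Norm_add_le _ _).trans (add_le_add (hK F) ?_)
          refine (latticeL2Norm_latticeConv_le _ _).trans ?_
          gcongr; exact hmass _
      _ = _ := by ring
  have h3 : latticeL2Norm H ≤ K' * latticeL2Norm F := by
    refine (ENNReal.pow_le_pow_left_iff two_ne_zero).1 (h2.trans ?_)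
    rw [mul_pow]
    gcongr
    -- The difference is (K - 7A)²/16: K' is the tangent line at K = 7A to √(2A(K+A)). As a map of K
    -- it contracts with fixed point 3A.
    have : 2 * A * (K + A) ≤ K' ^ 2 := by
      rw [← NNReal.coe_le_coe, hK']
      push_cast
      nlinarith [sq_nonneg ((K : ℝ) - 7 * A), A.2, K.2]
    exact_mod_cast this
  rcases eq_or_ne (latticeL2Norm F) 0 with h0 | h0
  · change latticeL2Norm F ≤ _
    rw [h0]; exact zero_le
  · have h4 : latticeL2Norm F * latticeL2Norm F ≤ latticeL2Norm F * (K' * latticeL2Norm f) := by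
      rw [← sq]
      refine h1.trans ((mul_le_mul_right h3 _).trans (le_of_eq (by ring)))
    exact (ENNReal.mul_le_mul_iff_right h0 hFtop).1 h4

/-- A maximal inequality for a sequence of symmetric kernels whose convolutions are dominated by
the kernel following the later factor. -/
theorem latticeL2Norm_maximal_le {p : ℕ → (Fin d → ℤ) → ℝ≥0∞} {A : ℝ≥0} (hA : 0 < A)
    (hsymm : ∀ j m, p j (-m) = p j m) (hmass : ∀ j, ∑' m, p j m ≤ A)
    (hconv : ∀ j k, j ≤ k → ∀ m, latticeConv (p j) (p k) m ≤ A * p (k + 1) m)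
    (f : (Fin d → ℤ) → ℝ≥0∞) :
    latticeL2Norm (fun n => ⨆ j, latticeConv (p j) f n) ≤ 4 * A * latticeL2Norm f := by
  have hfin : ∀ (N : ℕ) (f : (Fin d → ℤ) → ℝ≥0∞),
      latticeL2Norm (fun n => (Finset.range (N + 1)).sup fun j => latticeConv (p j) f n) ≤
        (4 * A : ℝ≥0) * latticeL2Norm f := by
    intro N
    set V : Set ℝ≥0 := {K | ∀ f,
      latticeL2Norm (fun n => (Finset.range (N + 1)).sup fun j => latticeConv (p j) f n) ≤
        K * latticeL2Norm f} with hV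
    have hne : V.Nonempty := by
      refine ⟨(N + 1 : ℕ) * A, fun f => ?_⟩
      calc _ ≤ latticeL2Norm (fun n => ∑ j ∈ Finset.range (N + 1), latticeConv (p j) f n) :=
            latticeL2Norm_mono fun n => Finset.sup_le fun j hj =>
              Finset.single_le_sum (f := fun j => latticeConv (p j) f n) (fun _ _ => zero_le) hj
        _ ≤ ∑ j ∈ Finset.range (N + 1), latticeL2Norm (latticeConv (p j) f) := by
            have h := latticeL2Norm_tsum_le (fun (j : Finset.range (N + 1)) => latticeConv (p j) f)
            have e : ∀ n, ∑ j : Finset.range (N + 1), latticeConv (p j) f n =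
                ∑ j ∈ Finset.range (N + 1), latticeConv (p j) f n := fun n =>
              Finset.sum_coe_sort (Finset.range (N + 1)) (fun j => latticeConv (p j) f n)
            simpa only [tsum_fintype, e, Finset.sum_coe_sort (Finset.range (N + 1))
              (fun j => latticeL2Norm (latticeConv (p j) f))] using h
        _ ≤ ∑ j ∈ Finset.range (N + 1), A * latticeL2Norm f := by
            refine Finset.sum_le_sum fun j _ => (latticeL2Norm_latticeConv_le _ _).trans ?_
            gcongr; exact hmass j
        _ = _ := by simp [mul_assoc]
    have hstep : ∀ K ∈ V, K / 4 + 9 * A / 4 ∈ V := fun K hK f =>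
      latticeL2Norm_finiteMaximal_bootstrap hsymm hmass hconv N hK f
    have hlt : sInf V < 4 * A := by
      by_contra hcon
      push Not at hcon
      have hpos : 0 < sInf V := lt_of_lt_of_le (by positivity) hcon
      -- If inf V ≥ 4A, then 9A/4 ≤ (9/16) inf V. A K below (7/4) inf V improves to less than (7/16
      -- + 9/16) inf V, which contradicts the infimum.
      obtain ⟨K, hKV, hK⟩ := exists_lt_of_csInf_lt hne
        (show sInf V < 7 / 4 * sInf V by
          rw [← NNReal.coe_lt_coe]; push_cast
          have : (0 : ℝ) < (sInf V : ℝ≥0) := hpos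
          linarith)
      have h1 := csInf_le (OrderBot.bddBelow V) (hstep K hKV)
      have h1' : ((sInf V : ℝ≥0) : ℝ) ≤ K / 4 + 9 * A / 4 := NNReal.coe_le_coe.2 h1
      have h2' : (4 * A : ℝ) ≤ (sInf V : ℝ≥0) := NNReal.coe_le_coe.2 hcon
      have h3' : (K : ℝ) < 7 / 4 * (sInf V : ℝ≥0) := NNReal.coe_lt_coe.2 hK
      have : (0 : ℝ) < (sInf V : ℝ≥0) := hpos
      linarith
    obtain ⟨K, hKV, hK⟩ := exists_lt_of_csInf_lt hne hlt
    intro f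
    refine (hKV f).trans ?_
    gcongr
  rw [latticeL2Norm_le_iff]
  -- The finite bound is uniform in N, so monotone convergence passes to the full supremum.
  have hsup : ∀ n, (⨆ j, latticeConv (p j) f n) ^ 2 =
      ⨆ N, ((Finset.range (N + 1)).sup fun j => latticeConv (p j) f n) ^ 2 := by
    intro n
    have h1 : (⨆ j, latticeConv (p j) f n) =
        ⨆ N, (Finset.range (N + 1)).sup fun j => latticeConv (p j) f n :=
      le_antisymm (iSup_le fun j => le_iSup_of_le j
          (Finset.le_sup (f := fun j => latticeConv (p j) f n) (by simp)))
        (iSup_le fun N => Finset.sup_le fun j _ => le_iSup (fun j => latticeConv (p j) f n) j)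
    rw [h1, ENNReal.iSup_pow]
  simp_rw [hsup]
  rw [ENNReal.tsum_eq_iSup_sum]
  refine iSup_le fun s => ?_
  rw [ENNReal.finsetSum_iSup_of_monotone]
  · refine iSup_le fun N => ?_
    refine (ENNReal.sum_le_tsum s).trans ?_
    have := hfin N f
    rw [latticeL2Norm_le_iff] at this
    exact_mod_cast this
  · intro n N N' hN
    refine pow_le_pow_left₀ (zero_le) (Finset.sup_mono fun x hx => ?_) 2
    simp only [Finset.mem_range] at hx ⊢
    omega

end LatticeNorm

end

noncomputable section

open scoped NNReal

/-! ### Sums of products over `ℤ^d` -/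

theorem hasSum_pi_prod {d : ℕ} (f : Fin d → ℤ → ℂ) (hf : ∀ i, Summable fun m => ‖f i m‖) :
    (Summable fun m : Fin d → ℤ => ‖∏ i, f i (m i)‖) ∧
      ∑' m : Fin d → ℤ, ∏ i, f i (m i) = ∏ i, ∑' m, f i m := by
  induction d with
  | zero => exact ⟨summable_of_hasFiniteSupport (Set.toFinite _), by simp [tsum_fintype]⟩
  | succ d ih =>
    obtain ⟨h1, h2⟩ := ih (fun i => f i.succ) fun i => hf i.succ
    have h3 := summable_mul_of_summable_norm (hf 0).of_norm.norm h1.of_norm.norm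
    have h4 := tsum_mul_tsum_of_summable_norm (hf 0).of_norm.norm h1.of_norm.norm
    set e := Fin.consEquiv fun _ : Fin (d + 1) => ℤ
    have he : ∀ x : ℤ × (Fin d → ℤ), ∏ i, f i (e x i) = f 0 x.1 * ∏ i : Fin d, f i.succ (x.2 i) := by
      intro x
      rw [Fin.prod_univ_succ]
      simp [e]
    refine ⟨?_, ?_⟩
    · rw [← e.summable_iff]
      refine h3.norm.congr fun x => ?_
      rw [Function.comp_apply, he]
    · rw [← e.tsum_eq, tsum_congr he, ← h4, h2, Fin.prod_univ_succ]

theorem ennreal_tsum_pi_prod {d : ℕ} (f : Fin d → ℤ → ℝ≥0∞) :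
    ∑' m : Fin d → ℤ, ∏ i, f i (m i) = ∏ i, ∑' m, f i m := by
  induction d with
  | zero => simp [tsum_fintype]
  | succ d ih =>
    set e := Fin.consEquiv fun _ : Fin (d + 1) => ℤ
    have he : ∀ x : ℤ × (Fin d → ℤ), ∏ i, f i (e x i) = f 0 x.1 * ∏ i : Fin d, f i.succ (x.2 i) := by
      intro x
      rw [Fin.prod_univ_succ]
      simp [e]
    rw [← e.tsum_eq, tsum_congr he, ENNReal.tsum_prod', Fin.prod_univ_succ, ← ih (fun i => f i.succ),
      ← ENNReal.tsum_mul_right]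
    exact tsum_congr fun m => by simp only [ENNReal.tsum_mul_left]

/-! ### Fourier coefficients on the torus -/

section Fourier

variable {d : ℕ}

/-- The coefficient `∫ φ(α) e(n · α) dα`, inverse to `latticeFourier`. -/
def torusCoeff (φ : UnitAddTorus (Fin d) → ℂ) (n : Fin d → ℤ) : ℂ :=
  ∫ α, UnitAddTorus.mFourier n α * φ α ∂(torusHaar d)

/-- The symbol `∑ K(m) e(-m · α)` of a convolution kernel. -/
def kernelSymbol (K : (Fin d → ℤ) → ℂ) (α : UnitAddTorus (Fin d)) : ℂ :=
  ∑' m, K m * UnitAddTorus.mFourier (-m) α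

theorem torusCoeff_eq_mFourierCoeff (φ : UnitAddTorus (Fin d) → ℂ) (n : Fin d → ℤ) :
    torusCoeff φ n = UnitAddTorus.mFourierCoeff φ (-n) := by
  rw [torusCoeff, UnitAddTorus.mFourierCoeff, neg_neg]
  rfl

theorem torusCoeff_latticeFourier (f : LatticeL2 d) (n : Fin d → ℤ) :
    torusCoeff (latticeFourier f) n = f n := by
  rw [torusCoeff_eq_mFourierCoeff, ← UnitAddTorus.mFourierBasis_repr,
    HilbertBasis.repr_apply_apply, UnitAddTorus.coe_mFourierBasis]
  have h := (innerSL ℂ (UnitAddTorus.mFourierLp 2 (-n) : Lp ℂ 2 (torusHaar d))).hasSum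
    (hasSum_latticeFourier f)
  refine h.unique ?_
  have hO := orthonormal_iff_ite.1 (UnitAddTorus.orthonormal_mFourier (d := Fin d))
  have h2 := hasSum_ite_eq n (f n)
  refine h2.congr_fun fun m => ?_
  rw [innerSL_apply_apply, inner_smul_right]
  erw [hO (-n) (-m)]
  by_cases hmn : m = n
  · subst hmn; simp
  · have : ¬ n = m := fun h => hmn h.symm
    simp [hmn, this]

theorem latticeL2Norm_torusCoeff {φ : UnitAddTorus (Fin d) → ℂ} (hφ : MemLp φ 2 (torusHaar d)) :
    latticeL2Norm (fun n => ‖torusCoeff φ n‖ₑ) ^ 2 = ∫⁻ α, ‖φ α‖ₑ ^ 2 ∂(torusHaar d) := by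
  have h1 := UnitAddTorus.hasSum_sq_mFourierCoeff (hφ.toLp φ)
  have hae : hφ.toLp φ =ᵐ[torusHaar d] φ := hφ.coeFn_toLp
  have hc : ∀ n, UnitAddTorus.mFourierCoeff (hφ.toLp φ) n = UnitAddTorus.mFourierCoeff φ n := by
    intro n
    refine integral_congr_ae ?_
    filter_upwards [hae] with α hα
    rw [hα]
  have hi : ∫ t, ‖hφ.toLp φ t‖ ^ 2 ∂(torusHaar d) = ∫ t, ‖φ t‖ ^ 2 ∂(torusHaar d) := by
    refine integral_congr_ae ?_
    filter_upwards [hae] with α hα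
    rw [hα]
  simp_rw [hc] at h1
  have h1' : HasSum (fun i ↦ ‖UnitAddTorus.mFourierCoeff φ i‖ ^ 2) (∫ t, ‖φ t‖ ^ 2 ∂(torusHaar d)) := by
    rw [← hi]; exact h1
  have h_integral : Integrable (fun α => ‖φ α‖ ^ 2) (torusHaar d) := hφ.integrable_norm_pow two_ne_zero
  have h3 : ∫⁻ α, ‖φ α‖ₑ ^ 2 ∂(torusHaar d) = ENNReal.ofReal (∫ t, ‖φ t‖ ^ 2 ∂(torusHaar d)) := by
    rw [ofReal_integral_eq_lintegral_ofReal h_integral (Filter.Eventually.of_forall fun _ => by positivity)]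
    refine lintegral_congr fun α => ?_
    rw [ENNReal.ofReal_pow (norm_nonneg _), ofReal_norm]
  rw [latticeL2Norm_sq, h3, ← h1'.tsum_eq, ENNReal.ofReal_tsum_of_nonneg (fun _ => by positivity)
    h1'.summable, ← (Equiv.neg _).tsum_eq]
  refine tsum_congr fun n => ?_
  rw [torusCoeff_eq_mFourierCoeff, Equiv.neg_apply, neg_neg, ENNReal.ofReal_pow (norm_nonneg _),
    ofReal_norm]

theorem norm_mFourier_apply (n : Fin d → ℤ) (α : UnitAddTorus (Fin d)) :
    ‖UnitAddTorus.mFourier n α‖ = 1 := by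
  simp only [UnitAddTorus.mFourier, fourier_apply, ContinuousMap.coe_mk, norm_prod, Circle.norm_coe,
      Finset.prod_const_one]

theorem tsum_mul_torusCoeff {K : (Fin d → ℤ) → ℂ} (hK : Summable fun m => ‖K m‖)
    {φ : UnitAddTorus (Fin d) → ℂ} (hφ : Integrable φ (torusHaar d)) (n : Fin d → ℤ) :
    ∑' m, K m * torusCoeff φ (n - m) = torusCoeff (fun α => kernelSymbol K α * φ α) n := by
  set F : (Fin d → ℤ) → UnitAddTorus (Fin d) → ℂ :=
    fun m α => K m * (UnitAddTorus.mFourier (n - m) α * φ α) with hF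
  have hFi : ∀ m, Integrable (F m) (torusHaar d) := by
    intro m
    refine Integrable.const_mul ?_ _
    exact hφ.bdd_mul (UnitAddTorus.mFourier (n - m)).continuous.aestronglyMeasurable (c := 1)
      (Filter.Eventually.of_forall fun α => (norm_mFourier_apply _ _).le)
  have hFn : ∀ m, ∫ α, ‖F m α‖ ∂(torusHaar d) = ‖K m‖ * ∫ α, ‖φ α‖ ∂(torusHaar d) := by
    intro m
    rw [← integral_const_mul]
    refine integral_congr_ae (Filter.Eventually.of_forall fun α => ?_)
    simp only [hF, norm_mul, norm_mFourier_apply, one_mul]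
  have h := hasSum_integral_of_summable_integral_norm hFi
    (by simp_rw [hFn]; exact hK.mul_right _)
  have e1 : ∀ m, K m * torusCoeff φ (n - m) = ∫ α, F m α ∂(torusHaar d) := by
    intro m; rw [torusCoeff, ← integral_const_mul]
  rw [tsum_congr e1, h.tsum_eq, torusCoeff]
  refine integral_congr_ae (Filter.Eventually.of_forall fun α => ?_)
  simp only [hF, kernelSymbol]
  rw [← tsum_mul_right, ← tsum_mul_left]
  refine tsum_congr fun m => ?_
  rw [sub_eq_add_neg, UnitAddTorus.mFourier_add]
  ring

/-- Square function bound for a countable family of multipliers. -/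
theorem latticeL2Norm_iSup_torusCoeff_le {ι : Type*} [Countable ι] {φ : UnitAddTorus (Fin d) → ℂ}
    (hφ : MemLp φ 2 (torusHaar d)) {D : ι → UnitAddTorus (Fin d) → ℂ} (hD : ∀ j, Measurable (D j))
    {S : ℝ≥0} (hS : ∀ᵐ α ∂(torusHaar d), φ α ≠ 0 → ∑' j, ‖D j α‖ₑ ^ 2 ≤ (S : ℝ≥0∞) ^ 2) :
    latticeL2Norm (fun n => ⨆ j, ‖torusCoeff (fun α => D j α * φ α) n‖ₑ) ≤
      S * latticeL2Norm (fun n => ‖torusCoeff φ n‖ₑ) := by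
  have hS' : ∀ᵐ α ∂(torusHaar d), ∑' j, ‖D j α * φ α‖ₑ ^ 2 ≤ (S : ℝ≥0∞) ^ 2 * ‖φ α‖ₑ ^ 2 := by
    filter_upwards [hS] with α hα
    simp_rw [enorm_mul, mul_pow, ENNReal.tsum_mul_right]
    by_cases h : φ α = 0
    · simp [h]
    · gcongr; exact hα h
  have hmem : ∀ j, MemLp (fun α => D j α * φ α) 2 (torusHaar d) := by
    intro j
    have hb : ∀ᵐ α ∂(torusHaar d), ‖D j α * φ α‖ ≤ S * ‖φ α‖ := by
      filter_upwards [hS'] with α hα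
      have h1 := (ENNReal.le_tsum j).trans hα
      rw [← mul_pow, ENNReal.pow_le_pow_left_iff two_ne_zero] at h1
      rw [enorm_eq_nnnorm, enorm_eq_nnnorm, ← ENNReal.coe_mul, ENNReal.coe_le_coe] at h1
      exact_mod_cast h1
    exact hφ.of_le_mul ((hD j).aestronglyMeasurable.mul hφ.aestronglyMeasurable) hb
  refine (ENNReal.pow_le_pow_left_iff two_ne_zero).1 ?_
  rw [mul_pow, latticeL2Norm_torusCoeff hφ]
  refine (latticeL2Norm_iSup_le _).trans ?_
  simp_rw [latticeL2Norm_torusCoeff (hmem _)]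
  rw [← lintegral_tsum fun j => ((hmem j).aestronglyMeasurable.enorm.pow_const 2),
    ← lintegral_const_mul' _ _ (by simp)]
  exact lintegral_mono_ae hS'

theorem latticeL2Norm_torusCoeff_mul_le {φ : UnitAddTorus (Fin d) → ℂ}
    (hφ : MemLp φ 2 (torusHaar d)) {D : UnitAddTorus (Fin d) → ℂ} (hD : Measurable D)
    {S : ℝ≥0} (hS : ∀ α, ‖D α‖ ≤ S) :
    latticeL2Norm (fun n => ‖torusCoeff (fun α => D α * φ α) n‖ₑ) ≤
      S * latticeL2Norm (fun n => ‖torusCoeff φ n‖ₑ) := by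
  have h := latticeL2Norm_iSup_torusCoeff_le (ι := Unit) hφ (D := fun _ => D) (fun _ => hD) (S := S)
    (Filter.Eventually.of_forall fun α _ => by
      rw [tsum_fintype]
      simp only [Finset.univ_unique, Finset.sum_const, Finset.card_singleton, one_smul]
      gcongr
      rw [enorm_eq_nnnorm, ENNReal.coe_le_coe]
      exact_mod_cast hS α)
  simpa using h

theorem latticeL2Norm_coe (f : LatticeL2 d) :
    latticeL2Norm (fun n => ‖f n‖ₑ) = ENNReal.ofReal ‖f‖ := by
  have h : latticeL2Norm (fun n => ‖f n‖ₑ) ^ 2 = ENNReal.ofReal ‖f‖ ^ 2 := by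
    rw [latticeL2Norm_sq, ← ENNReal.ofReal_pow (norm_nonneg _)]
    have h1 := lp.hasSum_norm (p := 2) (by norm_num) f
    simp only [ENNReal.toReal_ofNat, Real.rpow_two] at h1
    rw [← h1.tsum_eq, ENNReal.ofReal_tsum_of_nonneg (fun _ => by positivity) h1.summable]
    exact tsum_congr fun n => by rw [ENNReal.ofReal_pow (norm_nonneg _), ofReal_norm]
  exact le_antisymm ((ENNReal.pow_le_pow_left_iff two_ne_zero).1 h.le)
    ((ENNReal.pow_le_pow_left_iff two_ne_zero).1 h.ge)

end Fourier

/-! ### Symbols of product kernels -/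

/-- The representative in `(0, 1]` of a point of the circle. -/
def circleRep (x : UnitAddCircle) : ℝ := (AddCircle.measurableEquivIoc 1 0 x : ℝ)

theorem measurable_circleRep : Measurable circleRep :=
  measurable_subtype_coe.comp (AddCircle.measurableEquivIoc 1 0).measurable

theorem coe_circleRep (x : UnitAddCircle) : (circleRep x : UnitAddCircle) = x :=
  (AddCircle.measurableEquivIoc 1 0).symm_apply_apply x

theorem fourier_circleRep (m : ℤ) (x : UnitAddCircle) :
    fourier m x = Complex.exp (2 * Real.pi * Complex.I * m * circleRep x) := by
  conv_lhs => rw [← coe_circleRep x]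
  rw [fourier_coe_apply]
  simp

theorem kernelSymbol_pi {d : ℕ} (k : ℤ → ℂ) (hk : Summable fun m => ‖k m‖) :
    (Summable fun m : Fin d → ℤ => ‖∏ i, k (m i)‖) ∧ ∀ α : UnitAddTorus (Fin d),
      kernelSymbol (fun m : Fin d → ℤ => ∏ i, k (m i)) α =
        ∏ i, ∑' m : ℤ, k m * Complex.exp (2 * Real.pi * Complex.I * (-m * circleRep (α i))) := by
  refine ⟨(hasSum_pi_prod (fun _ => k) fun _ => hk).1, fun α => ?_⟩
  rw [kernelSymbol, ← (hasSum_pi_prod (fun i m => k m * Complex.exp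
      (2 * Real.pi * Complex.I * (-m * circleRep (α i)))) fun i => ?_).2]
  · refine tsum_congr fun m => ?_
    rw [UnitAddTorus.mFourier, ContinuousMap.coe_mk, ← Finset.prod_mul_distrib]
    refine Finset.prod_congr rfl fun i _ => ?_
    rw [fourier_circleRep]
    push_cast [Pi.neg_apply]
    congr 2
    ring
  · refine hk.congr fun m => ?_
    rw [norm_mul]
    have : ‖Complex.exp (2 * Real.pi * Complex.I * (-m * circleRep (α i)))‖ = 1 := by
      have := Complex.norm_exp_ofReal_mul_I (2 * Real.pi * (-m * circleRep (α i)))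
      rw [← this]; push_cast; congr 2; ring
    rw [this, mul_one]

end

/-! ### One-dimensional kernels and Gaussian averages over progressions -/

noncomputable section

open scoped NNReal
open Complex

/-- One-dimensional factor of the kernel whose symbol is `normTheta`. -/
def arcTerm (Λ : ℝ) (q : ℕ) (a : ℤ) (u : ℝ) (m : ℤ) : ℂ :=
  (Λ : ℂ)⁻¹ * thetaTerm (a / q + I * ((1 - I * u) / Λ ^ 2)) 0 m

theorem im_arcPoint (Λ : ℝ) (q : ℕ) (a : ℤ) (u : ℝ) :
    (a / q + I * ((1 - I * u) / Λ ^ 2) : ℂ).im = 1 / Λ ^ 2 := by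
  have h : (a / q + I * ((1 - I * u) / Λ ^ 2) : ℂ) =
      ((a / q + u / Λ ^ 2 : ℝ) : ℂ) + I * ((1 / Λ ^ 2 : ℝ) : ℂ) := by
    push_cast
    ring_nf
    rw [I_sq]; ring
  rw [h, add_im, ofReal_im, I_mul_im, ofReal_re, zero_add]

theorem summable_norm_arcTerm {Λ : ℝ} (hΛ : 0 < Λ) (q : ℕ) (a : ℤ) (u : ℝ) :
    Summable fun m => ‖arcTerm Λ q a u m‖ := by
  simp_rw [arcTerm, norm_mul]
  refine (summable_norm_thetaTerm ?_ 0).mul_left _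
  rw [im_arcPoint]; positivity

theorem thetaTerm_eq_mul (w : ℂ) (α : ℝ) (m : ℤ) :
    thetaTerm w α m = thetaTerm w 0 m * cexp (2 * Real.pi * I * (-m * α)) := by
  rw [thetaTerm, thetaTerm, ← Complex.exp_add]
  congr 1
  push_cast; ring

theorem tsum_arcTerm_mul (Λ : ℝ) (q : ℕ) (a : ℤ) (u x : ℝ) :
    ∑' m, arcTerm Λ q a u m * cexp (2 * Real.pi * I * (-m * x)) = normTheta Λ q a u x := by
  rw [normTheta, ← tsum_mul_left]
  refine tsum_congr fun m => ?_
  rw [arcTerm, thetaTerm_eq_mul _ x, mul_assoc]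

/-- One-dimensional factor of the Gaussian averaging kernel on `q ℤ` at scale `Λ`. -/
def progTerm (Λ : ℝ) (q : ℕ) (m : ℤ) : ℝ :=
  if (q : ℤ) ∣ m then q / Λ * Real.exp (-2 * Real.pi * m ^ 2 / Λ ^ 2) else 0

theorem progTerm_nonneg {Λ : ℝ} (hΛ : 0 < Λ) (q : ℕ) (m : ℤ) : 0 ≤ progTerm Λ q m := by
  unfold progTerm; split_ifs <;> positivity

theorem progTerm_neg (Λ : ℝ) (q : ℕ) (m : ℤ) : progTerm Λ q (-m) = progTerm Λ q m := by
  unfold progTerm; simp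

theorem progTheta_hasSum {Λ : ℝ} (hΛ : 0 < Λ) (q : ℕ) [NeZero q] (x : ℝ) :
    (Summable fun m => ‖(progTerm Λ q m : ℂ)‖) ∧
    ∑' m, (progTerm Λ q m : ℂ) * cexp (2 * Real.pi * I * (-m * x)) = progTheta Λ q x := by
  have hq0 : (q : ℤ) ≠ 0 := by exact_mod_cast NeZero.ne q
  have hqpos : (0 : ℝ) < q := by exact_mod_cast Nat.pos_of_ne_zero (NeZero.ne q)
  have hinj : Function.Injective fun k : ℤ => (q : ℤ) * k := mul_right_injective₀ hq0
  have hsupp : ∀ m : ℤ, m ∉ Set.range (fun k : ℤ => (q : ℤ) * k) → progTerm Λ q m = 0 := by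
    intro m hm
    rw [progTerm, if_neg]
    rintro ⟨k, rfl⟩
    exact hm ⟨k, rfl⟩
  have hterm : ∀ k : ℤ, (progTerm Λ q (q * k) : ℂ) = arcTerm (Λ / q) 1 0 0 k := by
    intro k
    rw [progTerm, if_pos (dvd_mul_right _ _), arcTerm, thetaTerm]
    push_cast
    rw [inv_div]
    congr 2
    field_simp
    ring_nf
    rw [I_sq]; ring
  constructor
  · rw [← hinj.summable_iff (fun m hm => by rw [hsupp m hm]; simp)]
    refine (summable_norm_arcTerm (Λ := Λ / q) (by positivity) 1 0 0).congr fun k => ?_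
    rw [Function.comp_apply, hterm]
  · rw [← hinj.tsum_eq (f := fun m : ℤ => (progTerm Λ q m : ℂ) * cexp (2 * Real.pi * I * (-m * x))),
      progTheta, ← tsum_arcTerm_mul]
    · refine tsum_congr fun k => ?_
      rw [hterm]
      congr 2
      push_cast; ring
    · intro m hm
      by_contra h
      simp [hsupp m h] at hm

/-- For a non-negative kernel the total mass is the value of its symbol at 0. -/
theorem tsum_ofReal_progTerm_le {Λ : ℝ} (hΛ : 0 < Λ) (q : ℕ) [NeZero q] (hqΛ : q ≤ Λ) :
    ∑' m, ENNReal.ofReal (progTerm Λ q m) ≤ ENNReal.ofReal (1 + 4 * thetaConst) := by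
  obtain ⟨h1, h2⟩ := progTheta_hasSum hΛ q 0
  have hs : Summable (progTerm Λ q) := by
    refine h1.congr fun m => ?_
    rw [Complex.norm_real, Real.norm_of_nonneg (progTerm_nonneg hΛ q m)]
  rw [← ENNReal.ofReal_tsum_of_nonneg (progTerm_nonneg hΛ q) hs]
  refine ENNReal.ofReal_le_ofReal ?_
  have h3 := norm_progTheta_le (q := q) hΛ hqΛ 0
  rw [← h2] at h3
  simp only [ofReal_zero, mul_zero, Complex.exp_zero, mul_one] at h3
  rw [← Complex.ofReal_tsum, Complex.norm_real] at h3
  exact (le_abs_self _).trans h3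

/-- Half of the Gaussian in r is spent on widening the other one: m²/2 ≤ r² + 2(m-r)² and Λ ≤ Λ'.
Summing over r bounds the convolution by a constant times the kernel at scale 2Λ', the next dyadic
one, as the abstract maximal inequality requires. -/
theorem progTerm_mul_le {Λ Λ' : ℝ} (hΛ : 0 < Λ) (hΛΛ' : Λ ≤ Λ') (q : ℕ) (m r : ℤ) :
    progTerm Λ q r * progTerm Λ' q (m - r) ≤
      4 * (progTerm (√2 * Λ) q r * progTerm (2 * Λ') q m) := by
  have hΛ' : 0 < Λ' := hΛ.trans_le hΛΛ'
  by_cases hr : (q : ℤ) ∣ r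
  swap
  · simp [progTerm, hr]
  by_cases hm : (q : ℤ) ∣ m
  swap
  · have : ¬ (q : ℤ) ∣ m - r := fun h => hm ((dvd_sub_left hr).1 h)
    simp [progTerm, this, hm]
  have hmr : (q : ℤ) ∣ m - r := dvd_sub hm hr
  simp only [progTerm, if_pos hr, if_pos hm, if_pos hmr]
  have h2 : √2 ^ 2 = (2 : ℝ) := Real.sq_sqrt (by norm_num)
  have hs2 : √2 ≤ 2 := by rw [Real.sqrt_le_left (by norm_num)]; norm_num
  have hs0 : 0 < √2 := by positivity
  have hexp : Real.exp (-2 * Real.pi * r ^ 2 / Λ ^ 2) *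
      Real.exp (-2 * Real.pi * ((m - r : ℤ) : ℝ) ^ 2 / Λ' ^ 2) ≤
      Real.exp (-2 * Real.pi * r ^ 2 / (√2 * Λ) ^ 2) *
        Real.exp (-2 * Real.pi * m ^ 2 / (2 * Λ') ^ 2) := by
    rw [← Real.exp_add, ← Real.exp_add]
    apply Real.exp_le_exp.2
    rw [mul_pow, h2]
    push_cast
    have hp := Real.pi_pos
    have hi : 1 / Λ' ^ 2 ≤ 1 / Λ ^ 2 := by
      apply one_div_le_one_div_of_le (by positivity); gcongr
    have hj : 0 < 1 / Λ' ^ 2 := by positivity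
    have key : (r : ℝ) ^ 2 * (1 / Λ' ^ 2) ≤ r ^ 2 * (1 / Λ ^ 2) := by gcongr
    have key2 : (m : ℝ) ^ 2 / 2 * (1 / Λ' ^ 2) ≤ (r ^ 2 + 2 * (m - r) ^ 2) * (1 / Λ' ^ 2) := by
      gcongr
      nlinarith [sq_nonneg ((m : ℝ) - 2 * r), sq_nonneg ((m : ℝ) - r)]
    have e1 : -2 * Real.pi * (r : ℝ) ^ 2 / Λ ^ 2 + -2 * Real.pi * ((m : ℝ) - r) ^ 2 / Λ' ^ 2 =
      -Real.pi * (2 * (r ^ 2 * (1 / Λ ^ 2)) + 2 * (m - r) ^ 2 * (1 / Λ' ^ 2)) := by ring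
    have e2 : -2 * Real.pi * (r : ℝ) ^ 2 / (2 * Λ ^ 2) + -2 * Real.pi * (m : ℝ) ^ 2 / (2 * Λ') ^ 2 =
      -Real.pi * (r ^ 2 * (1 / Λ ^ 2) + m ^ 2 / 2 * (1 / Λ' ^ 2)) := by ring
    rw [e1, e2, neg_mul, neg_mul, neg_le_neg_iff]
    refine mul_le_mul_of_nonneg_left ?_ hp.le
    linarith
  calc _ = (q / Λ) * (q / Λ') * (Real.exp (-2 * Real.pi * r ^ 2 / Λ ^ 2) *
      Real.exp (-2 * Real.pi * ((m - r : ℤ) : ℝ) ^ 2 / Λ' ^ 2)) := by ring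
    _ ≤ (4 * (q / (√2 * Λ) * (q / (2 * Λ')))) * (Real.exp (-2 * Real.pi * r ^ 2 / (√2 * Λ) ^ 2) *
        Real.exp (-2 * Real.pi * m ^ 2 / (2 * Λ') ^ 2)) := by
        refine mul_le_mul ?_ hexp (by positivity) (by positivity)
        have : 4 * (q / (√2 * Λ) * (q / (2 * Λ'))) = (2 / √2) * (q / Λ * (q / Λ')) := by
          field_simp; ring
        rw [this]
        have h1 : 1 ≤ 2 / √2 := by rw [le_div_iff₀ hs0]; linarith
        have h3 : 0 ≤ q / Λ * (q / Λ') := by positivity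
        nlinarith
    _ = _ := by ring

/-- The Gaussian averaging kernel on `(q ℤ)^d` at scale `Λ`. -/
def progKernel (d : ℕ) (Λ : ℝ) (q : ℕ) (m : Fin d → ℤ) : ℝ≥0∞ :=
  ∏ i, ENNReal.ofReal (progTerm Λ q (m i))

/-- Uniformity in q is the point: at scales at least q the one-dimensional masses and convolution
constants do not depend on q. -/
theorem progKernel_maximal (d : ℕ) : ∃ A : ℝ≥0, ∀ (q : ℕ) [NeZero q] (f : (Fin d → ℤ) → ℝ≥0∞),
    latticeL2Norm (fun n => ⨆ j : {j : ℕ // (q : ℝ) ≤ 2 ^ j},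
      latticeConv (progKernel d (2 ^ (j : ℕ)) q) f n) ≤ A * latticeL2Norm f := by
  set T : ℝ := 1 + 4 * thetaConst with hT
  have hT0 : 1 ≤ T := by have := thetaConst_nonneg; rw [hT]; linarith
  -- T bounds the one-dimensional mass, and 4 is the loss in `progTerm_mul_le`.
  set A : ℝ≥0 := (4 * T.toNNReal) ^ d with hA
  have hTn : 1 ≤ T.toNNReal := Real.one_le_toNNReal.2 hT0
  have hA0 : 0 < A := by rw [hA]; positivity
  refine ⟨4 * A, fun q _ f => ?_⟩
  -- The admissible scales are exactly j ≥ j₀, so the kernels can be renumbered from 0.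
  obtain ⟨j₀, hj₀⟩ : ∃ j₀ : ℕ, (∀ j, (q : ℝ) ≤ 2 ^ j ↔ j₀ ≤ j) := by
    refine ⟨Nat.clog 2 q, fun j => ?_⟩
    rw [Nat.clog_le_iff_le_pow (by norm_num)]
    exact_mod_cast Iff.rfl
  have hmax := latticeL2Norm_maximal_le (d := d) (p := fun j => progKernel d (2 ^ (j₀ + j)) q) hA0
    ?_ ?_ ?_ f
  · refine le_trans (latticeL2Norm_mono fun n => ?_) (hmax.trans (le_of_eq ?_))
    · refine iSup_le fun j => ?_
      have := (hj₀ j).1 j.2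
      refine le_iSup_of_le (j - j₀) ?_
      rw [Nat.add_sub_cancel' this]
    · push_cast; ring
  · intro j m
    simp only [progKernel, Pi.neg_apply, progTerm_neg]
  · intro j
    simp only [progKernel]
    rw [ennreal_tsum_pi_prod (fun _ m => ENNReal.ofReal (progTerm (2 ^ (j₀ + j)) q m)), hA]
    push_cast
    rw [Finset.prod_const, Finset.card_fin]
    gcongr
    refine (tsum_ofReal_progTerm_le (by positivity) q ((hj₀ _).2 (by omega))).trans ?_
    change (T.toNNReal : ℝ≥0∞) ≤ _
    exact le_mul_of_one_le_left zero_le (by norm_num)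
  · intro j k hjk m
    have h1 : latticeConv (progKernel d (2 ^ (j₀ + j)) q) (progKernel d (2 ^ (j₀ + k)) q) m ≤
        ∑' r : Fin d → ℤ, ∏ i, (ENNReal.ofReal (progTerm (√2 * 2 ^ (j₀ + j)) q (r i)) *
          (4 * ENNReal.ofReal (progTerm (2 ^ (j₀ + (k + 1))) q (m i)))) := by
      unfold latticeConv progKernel
      refine ENNReal.tsum_le_tsum fun r => ?_
      rw [← Finset.prod_mul_distrib]
      refine Finset.prod_le_prod' fun i _ => ?_
      rw [Pi.sub_apply, ← ENNReal.ofReal_mul (progTerm_nonneg (by positivity) _ _)]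
      refine (ENNReal.ofReal_le_ofReal (progTerm_mul_le (Λ := 2 ^ (j₀ + j)) (Λ' := 2 ^ (j₀ + k))
        (by positivity) (pow_le_pow_right₀ (by norm_num) (by omega)) q (m i) (r i))).trans
        (le_of_eq ?_)
      rw [ENNReal.ofReal_mul (by norm_num), ENNReal.ofReal_mul (progTerm_nonneg (by positivity) _ _)]
      rw [show (2 : ℝ) * 2 ^ (j₀ + k) = 2 ^ (j₀ + (k + 1)) by ring]
      norm_num
      ring
    refine h1.trans ?_
    rw [ennreal_tsum_pi_prod (fun i r => (ENNReal.ofReal (progTerm (√2 * 2 ^ (j₀ + j)) q r) *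
          (4 * ENNReal.ofReal (progTerm (2 ^ (j₀ + (k + 1))) q (m i)))))]
    simp_rw [ENNReal.tsum_mul_right]
    rw [progKernel, hA]
    push_cast
    have hpow : (4 * (T.toNNReal : ℝ≥0∞)) ^ d = ∏ _i : Fin d, (4 * (T.toNNReal : ℝ≥0∞)) := by
      rw [Finset.prod_const, Finset.card_fin]
    rw [hpow, ← Finset.prod_mul_distrib]
    refine Finset.prod_le_prod' fun i _ => ?_
    have hq2 : (q : ℝ) ≤ √2 * 2 ^ (j₀ + j) := by
      have h1 := (hj₀ (j₀ + j)).2 (by omega)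
      have h2 : 1 ≤ √2 := by rw [Real.one_le_sqrt]; norm_num
      nlinarith [show (0 : ℝ) < 2 ^ (j₀ + j) by positivity]
    have h2 := tsum_ofReal_progTerm_le (Λ := √2 * 2 ^ (j₀ + j)) (by positivity) q hq2
    calc _ ≤ ENNReal.ofReal T * (4 * ENNReal.ofReal (progTerm (2 ^ (j₀ + (k + 1))) q (m i))) := by
          gcongr
      _ = _ := by rw [ENNReal.ofReal]; ring

theorem norm_prod_le_pow_card {ι : Type*} (s : Finset ι) {x : ι → ℂ} {M : ℝ}
    (hx : ∀ i ∈ s, ‖x i‖ ≤ M) : ‖∏ i ∈ s, x i‖ ≤ M ^ s.card := by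
  rw [norm_prod, ← Finset.prod_const]
  exact Finset.prod_le_prod (fun _ _ => norm_nonneg _) hx

theorem norm_prod_sub_prod_le {ι : Type*} (s : Finset ι) {x y : ι → ℂ} {M : ℝ} {e : ι → ℝ}
    (hM : 0 ≤ M) (hx : ∀ i ∈ s, ‖x i‖ ≤ M) (hy : ∀ i ∈ s, ‖y i‖ ≤ M)
    (hxy : ∀ i ∈ s, ‖x i - y i‖ ≤ M * e i) :
    ‖∏ i ∈ s, x i - ∏ i ∈ s, y i‖ ≤ M ^ s.card * ∑ i ∈ s, e i := by
  classical
  induction s using Finset.induction_on with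
  | empty => simp
  | insert i s hi ih =>
    have ih' := ih (fun j hj => hx j (Finset.mem_insert_of_mem hj))
      (fun j hj => hy j (Finset.mem_insert_of_mem hj))
      (fun j hj => hxy j (Finset.mem_insert_of_mem hj))
    have hxs : ‖∏ j ∈ s, x j‖ ≤ M ^ s.card :=
      norm_prod_le_pow_card _ fun j hj => hx j (Finset.mem_insert_of_mem hj)
    have hi1 := hxy i (Finset.mem_insert_self _ _)
    have hi2 := hy i (Finset.mem_insert_self _ _)
    rw [Finset.prod_insert hi, Finset.prod_insert hi, Finset.card_insert_of_notMem hi,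
      Finset.sum_insert hi]
    have e1 : x i * ∏ j ∈ s, x j - y i * ∏ j ∈ s, y j =
        (x i - y i) * ∏ j ∈ s, x j + y i * (∏ j ∈ s, x j - ∏ j ∈ s, y j) := by ring
    rw [e1]
    refine (norm_add_le _ _).trans ?_
    rw [norm_mul, norm_mul]
    have h1 := mul_le_mul hi1 hxs (norm_nonneg _) ((norm_nonneg _).trans hi1)
    have h2 := mul_le_mul hi2 ih' (norm_nonneg _) hM
    calc _ ≤ M * e i * M ^ s.card + M * (M ^ s.card * ∑ i ∈ s, e i) := add_le_add h1 h2
      _ = _ := by ring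

/-- The sum over dyadic `x` of `min (x, 1/x)²` is bounded. -/
theorem tsum_dyadic_min_le {Y : ℝ} (hY : 0 ≤ Y) :
    ∑' j : ℕ, ENNReal.ofReal (min (2 ^ j * Y) (2 ^ j * Y)⁻¹ ^ 2) ≤ 4 := by
  -- With x = 2^j Y the decrement of φ is 12x²/((1+x²)(1+4x²)), comparable with min(x, 1/x)², so the
  -- sum telescopes.
  set φ : ℕ → ℝ := fun j => 4 / (1 + (2 ^ j * Y) ^ 2) with hφ
  have hstep : ∀ j : ℕ, min (2 ^ j * Y) (2 ^ j * Y)⁻¹ ^ 2 ≤ φ j - φ (j + 1) := by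
    intro j
    have e : (2 : ℝ) ^ (j + 1) * Y = 2 * (2 ^ j * Y) := by ring
    simp only [hφ]
    rw [e]
    set x := (2 : ℝ) ^ j * Y
    have hx : 0 ≤ x := by positivity
    have e2 : 4 / (1 + x ^ 2) - 4 / (1 + (2 * x) ^ 2) = 12 * x ^ 2 / ((1 + x ^ 2) * (1 + 4 * x ^ 2)) := by
      field_simp
      ring
    rw [e2]
    rcases le_total x 1 with h | h
    · have hm : min x x⁻¹ ≤ x := min_le_left _ _
      have hm0 : 0 ≤ min x x⁻¹ := le_min hx (inv_nonneg.2 hx)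
      refine (pow_le_pow_left₀ hm0 hm 2).trans ?_
      rw [le_div_iff₀ (by positivity)]
      have hx2 : x ^ 2 ≤ 1 := by nlinarith
      have : (1 + x ^ 2) * (1 + 4 * x ^ 2) ≤ 12 := by nlinarith [sq_nonneg x]
      nlinarith [sq_nonneg x]
    · have hx0 : 0 < x := by linarith
      have hm : min x x⁻¹ ≤ x⁻¹ := min_le_right _ _
      have hm0 : 0 ≤ min x x⁻¹ := le_min hx (inv_nonneg.2 hx)
      refine (pow_le_pow_left₀ hm0 hm 2).trans ?_
      rw [inv_pow, ← one_div, div_le_div_iff₀ (by positivity) (by positivity)]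
      have hx2 : 1 ≤ x ^ 2 := by nlinarith
      nlinarith [sq_nonneg (x ^ 2 - 1)]
  rw [ENNReal.tsum_eq_iSup_nat]
  refine iSup_le fun N => ?_
  rw [← ENNReal.ofReal_sum_of_nonneg fun _ _ => by positivity]
  refine ENNReal.ofReal_le_of_le_toReal ?_
  refine (Finset.sum_le_sum fun j _ => hstep j).trans ?_
  rw [Finset.sum_range_sub']
  have h1 : φ 0 ≤ 4 := by
    simp only [hφ]
    exact div_le_self (by norm_num) (by nlinarith [sq_nonneg ((2 : ℝ) ^ 0 * Y)])
  have h2 : 0 ≤ φ N := by simp only [hφ]; positivity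
  simp; linarith

theorem continuous_normTheta {Λ : ℝ} (hΛ : 0 < Λ) (q : ℕ) (a : ℤ) (u : ℝ) :
    Continuous (normTheta Λ q a u) := by
  have hw : 0 < (a / q + I * ((1 - I * u) / Λ ^ 2) : ℂ).im := by
    rw [im_arcPoint]; positivity
  unfold normTheta
  refine continuous_const.mul (continuous_tsum (fun m => ?_) (summable_norm_thetaTerm hw 0) fun m α => ?_)
  · unfold thetaTerm; fun_prop
  · rw [norm_thetaTerm, norm_thetaTerm]

theorem measurable_quadGauss_round (q : ℕ) [NeZero q] (a : ZMod q) :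
    Measurable fun x : ℝ => quadGauss q a (-round (q * x) : ℤ) := by
  have h1 : Measurable fun x : ℝ => (-round (q * x) : ℤ) := by
    simp_rw [round_eq]
    exact (Int.measurable_floor.comp (by fun_prop)).neg
  exact (measurable_of_countable (fun n : ℤ => quadGauss q a n)).comp h1

/-! ### Dyadic maximal operators attached to one arc -/

section ArcOperator

variable {d : ℕ}

/-- The convolution operator whose symbol is a product of values of `normTheta`. -/
def arcOp (Λ : ℝ) (q : ℕ) (a : ℤ) (u : ℝ) (f : (Fin d → ℤ) → ℂ) (n : Fin d → ℤ) : ℂ :=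
  ∑' m : Fin d → ℤ, (∏ i, arcTerm Λ q a u (m i)) * f (n - m)

/-- The symbol of `arcOp`. -/
def arcSymbol (Λ : ℝ) (q : ℕ) (a : ℤ) (u : ℝ) (α : UnitAddTorus (Fin d)) : ℂ :=
  ∏ i, normTheta Λ q a u (circleRep (α i))

theorem memLp_latticeFourier (f : LatticeL2 d) : MemLp (latticeFourier f) 2 (torusHaar d) :=
  Lp.memLp _

theorem arcOp_eq_torusCoeff {Λ : ℝ} (hΛ : 0 < Λ) (q : ℕ) (a : ℤ) (u : ℝ) (f : LatticeL2 d)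
    (n : Fin d → ℤ) :
    arcOp Λ q a u f n = torusCoeff (fun α => arcSymbol Λ q a u α * latticeFourier f α) n := by
  obtain ⟨h1, h2⟩ := kernelSymbol_pi (d := d) _ (summable_norm_arcTerm hΛ q a u)
  rw [arcOp, tsum_congr fun m => by rw [← torusCoeff_latticeFourier f (n - m)],
    tsum_mul_torusCoeff h1 ((memLp_latticeFourier f).integrable one_le_two)]
  congr 1
  ext α
  rw [h2, arcSymbol]
  congr 1
  exact Finset.prod_congr rfl fun i _ => tsum_arcTerm_mul _ _ _ _ _

theorem measurable_arcSymbol {Λ : ℝ} (hΛ : 0 < Λ) (q : ℕ) (a : ℤ) (u : ℝ) :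
    Measurable (arcSymbol (d := d) Λ q a u) := by
  unfold arcSymbol
  refine Finset.measurable_prod _ fun i _ => ?_
  exact (continuous_normTheta hΛ q a u).measurable.comp
    (measurable_circleRep.comp (measurable_pi_apply i))

/-- The scale-independent part of the symbol that approximates `arcSymbol`. -/
def gaussSymbol (q : ℕ) [NeZero q] (a : ℤ) (u : ℝ) (α : UnitAddTorus (Fin d)) : ℂ :=
  ∏ i, (arcFactor u / arcFactor 0 * (q : ℂ)⁻¹ *
    quadGauss q a (-round (q * circleRep (α i)) : ℤ))

/-- The symbol of the Gaussian averages on `(q ℤ)^d`. -/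
def progSymbol (Λ : ℝ) (q : ℕ) (α : UnitAddTorus (Fin d)) : ℂ :=
  ∏ i, progTheta Λ q (circleRep (α i))

theorem measurable_gaussSymbol (q : ℕ) [NeZero q] (a : ℤ) (u : ℝ) :
    Measurable (gaussSymbol (d := d) q a u) := by
  unfold gaussSymbol
  refine Finset.measurable_prod _ fun i _ => Measurable.const_mul ?_ _
  exact (measurable_quadGauss_round q a).comp
    (measurable_circleRep.comp (measurable_pi_apply i))

theorem measurable_progSymbol {Λ : ℝ} (hΛ : 0 < Λ) (q : ℕ) [NeZero q] :
    Measurable (progSymbol (d := d) Λ q) := by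
  have hqpos : (0 : ℝ) < q := by exact_mod_cast Nat.pos_of_ne_zero (NeZero.ne q)
  unfold progSymbol progTheta
  refine Finset.measurable_prod _ fun i _ => ?_
  exact (continuous_normTheta (Λ := Λ / q) (by positivity) 1 0 0).measurable.comp
    ((measurable_circleRep.comp (measurable_pi_apply i)).const_mul _)

/-- The constant in the uniform bound for the factors of `arcSymbol`. -/
def arcConst : ℝ := 8 + 16 * thetaConst

theorem arcConst_pos : 0 < arcConst := by
  have := thetaConst_nonneg
  unfold arcConst; positivity

theorem norm_arcSymbol_sub_le {Λ : ℝ} (hΛ : 0 < Λ) {q : ℕ} [NeZero q] {a : ℤ} {u : ℝ}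
    (ha : IsUnit (a : ZMod q)) (hqΛ : q ≤ Λ) (huΛ : q * |u| ≤ Λ) (α : UnitAddTorus (Fin d)) :
    ‖arcSymbol Λ q a u α - progSymbol Λ q α * gaussSymbol q a u α‖ ≤
      (arcConst * arcDecay q u) ^ d * ∑ i, (1 + |u|) *
        (min (Λ * (|q * circleRep (α i) - round (q * circleRep (α i))| / q))
          (Λ * (|q * circleRep (α i) - round (q * circleRep (α i))| / q))⁻¹ + q / Λ) := by
  have hB := arcDecay_pos q u
  have hT := thetaConst_nonneg
  have hC := arcConst_pos
  have e1 : progSymbol Λ q α * gaussSymbol q a u α = ∏ i, (arcFactor u / arcFactor 0 * (q : ℂ)⁻¹ *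
      quadGauss q a (-round (q * circleRep (α i)) : ℤ) * progTheta Λ q (circleRep (α i))) := by
    rw [progSymbol, gaussSymbol, ← Finset.prod_mul_distrib]
    exact Finset.prod_congr rfl fun i _ => mul_comm _ _
  rw [e1, arcSymbol]
  have h := norm_prod_sub_prod_le (Finset.univ : Finset (Fin d)) (M := arcConst * arcDecay q u)
    (x := fun i => normTheta Λ q a u (circleRep (α i)))
    (y := fun i => arcFactor u / arcFactor 0 * (q : ℂ)⁻¹ *
      quadGauss q a (-round (q * circleRep (α i)) : ℤ) * progTheta Λ q (circleRep (α i)))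
    (e := fun i => (1 + |u|) *
        (min (Λ * (|q * circleRep (α i) - round (q * circleRep (α i))| / q))
          (Λ * (|q * circleRep (α i) - round (q * circleRep (α i))| / q))⁻¹ + q / Λ))
    (by positivity) ?_ ?_ ?_
  · simpa using h
  · intro i _
    refine (norm_normTheta_le hΛ ha hqΛ huΛ _).trans ?_
    unfold arcConst; gcongr <;> linarith
  · intro i _
    rw [norm_mul]
    have h1 := norm_arcRatio_mul_quadGauss_le (u := u) ha (-round (q * circleRep (α i)) : ℤ)
    have h2 := norm_progTheta_le (q := q) hΛ hqΛ (circleRep (α i))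
    refine (mul_le_mul h1 h2 (norm_nonneg _) (by positivity)).trans ?_
    unfold arcConst
    nlinarith [mul_nonneg hT hB.le]
  · intro i _
    refine (norm_normTheta_sub_progTheta_le hΛ ha hqΛ huΛ _).trans ?_
    simp only [mul_div_assoc]
    gcongr
    unfold arcConst; linarith

theorem torusCoeff_progSymbol_mul {Λ : ℝ} (hΛ : 0 < Λ) (q : ℕ) [NeZero q]
    {φ : UnitAddTorus (Fin d) → ℂ} (hφ : Integrable φ (torusHaar d)) (n : Fin d → ℤ) :
    ‖torusCoeff (fun α => progSymbol Λ q α * φ α) n‖ₑ ≤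
      latticeConv (progKernel d Λ q) (fun m => ‖torusCoeff φ m‖ₑ) n := by
  have hs := (progTheta_hasSum hΛ q 0).1
  obtain ⟨h1, h2⟩ := kernelSymbol_pi (d := d) _ hs
  have e : progSymbol Λ q = kernelSymbol fun m : Fin d → ℤ => ∏ i, (progTerm Λ q (m i) : ℂ) := by
    ext α
    rw [h2, progSymbol]
    exact Finset.prod_congr rfl fun i _ => (progTheta_hasSum hΛ q _).2.symm
  rw [e, ← tsum_mul_torusCoeff h1 hφ, latticeConv]
  refine (enorm_tsum_le_tsum_enorm).trans (le_of_eq (tsum_congr fun m => ?_))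
  rw [enorm_mul, progKernel]
  congr 1
  rw [← ofReal_norm, norm_prod, ENNReal.ofReal_prod_of_nonneg fun _ _ => norm_nonneg _]
  refine Finset.prod_congr rfl fun i _ => ?_
  rw [Complex.norm_real, Real.norm_of_nonneg (progTerm_nonneg hΛ _ _)]

theorem sq_sum_add_le (s : Finset (Fin d)) (b : Fin d → ℝ) (c : ℝ) :
    (∑ i ∈ s, (b i + c)) ^ 2 ≤ s.card * ∑ i ∈ s, (2 * b i ^ 2 + 2 * c ^ 2) := by
  refine sq_sum_le_card_mul_sum_sq.trans ?_
  gcongr with i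
  nlinarith [sq_nonneg (b i - c)]

/-- Pointwise in α, each coordinate contributes a dyadic sum of min(x, 1/x)² and a geometric sum of
(q/2^j)². The total is therefore independent of α, and Parseval yields a square function bound. -/
theorem tsum_enorm_sq_arcSymbol_sub_le {q : ℕ} [NeZero q] {a : ℤ} (u : ℝ)
    (ha : IsUnit (a : ZMod q)) (α : UnitAddTorus (Fin d)) :
    ∑' j : {j : ℕ // (q : ℝ) ≤ 2 ^ j ∧ q * |u| ≤ 2 ^ j},
      ‖arcSymbol (2 ^ (j : ℕ)) q a u α - progSymbol (2 ^ (j : ℕ)) q α * gaussSymbol q a u α‖ₑ ^ 2 ≤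
      ((4 * d * (arcConst * arcDecay q u) ^ d * (1 + |u|)).toNNReal : ℝ≥0∞) ^ 2 := by
  have hqpos : (0 : ℝ) < q := by exact_mod_cast Nat.pos_of_ne_zero (NeZero.ne q)
  have hB := arcDecay_pos q u
  have hC := arcConst_pos
  set M : ℝ := (arcConst * arcDecay q u) ^ d * (1 + |u|) with hM
  have hM0 : 0 ≤ M := by positivity
  set Y : Fin d → ℝ := fun i => |q * circleRep (α i) - round (q * circleRep (α i))| / q with hY
  have hY0 : ∀ i, 0 ≤ Y i := fun i => by positivity
  set g : ℝ → ℕ → ℝ := fun y j => min (2 ^ j * y) (2 ^ j * y)⁻¹ ^ 2 with hg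
  have hb : ∀ j : {j : ℕ // (q : ℝ) ≤ 2 ^ j ∧ q * |u| ≤ 2 ^ j},
      ‖arcSymbol (2 ^ (j : ℕ)) q a u α - progSymbol (2 ^ (j : ℕ)) q α * gaussSymbol q a u α‖ₑ ^ 2 ≤
      ∑ i, ENNReal.ofReal (2 * d * M ^ 2) *
        (ENNReal.ofReal (g (Y i) j) + ENNReal.ofReal (g (q : ℝ)⁻¹ j)) := by
    intro j
    have h := norm_arcSymbol_sub_le (Λ := 2 ^ (j : ℕ)) (by positivity) ha j.2.1 j.2.2 α
    rw [← Finset.mul_sum, ← mul_assoc] at h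
    have hx : (1 : ℝ) ≤ 2 ^ (j : ℕ) * (q : ℝ)⁻¹ := by
      rw [← div_eq_mul_inv, le_div_iff₀ hqpos, one_mul]; exact j.2.1
    -- As 2^j ≥ q, the term q/2^j is itself such a minimum, taken at y = 1/q; one dyadic estimate
    -- serves both errors.
    have hgq : g (q : ℝ)⁻¹ j = (q / 2 ^ (j : ℕ)) ^ 2 := by
      simp only [hg]
      rw [min_eq_right ((inv_le_one_of_one_le₀ hx).trans hx), mul_inv, inv_inv]
      congr 1
      rw [mul_comm, div_eq_mul_inv]
    have hg0 : ∀ y i, 0 ≤ g y i := fun y i => by simp only [hg]; positivity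
    have h2 := sq_sum_add_le (Finset.univ : Finset (Fin d))
      (fun i => min (2 ^ (j : ℕ) * Y i) (2 ^ (j : ℕ) * Y i)⁻¹) (q / 2 ^ (j : ℕ))
    rw [← ofReal_norm, ← ENNReal.ofReal_pow (norm_nonneg _)]
    have h3 : ‖arcSymbol (2 ^ (j : ℕ)) q a u α -
        progSymbol (2 ^ (j : ℕ)) q α * gaussSymbol q a u α‖ ^ 2 ≤
        ∑ i, 2 * d * M ^ 2 * (g (Y i) j + g (q : ℝ)⁻¹ j) := by
      refine (pow_le_pow_left₀ (norm_nonneg _) h 2).trans ?_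
      rw [mul_pow]
      refine (mul_le_mul_of_nonneg_left h2 (by positivity)).trans (le_of_eq ?_)
      rw [Finset.card_fin, ← mul_assoc, Finset.mul_sum]
      refine Finset.sum_congr rfl fun i _ => ?_
      rw [hgq]
      simp only [hg]
      ring
    refine (ENNReal.ofReal_le_ofReal h3).trans (le_of_eq ?_)
    rw [ENNReal.ofReal_sum_of_nonneg fun i _ =>
      mul_nonneg (by positivity) (add_nonneg (hg0 _ _) (hg0 _ _))]
    refine Finset.sum_congr rfl fun i _ => ?_
    rw [ENNReal.ofReal_mul (by positivity), ENNReal.ofReal_add (hg0 _ _) (hg0 _ _)]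
  refine (ENNReal.tsum_le_tsum hb).trans ?_
  refine (ENNReal.tsum_comp_le_tsum_of_injective Subtype.val_injective (fun j : ℕ =>
    ∑ i, ENNReal.ofReal (2 * d * M ^ 2) *
        (ENNReal.ofReal (g (Y i) j) + ENNReal.ofReal (g (q : ℝ)⁻¹ j)))).trans ?_
  rw [Summable.tsum_finsetSum fun _ _ => ENNReal.summable]
  have h4 : ∀ i : Fin d, ∑' j : ℕ, ENNReal.ofReal (2 * d * M ^ 2) *
        (ENNReal.ofReal (g (Y i) j) + ENNReal.ofReal (g (q : ℝ)⁻¹ j)) ≤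
        ENNReal.ofReal (2 * d * M ^ 2) * (4 + 4) := by
    intro i
    rw [ENNReal.tsum_mul_left, ENNReal.tsum_add]
    gcongr
    · exact tsum_dyadic_min_le (hY0 i)
    · exact tsum_dyadic_min_le (by positivity)
  refine (Finset.sum_le_sum fun i _ => h4 i).trans (le_of_eq ?_)
  rw [Finset.sum_const, Finset.card_fin, nsmul_eq_mul]
  change _ = ENNReal.ofReal _ ^ 2
  rw [← ENNReal.ofReal_pow (by positivity), ← ENNReal.ofReal_natCast,
    show (4 + 4 : ℝ≥0∞) = ENNReal.ofReal 8 by norm_num, ← ENNReal.ofReal_mul (by positivity),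
    ← ENNReal.ofReal_mul (by positivity)]
  congr 1
  rw [hM]; ring

/-- The maximal operator attached to one arc is bounded. -/
theorem arcOp_maximal_le (d : ℕ) : ∃ C : ℝ, 0 ≤ C ∧ ∀ (q : ℕ) [NeZero q] (a : ℤ),
    IsUnit (a : ZMod q) → ∀ (u : ℝ) (f : LatticeL2 d),
    latticeL2Norm (fun n => ⨆ j : {j : ℕ // (q : ℝ) ≤ 2 ^ j ∧ q * |u| ≤ 2 ^ j},
      ‖arcOp (2 ^ (j : ℕ)) q a u f n‖ₑ) ≤
      ENNReal.ofReal (C * (arcDecay q u ^ d * (1 + |u|))) * ENNReal.ofReal ‖f‖ := by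
  obtain ⟨A, hA⟩ := progKernel_maximal d
  have hC := arcConst_pos
  refine ⟨4 * d * arcConst ^ d + A * 2 ^ d, by positivity, fun q _ a ha u f => ?_⟩
  have hB := arcDecay_pos q u
  set φ := latticeFourier f with hφ
  have hφL := memLp_latticeFourier f
  have hnorm : latticeL2Norm (fun n => ‖torusCoeff φ n‖ₑ) = ENNReal.ofReal ‖f‖ := by
    simp_rw [hφ, torusCoeff_latticeFourier]
    exact latticeL2Norm_coe f
  set ψ : UnitAddTorus (Fin d) → ℂ := fun α => gaussSymbol q a u α * φ α with hψ
  have hgb : ∀ α, ‖gaussSymbol (d := d) q a u α‖ ≤ ((2 * arcDecay q u) ^ d).toNNReal := by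
    intro α
    rw [Real.coe_toNNReal _ (by positivity), gaussSymbol]
    refine (norm_prod_le_pow_card _ (M := 2 * arcDecay q u) fun i _ => ?_).trans (by simp)
    exact norm_arcRatio_mul_quadGauss_le ha _
  have hψL : MemLp ψ 2 (torusHaar d) :=
    hφL.of_le_mul (c := ((2 * arcDecay q u) ^ d).toNNReal)
      ((measurable_gaussSymbol q a u).aestronglyMeasurable.mul hφL.aestronglyMeasurable)
      (Filter.Eventually.of_forall fun α => by
        rw [hψ, norm_mul]; exact mul_le_mul_of_nonneg_right (hgb α) (norm_nonneg _))
  have hψn := latticeL2Norm_torusCoeff_mul_le hφL (measurable_gaussSymbol q a u) hgb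
  have hψi := hψL.integrable one_le_two
  -- D is the error handled by the square function. The rest is a positive average of the fixed
  -- function with transform ψ, handled by `progKernel_maximal`.
  set D : {j : ℕ // (q : ℝ) ≤ 2 ^ j ∧ q * |u| ≤ 2 ^ j} → UnitAddTorus (Fin d) → ℂ := fun j α =>
    arcSymbol (2 ^ (j : ℕ)) q a u α - progSymbol (2 ^ (j : ℕ)) q α * gaussSymbol q a u α with hD
  have hDm : ∀ j, Measurable (D j) := fun j =>
    (measurable_arcSymbol (by positivity) q a u).sub
      ((measurable_progSymbol (by positivity) q).mul (measurable_gaussSymbol q a u))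
  have hsq := latticeL2Norm_iSup_torusCoeff_le hφL hDm
    (Filter.Eventually.of_forall fun α _ => tsum_enorm_sq_arcSymbol_sub_le u ha α)
  have hpt : ∀ n (j : {j : ℕ // (q : ℝ) ≤ 2 ^ j ∧ q * |u| ≤ 2 ^ j}),
      ‖arcOp (2 ^ (j : ℕ)) q a u f n‖ₑ ≤ ‖torusCoeff (fun α => D j α * φ α) n‖ₑ +
        latticeConv (progKernel d (2 ^ (j : ℕ)) q) (fun m => ‖torusCoeff ψ m‖ₑ) n := by
    intro n j
    have hΛ : (0 : ℝ) < 2 ^ (j : ℕ) := by positivity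
    have hbound : ∃ S : ℝ, ∀ α, ‖progSymbol (d := d) (2 ^ (j : ℕ)) q α‖ ≤ S := by
      refine ⟨(1 + 4 * thetaConst) ^ d, fun α => ?_⟩
      rw [progSymbol]
      refine (norm_prod_le_pow_card _ (M := 1 + 4 * thetaConst) fun i _ => ?_).trans (by simp)
      exact norm_progTheta_le hΛ j.2.1 _
    have hbound' : ∃ S : ℝ, ∀ α, ‖arcSymbol (d := d) (2 ^ (j : ℕ)) q a u α‖ ≤ S := by
      refine ⟨((1 + 4 * thetaConst) * arcDecay q u) ^ d, fun α => ?_⟩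
      rw [arcSymbol]
      refine (norm_prod_le_pow_card _ (M := (1 + 4 * thetaConst) * arcDecay q u)
        fun i _ => ?_).trans (by simp)
      exact norm_normTheta_le hΛ ha j.2.1 j.2.2 _
    obtain ⟨S, hS⟩ := hbound
    obtain ⟨S', hS'⟩ := hbound'
    have hi1 : Integrable (fun α => progSymbol (2 ^ (j : ℕ)) q α * ψ α) (torusHaar d) :=
      hψi.bdd_mul (measurable_progSymbol hΛ q).aestronglyMeasurable
        (Filter.Eventually.of_forall hS)
    have hi2 : Integrable (fun α => arcSymbol (2 ^ (j : ℕ)) q a u α * φ α) (torusHaar d) :=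
      (hφL.integrable one_le_two).bdd_mul (measurable_arcSymbol hΛ q a u).aestronglyMeasurable
        (Filter.Eventually.of_forall hS')
    have hmul : ∀ g : UnitAddTorus (Fin d) → ℂ, Integrable g (torusHaar d) →
        Integrable (fun α => UnitAddTorus.mFourier n α * g α) (torusHaar d) := fun g hg =>
      hg.bdd_mul (UnitAddTorus.mFourier n).continuous.aestronglyMeasurable (c := 1)
        (Filter.Eventually.of_forall fun α => (norm_mFourier_apply _ _).le)
    have e1 : arcOp (2 ^ (j : ℕ)) q a u f n = torusCoeff (fun α => D j α * φ α) n +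
        torusCoeff (fun α => progSymbol (2 ^ (j : ℕ)) q α * ψ α) n := by
      rw [arcOp_eq_torusCoeff hΛ, torusCoeff, torusCoeff, torusCoeff, ← integral_add]
      · refine integral_congr_ae (Filter.Eventually.of_forall fun α => ?_)
        simp only [hD, hψ]
        ring
      · refine ((hmul _ hi2).sub (hmul _ hi1)).congr (Filter.Eventually.of_forall fun α => ?_)
        simp only [hD, hψ, Pi.sub_apply]
        ring
      · exact hmul _ hi1
    rw [e1]
    refine (enorm_add_le _ _).trans ?_
    gcongr
    exact torusCoeff_progSymbol_mul hΛ q hψi n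
  calc _ ≤ latticeL2Norm (fun n => (⨆ j, ‖torusCoeff (fun α => D j α * φ α) n‖ₑ) +
        ⨆ j : {j : ℕ // (q : ℝ) ≤ 2 ^ j},
          latticeConv (progKernel d (2 ^ (j : ℕ)) q) (fun m => ‖torusCoeff ψ m‖ₑ) n) := by
        refine latticeL2Norm_mono fun n => iSup_le fun j => (hpt n j).trans ?_
        gcongr
        · exact le_iSup (fun j => ‖torusCoeff (fun α => D j α * φ α) n‖ₑ) j
        · exact le_iSup (fun j : {j : ℕ // (q : ℝ) ≤ 2 ^ j} =>
            latticeConv (progKernel d (2 ^ (j : ℕ)) q) (fun m => ‖torusCoeff ψ m‖ₑ) n) ⟨j, j.2.1⟩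
    _ ≤ _ := (latticeL2Norm_add_le _ _).trans (add_le_add hsq ((hA q _).trans
        (mul_le_mul_right hψn _)))
    _ ≤ _ := by
        rw [hnorm, ← mul_assoc, ← add_mul]
        gcongr
        change ENNReal.ofReal _ + (A : ℝ≥0∞) * ENNReal.ofReal _ ≤ _
        rw [← ENNReal.ofReal_coe_nnreal, ← ENNReal.ofReal_mul (by positivity),
          ← ENNReal.ofReal_add (by positivity) (by positivity)]
        refine ENNReal.ofReal_le_ofReal ?_
        have h1 : (A : ℝ) * (2 * arcDecay q u) ^ d ≤ A * (2 * arcDecay q u) ^ d * (1 + |u|) :=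
          le_mul_of_one_le_right (by positivity) (by linarith [abs_nonneg u])
        refine (add_le_add_right h1 _).trans (le_of_eq ?_)
        rw [mul_pow, mul_pow]
        ring

/-- The one coordinate far from q⁻¹ℤ makes its factor O((1+|u|)L/Λ), the others are bounded
uniformly, and the geometric sum over Λ = 2^j ≥ R leaves L/R. -/
theorem tsum_enorm_sq_arcSymbol_le {q : ℕ} [NeZero q] {a : ℤ} (u : ℝ)
    (ha : IsUnit (a : ZMod q)) {L R : ℝ} (hL : q ≤ L) (hR : 0 < R) {α : UnitAddTorus (Fin d)}
    (hα : ∃ i, 1 / L < |q * circleRep (α i) - round (q * circleRep (α i))| / q) :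
    ∑' j : {j : ℕ // ((q : ℝ) ≤ 2 ^ j ∧ q * |u| ≤ 2 ^ j) ∧ R ≤ 2 ^ j},
      ‖arcSymbol (2 ^ (j : ℕ)) q a u α‖ₑ ^ 2 ≤
      ((4 * (arcConst * arcDecay q u) ^ d * (1 + |u|) * (L / R)).toNNReal : ℝ≥0∞) ^ 2 := by
  have hqpos : (0 : ℝ) < q := by exact_mod_cast Nat.pos_of_ne_zero (NeZero.ne q)
  have hLpos : 0 < L := hqpos.trans_le hL
  have hB := arcDecay_pos q u
  have hC := arcConst_pos
  have hT := thetaConst_nonneg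
  obtain ⟨i₀, hi₀⟩ := hα
  -- On the scales 2^j ≥ R this equals (R/2^j)², so `tsum_dyadic_min_le` sums the geometric series.
  set g : ℕ → ℝ := fun j => min (2 ^ j * R⁻¹) (2 ^ j * R⁻¹)⁻¹ ^ 2 with hg
  set M : ℝ := 2 * (arcConst * arcDecay q u) ^ d * (1 + |u|) * (L / R) with hM
  have hb : ∀ j : {j : ℕ // ((q : ℝ) ≤ 2 ^ j ∧ q * |u| ≤ 2 ^ j) ∧ R ≤ 2 ^ j},
      ‖arcSymbol (2 ^ (j : ℕ)) q a u α‖ₑ ^ 2 ≤ ENNReal.ofReal (M ^ 2) * ENNReal.ofReal (g j) := by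
    intro j
    set Λ : ℝ := 2 ^ (j : ℕ) with hΛd
    have hΛ : 0 < Λ := by positivity
    have hx : (1 : ℝ) ≤ Λ * R⁻¹ := by
      rw [← div_eq_mul_inv, le_div_iff₀ hR, one_mul]; exact j.2.2
    have hgj : g j = (R / Λ) ^ 2 := by
      simp only [hg]
      rw [← hΛd, min_eq_right ((inv_le_one_of_one_le₀ hx).trans hx), mul_inv, inv_inv]
      congr 1
      rw [mul_comm, div_eq_mul_inv]
    set x := |q * circleRep (α i₀) - round (q * circleRep (α i₀))| with hxd
    have hx0 : 0 < x := by
      have h1 : 0 < x / q := lt_trans (by positivity) hi₀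
      by_contra h
      exact absurd h1 (not_lt.2 (div_nonpos_of_nonpos_of_nonneg (not_lt.1 h) hqpos.le))
    have hdec := norm_normTheta_le_decay hΛ ha j.2.1.1 j.2.1.2 hx0
    have hinv : (Λ * x / q)⁻¹ ≤ L / Λ := by
      rw [mul_div_assoc, mul_inv, mul_comm, div_eq_mul_inv L]
      gcongr
      rw [inv_le_comm₀ (by positivity) hLpos, ← one_div]
      exact hi₀.le
    have hdec2 : ‖normTheta Λ q a u (circleRep (α i₀))‖ ≤
        (arcConst * arcDecay q u) * (2 * (1 + |u|) * (L / Λ)) := by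
      refine hdec.trans ?_
      have h1 : (1 + |u|) * (Λ * x / q)⁻¹ + q * (1 + |u|) / Λ ≤ 2 * (1 + |u|) * (L / Λ) := by
        have h2 : (1 + |u|) * (Λ * x / q)⁻¹ ≤ (1 + |u|) * (L / Λ) := by gcongr
        have h3 : q * (1 + |u|) / Λ ≤ (1 + |u|) * (L / Λ) := by
          rw [mul_comm, mul_div_assoc]; gcongr
        linarith
      have h4 : 1 + 2 * thetaConst ≤ arcConst := by unfold arcConst; linarith
      gcongr
    have hprod : ‖arcSymbol Λ q a u α‖ ≤ M * (R / Λ) := by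
      rw [arcSymbol, norm_prod]
      have h5 : ∀ i ∈ Finset.univ, ‖normTheta Λ q a u (circleRep (α i))‖ ≤
          (arcConst * arcDecay q u) * (if i = i₀ then 2 * (1 + |u|) * (L / Λ) else 1) := by
        intro i _
        split_ifs with h
        · rw [h]; exact hdec2
        · rw [mul_one]
          refine (norm_normTheta_le hΛ ha j.2.1.1 j.2.1.2 _).trans ?_
          unfold arcConst; gcongr <;> linarith
      refine (Finset.prod_le_prod (fun _ _ => norm_nonneg _) h5).trans (le_of_eq ?_)
      rw [Finset.prod_mul_distrib, Finset.prod_const, Finset.card_fin,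
        Finset.prod_ite_eq' Finset.univ i₀, if_pos (Finset.mem_univ _), hM]
      field_simp
    rw [← ofReal_norm, ← ENNReal.ofReal_pow (norm_nonneg _), ← ENNReal.ofReal_mul (by positivity)]
    refine ENNReal.ofReal_le_ofReal ((pow_le_pow_left₀ (norm_nonneg _) hprod 2).trans (le_of_eq ?_))
    rw [hgj, mul_pow]
  refine (ENNReal.tsum_le_tsum hb).trans ?_
  refine (ENNReal.tsum_comp_le_tsum_of_injective Subtype.val_injective (fun j : ℕ =>
    ENNReal.ofReal (M ^ 2) * ENNReal.ofReal (g j))).trans ?_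
  rw [ENNReal.tsum_mul_left]
  refine (mul_le_mul_right (tsum_dyadic_min_le (inv_nonneg.2 hR.le)) _).trans (le_of_eq ?_)
  change _ = ENNReal.ofReal _ ^ 2
  rw [← ENNReal.ofReal_pow (by positivity),
    show (4 : ℝ≥0∞) = ENNReal.ofReal 4 by norm_num, ← ENNReal.ofReal_mul (by positivity)]
  congr 1
  rw [hM]; ring

/-- On functions with spectrum away from the rationals of denominator `q`, the maximal operator
attached to an arc around `a / q` is small at large scales. -/
theorem arcOp_maximal_le_of_spectrum (d : ℕ) : ∃ C : ℝ, 0 ≤ C ∧ ∀ (q : ℕ) [NeZero q] (a : ℤ),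
    IsUnit (a : ZMod q) → ∀ (u L R : ℝ) (_ : q ≤ L) (_ : 0 < R) (f : LatticeL2 d)
    (_ : ∀ᵐ α ∂(torusHaar d), latticeFourier f α ≠ 0 →
      ∃ i, 1 / L < |q * circleRep (α i) - round (q * circleRep (α i))| / q),
    latticeL2Norm (fun n => ⨆ j : {j : ℕ // ((q : ℝ) ≤ 2 ^ j ∧ q * |u| ≤ 2 ^ j) ∧ R ≤ 2 ^ j},
      ‖arcOp (2 ^ (j : ℕ)) q a u f n‖ₑ) ≤
      ENNReal.ofReal (C * (arcDecay q u ^ d * (1 + |u|)) * (L / R)) * ENNReal.ofReal ‖f‖ := by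
  have hC := arcConst_pos
  refine ⟨4 * arcConst ^ d, by positivity, fun q _ a ha u L R hL hR f hf => ?_⟩
  have hφL := memLp_latticeFourier f
  have h := latticeL2Norm_iSup_torusCoeff_le hφL
    (D := fun (j : {j : ℕ // ((q : ℝ) ≤ 2 ^ j ∧ q * |u| ≤ 2 ^ j) ∧ R ≤ 2 ^ j}) =>
      arcSymbol (2 ^ (j : ℕ)) q a u)
    (fun j => measurable_arcSymbol (by positivity) q a u)
    (by
      filter_upwards [hf] with α hα h0
      exact tsum_enorm_sq_arcSymbol_le u ha hL hR (hα h0))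
  simp_rw [torusCoeff_latticeFourier, latticeL2Norm_coe] at h
  have e : ∀ n, (⨆ j : {j : ℕ // ((q : ℝ) ≤ 2 ^ j ∧ q * |u| ≤ 2 ^ j) ∧ R ≤ 2 ^ j},
      ‖arcOp (2 ^ (j : ℕ)) q a u f n‖ₑ) =
      ⨆ j : {j : ℕ // ((q : ℝ) ≤ 2 ^ j ∧ q * |u| ≤ 2 ^ j) ∧ R ≤ 2 ^ j},
      ‖torusCoeff (fun α => arcSymbol (2 ^ (j : ℕ)) q a u α * latticeFourier f α) n‖ₑ := fun n =>
    iSup_congr fun j => by rw [arcOp_eq_torusCoeff (by positivity)]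
  simp_rw [e]
  refine h.trans (le_of_eq ?_)
  congr 1
  change ENNReal.ofReal _ = _
  congr 1
  rw [mul_pow]; ring

end ArcOperator

/-! ### The singular series and its Euler product -/

/-- The `q`-th term of the singular series for representations of `k` as a sum of `d` squares. -/
def singularTerm (d k : ℕ) : ℕ → ℂ
  | 0 => 0
  | q + 1 => ∑ a : (ZMod (q + 1))ˣ, (((q + 1 : ℕ) : ℂ)⁻¹ * quadGauss (q + 1) a 0) ^ d *
      ZMod.stdAddChar (-((k : ZMod (q + 1)) * (a : ZMod (q + 1))))

theorem singularTerm_eq (d k q : ℕ) [NeZero q] : singularTerm d k q =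
    ∑ a : (ZMod q)ˣ, ((q : ℂ)⁻¹ * quadGauss q a 0) ^ d * ZMod.stdAddChar (-((k : ZMod q) * (a : ZMod q))) := by
  obtain ⟨p, rfl⟩ : ∃ p, q = p + 1 := ⟨q - 1, by have := NeZero.ne q; omega⟩
  rfl

theorem singularTerm_one (d k : ℕ) : singularTerm d k 1 = 1 := by
  rw [singularTerm_eq, Fintype.sum_subsingleton _ 1, quadGauss_one,
    Subsingleton.elim (-((k : ZMod 1) * ((1 : (ZMod 1)ˣ) : ZMod 1))) 0, AddChar.map_zero_eq_one]
  simp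

/-- If tm + sn = 1, then x/(mn) = sx/m + tx/n, and s, t are units for the respective moduli. -/
theorem stdAddChar_mul_eq {m n : ℕ} [NeZero m] [NeZero n] (h : Nat.Coprime m n) :
    ∃ (s : (ZMod m)ˣ) (t : (ZMod n)ˣ), ∀ x : ZMod (m * n), ZMod.stdAddChar x =
      ZMod.stdAddChar ((s : ZMod m) * (ZMod.chineseRemainder h x).1) *
        ZMod.stdAddChar ((t : ZMod n) * (ZMod.chineseRemainder h x).2) := by
  obtain ⟨t, s, hst⟩ := (Nat.isCoprime_iff_coprime.2 h)
  have hm0 : (m : ℂ) ≠ 0 := by exact_mod_cast NeZero.ne m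
  have hn0 : (n : ℂ) ≠ 0 := by exact_mod_cast NeZero.ne n
  have hs : IsUnit (s : ZMod m) := by
    refine IsUnit.of_mul_eq_one (n : ZMod m) ?_
    have := congrArg (fun z : ℤ => (z : ZMod m)) hst
    simpa using this
  have ht : IsUnit (t : ZMod n) := by
    refine IsUnit.of_mul_eq_one (m : ZMod n) ?_
    have := congrArg (fun z : ℤ => (z : ZMod n)) hst
    simpa using this
  refine ⟨hs.unit, ht.unit, fun x => ?_⟩
  obtain ⟨j, rfl⟩ := ZMod.intCast_surjective x
  rw [map_intCast (ZMod.chineseRemainder h) j, Prod.fst_intCast, Prod.snd_intCast, IsUnit.unit_spec, IsUnit.unit_spec,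
    ← Int.cast_mul, ← Int.cast_mul, ZMod.stdAddChar_coe, ZMod.stdAddChar_coe, ZMod.stdAddChar_coe,
    ← Complex.exp_add]
  congr 1
  have hst' : (t * m + s * n : ℂ) = 1 := by exact_mod_cast hst
  push_cast
  field_simp
  linear_combination (-(j : ℂ)) * hst'

theorem quadGauss_mul_eq {m n : ℕ} [NeZero m] [NeZero n] (h : Nat.Coprime m n)
    {s : (ZMod m)ˣ} {t : (ZMod n)ˣ} (hst : ∀ x : ZMod (m * n), ZMod.stdAddChar x =
      ZMod.stdAddChar ((s : ZMod m) * (ZMod.chineseRemainder h x).1) *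
        ZMod.stdAddChar ((t : ZMod n) * (ZMod.chineseRemainder h x).2)) (a : ZMod (m * n)) :
    quadGauss (m * n) a 0 = quadGauss m (s * (ZMod.chineseRemainder h a).1) 0 *
      quadGauss n (t * (ZMod.chineseRemainder h a).2) 0 := by
  unfold quadGauss
  rw [Finset.sum_mul_sum, ← Finset.sum_product', Finset.univ_product_univ]
  refine Fintype.sum_equiv (ZMod.chineseRemainder h).toEquiv _ _ fun r => ?_
  rw [hst]
  simp [mul_assoc]

/-- By the Chinese remainder theorem everything factors up to twists by the units s and t, which
reindexing the sums over units absorbs. -/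
theorem singularTerm_mul (d k : ℕ) {m n : ℕ} (h : Nat.Coprime m n) :
    singularTerm d k (m * n) = singularTerm d k m * singularTerm d k n := by
  rcases Nat.eq_zero_or_pos m with rfl | hm
  · simp [singularTerm]
  rcases Nat.eq_zero_or_pos n with rfl | hn
  · simp [singularTerm]
  have : NeZero m := ⟨hm.ne'⟩
  have : NeZero n := ⟨hn.ne'⟩
  obtain ⟨s, t, hst⟩ := stdAddChar_mul_eq h
  rw [singularTerm_eq, singularTerm_eq, singularTerm_eq, Finset.sum_mul_sum,
    ← Finset.sum_product', Finset.univ_product_univ]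
  set e : (ZMod (m * n))ˣ ≃ (ZMod m)ˣ × (ZMod n)ˣ :=
    ((Units.mapEquiv (ZMod.chineseRemainder h).toMulEquiv).trans MulEquiv.prodUnits).toEquiv.trans
      ((Equiv.mulLeft s).prodCongr (Equiv.mulLeft t)) with he
  refine Fintype.sum_equiv e _ _ fun a => ?_
  have h1 : ((e a).1 : ZMod m) = s * (ZMod.chineseRemainder h (a : ZMod (m * n))).1 := rfl
  have h2 : ((e a).2 : ZMod n) = t * (ZMod.chineseRemainder h (a : ZMod (m * n))).2 := rfl
  rw [h1, h2, quadGauss_mul_eq h hst, hst]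
  have h3 : ZMod.chineseRemainder h (-((k : ZMod (m * n)) * (a : ZMod (m * n)))) =
      (-((k : ZMod m) * (ZMod.chineseRemainder h (a : ZMod (m * n))).1),
       -((k : ZMod n) * (ZMod.chineseRemainder h (a : ZMod (m * n))).2)) := by
    rw [map_neg, map_mul, map_natCast]; rfl
  rw [h3]
  rw [show (s : ZMod m) * -((k : ZMod m) * (ZMod.chineseRemainder h (a : ZMod (m * n))).1) =
      -((k : ZMod m) * (s * (ZMod.chineseRemainder h (a : ZMod (m * n))).1)) by ring,
    show (t : ZMod n) * -((k : ZMod n) * (ZMod.chineseRemainder h (a : ZMod (m * n))).2) =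
      -((k : ZMod n) * (t * (ZMod.chineseRemainder h (a : ZMod (m * n))).2)) by ring]
  push_cast
  rw [mul_inv]
  ring

theorem norm_singularTerm_le_of_gauss {d k q : ℕ} [NeZero q] {g : ℝ}
    (hg : ∀ a : (ZMod q)ˣ, ‖quadGauss q a 0‖ ≤ g) :
    ‖singularTerm d k q‖ ≤ q.totient * ((q : ℝ)⁻¹ * g) ^ d := by
  rw [singularTerm_eq]
  refine (norm_sum_le _ _).trans ?_
  rw [← ZMod.card_units_eq_totient, ← nsmul_eq_mul]
  refine Finset.sum_le_card_nsmul _ _ _ fun a _ => ?_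
  rw [norm_mul, norm_stdAddChar, mul_one, norm_pow, norm_mul, norm_inv, Complex.norm_natCast]
  gcongr
  exact hg a

theorem rpow_neg_three_half_eq {x : ℝ} (hx : 0 < x) : x * (√x)⁻¹ ^ 5 = x ^ (-(3 / 2) : ℝ) := by
  rw [Real.sqrt_eq_rpow, ← Real.rpow_neg hx.le, ← Real.rpow_natCast, ← Real.rpow_mul hx.le]
  nth_rw 1 [← Real.rpow_one x]
  rw [← Real.rpow_add hx]
  norm_num

theorem norm_singularTerm_le_of_odd {d : ℕ} (hd : 5 ≤ d) (k : ℕ) {q : ℕ} [NeZero q] (hq : Odd q) :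
    ‖singularTerm d k q‖ ≤ (q : ℝ) ^ (-(3 / 2) : ℝ) := by
  have hq1 : (1 : ℝ) ≤ q := by exact_mod_cast Nat.pos_of_ne_zero (NeZero.ne q)
  have hs : 1 ≤ √(q : ℝ) := Real.one_le_sqrt.2 hq1
  refine (norm_singularTerm_le_of_gauss (q := q) (g := √q) fun a =>
    norm_quadGauss_le_of_odd q hq a 0 a.isUnit).trans ?_
  have e : (q : ℝ)⁻¹ * √q = (√q)⁻¹ := by
    nth_rw 1 [← Real.mul_self_sqrt (zero_le_one.trans hq1)]
    field_simp
  rw [e, ← rpow_neg_three_half_eq (by positivity)]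
  have h5 := pow_le_pow_of_le_one (show 0 ≤ (√(q : ℝ))⁻¹ by positivity)
    (inv_le_one_of_one_le₀ hs) hd
  exact mul_le_mul (by exact_mod_cast Nat.totient_le q) h5 (by positivity) (by positivity)

theorem norm_singularTerm_le {d : ℕ} (hd : 5 ≤ d) (k q : ℕ) :
    ‖singularTerm d k q‖ ≤ √2 ^ d * (q : ℝ) ^ (-(3 / 2) : ℝ) := by
  rcases Nat.eq_zero_or_pos q with rfl | hq
  · simp [singularTerm]
  have : NeZero q := ⟨hq.ne'⟩
  have hq1 : (1 : ℝ) ≤ q := by exact_mod_cast hq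
  have hs : 1 ≤ √(q : ℝ) := Real.one_le_sqrt.2 hq1
  refine (norm_singularTerm_le_of_gauss (q := q) (g := √2 * √q) fun a =>
    norm_quadGauss_le q a 0 a.isUnit).trans ?_
  have e : (q : ℝ)⁻¹ * (√2 * √q) = √2 * (√q)⁻¹ := by
    nth_rw 1 [← Real.mul_self_sqrt (zero_le_one.trans hq1)]
    field_simp
  rw [e, ← rpow_neg_three_half_eq (by positivity), mul_pow, mul_left_comm]
  have h5 := pow_le_pow_of_le_one (show 0 ≤ (√(q : ℝ))⁻¹ by positivity)
    (inv_le_one_of_one_le₀ hs) hd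
  refine mul_le_mul_of_nonneg_left ?_ (by positivity)
  exact mul_le_mul (by exact_mod_cast Nat.totient_le q) h5 (by positivity) (by positivity)

theorem summable_rpow_neg_three_half : Summable fun q : ℕ => (q : ℝ) ^ (-(3 / 2) : ℝ) :=
  Real.summable_nat_rpow.2 (by norm_num)

theorem summable_norm_singularTerm {d : ℕ} (hd : 5 ≤ d) (k : ℕ) :
    Summable fun q => ‖singularTerm d k q‖ :=
  Summable.of_nonneg_of_le (fun _ => norm_nonneg _) (norm_singularTerm_le hd k)
    (summable_rpow_neg_three_half.mul_left _)

/-- The term at 2 vanishes and φ(2^{e+1}) = 2^e. Together with (√2 / √(2^{e+1}))^d ≤ (2^e)^{-5/2},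
this leaves the geometric bound of the odd primes, with the exponent lowered by one. -/
theorem norm_singularTerm_two_pow_le {d : ℕ} (hd : 5 ≤ d) (k e : ℕ) :
    ‖singularTerm d k (2 ^ (e + 1))‖ ≤ if e = 0 then 0 else ((2 : ℝ) ^ (-(3 / 2) : ℝ)) ^ e := by
  split_ifs with h
  · subst h
    rw [zero_add, pow_one, singularTerm_eq, norm_le_zero_iff]
    refine Finset.sum_eq_zero fun a _ => ?_
    rw [quadGauss_two _ a.isUnit, mul_zero, zero_pow (by omega), zero_mul]
  · refine (norm_singularTerm_le_of_gauss (q := 2 ^ (e + 1))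
      (g := √2 * √((2 ^ (e + 1) : ℕ) : ℝ)) fun a => norm_quadGauss_le (2 ^ (e + 1)) a 0 a.isUnit).trans ?_
    rw [Nat.totient_prime_pow_succ Nat.prime_two]
    have hx : (1 : ℝ) ≤ 2 ^ e := one_le_pow₀ (by norm_num)
    have e1 : (((2 ^ (e + 1) : ℕ) : ℝ))⁻¹ * (√2 * √((2 ^ (e + 1) : ℕ) : ℝ)) = (√(2 ^ e))⁻¹ := by
      push_cast
      have h4 : √2 * √(2 ^ (e + 1)) = 2 * √((2 : ℝ) ^ e) := by
        rw [pow_succ, Real.sqrt_mul (by positivity)]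
        have := Real.mul_self_sqrt (show (0 : ℝ) ≤ 2 by norm_num)
        linear_combination √((2 : ℝ) ^ e) * this
      rw [h4, pow_succ]
      nth_rw 1 [← Real.mul_self_sqrt (zero_le_one.trans hx)]
      have : 0 < √((2 : ℝ) ^ e) := by positivity
      field_simp
    rw [e1]
    have e2 : ((2 : ℝ) ^ (-(3 / 2) : ℝ)) ^ e = ((2 : ℝ) ^ e) ^ (-(3 / 2) : ℝ) := by
      rw [← Real.rpow_natCast, ← Real.rpow_natCast, ← Real.rpow_mul (by norm_num),
        ← Real.rpow_mul (by norm_num), mul_comm]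
    rw [e2, ← rpow_neg_three_half_eq (by positivity)]
    push_cast
    norm_num only [mul_one]
    exact mul_le_mul_of_nonneg_left (pow_le_pow_of_le_one (by positivity)
      (inv_le_one_of_one_le₀ (Real.one_le_sqrt.2 hx)) hd) (by positivity)

theorem two_rpow_neg_three_half_le : (2 : ℝ) ^ (-(3 / 2) : ℝ) ≤ 3 / 8 := by
  rw [← rpow_neg_three_half_eq (by norm_num)]
  have h2 : √(2 : ℝ) ^ 2 = 2 := Real.sq_sqrt (by norm_num)
  have h3 : (√(2 : ℝ)) ^ 5 = 4 * √2 := by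
    calc √(2 : ℝ) ^ 5 = (√(2 : ℝ) ^ 2) ^ 2 * √2 := by ring
      _ = _ := by rw [h2]; norm_num
  rw [inv_pow, h3, ← div_eq_mul_inv, div_le_iff₀ (by positivity)]
  have : (4 / 3 : ℝ) ≤ √2 := Real.le_sqrt_of_sq_le (by norm_num)
  linarith

/-- With x = p^{-3/2}, the terms with e ≥ 1 sum to at most x/(1-x), and x ≤ 3/8 already at p = 2.
The exponential form makes the product over primes a convergent sum in the exponent. -/
theorem norm_tsum_singularTerm_prime_ge {d : ℕ} (hd : 5 ≤ d) (k : ℕ) {p : ℕ} (hp : p.Prime) :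
    Real.exp (-4 * (p : ℝ) ^ (-(3 / 2) : ℝ)) ≤ ‖∑' e, singularTerm d k (p ^ e)‖ := by
  set x : ℝ := (p : ℝ) ^ (-(3 / 2) : ℝ) with hx
  have hp2 : (2 : ℝ) ≤ p := by exact_mod_cast hp.two_le
  have hx0 : 0 < x := by positivity
  have hx1 : x ≤ 3 / 8 :=
    (Real.rpow_le_rpow_of_nonpos (by norm_num) hp2 (by norm_num)).trans two_rpow_neg_three_half_le
  have hsum : Summable fun e => singularTerm d k (p ^ e) :=
    ((summable_norm_singularTerm hd k).of_norm).comp_injective (Nat.pow_right_injective hp.two_le)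
  have hgeo := hasSum_geometric_of_lt_one hx0.le (by linarith : x < 1)
  have htail : ‖∑' e, singularTerm d k (p ^ (e + 1))‖ ≤ x / (1 - x) := by
    rcases hp.eq_two_or_odd' with h2 | hodd
    · subst h2
      have hg2 : HasSum (fun e : ℕ => if e = 0 then 0 else x ^ e) (x / (1 - x)) := by
        have h3 := (hasSum_nat_add_iff (f := fun e : ℕ => if e = 0 then 0 else x ^ e) 1
          (g := x / (1 - x))).1
        simp only [Finset.range_one, Finset.sum_singleton, if_pos, add_zero] at h3
        refine h3 ?_
        have := hgeo.mul_left x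
        rw [← div_eq_mul_inv] at this
        refine this.congr_fun fun e => ?_
        rw [if_neg (by omega), pow_succ, mul_comm]
      refine tsum_of_norm_bounded hg2 fun e => ?_
      exact_mod_cast norm_singularTerm_two_pow_le hd k e
    · have hg2 : HasSum (fun e : ℕ => x ^ (e + 1)) (x / (1 - x)) := by
        have := hgeo.mul_left x
        rw [← div_eq_mul_inv] at this
        exact this.congr_fun fun e => by rw [pow_succ, mul_comm]
      refine tsum_of_norm_bounded hg2 fun e => ?_
      have : NeZero (p ^ (e + 1)) := ⟨pow_ne_zero _ hp.ne_zero⟩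
      refine (norm_singularTerm_le_of_odd hd k (hodd.pow)).trans (le_of_eq ?_)
      rw [hx, ← Real.rpow_natCast (p ^ (-(3 / 2) : ℝ) : ℝ), ← Real.rpow_mul (by positivity)]
      push_cast
      rw [← Real.rpow_natCast, ← Real.rpow_mul (by positivity), mul_comm]
      push_cast
      rfl
  rw [hsum.tsum_eq_zero_add, pow_zero, singularTerm_one]
  have h1 : 1 - x / (1 - x) ≤ ‖1 + ∑' e, singularTerm d k (p ^ (e + 1))‖ := by
    have := norm_sub_norm_le (1 : ℂ) (-∑' e, singularTerm d k (p ^ (e + 1)))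
    rw [sub_neg_eq_add, norm_neg, norm_one] at this
    linarith
  refine le_trans ?_ h1
  have h2 : 1 - x / (1 - x) = (1 - 2 * x) / (1 - x) := by
    have : 1 - x ≠ 0 := by linarith
    field_simp
    ring
  have h3 : 1 + 4 * x ≤ Real.exp (4 * x) := by linarith [Real.add_one_le_exp (4 * x)]
  rw [h2, neg_mul, Real.exp_neg, inv_le_comm₀ (Real.exp_pos _) (div_pos (by linarith) (by linarith)),
    inv_div]
  -- It remains to see 1 - x ≤ (1 + 4x)(1 - 2x), which for x > 0 says precisely x ≤ 3/8.
  refine le_trans ?_ h3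
  rw [div_le_iff₀ (by linarith)]
  nlinarith

/-- The singular series is bounded away from zero. -/
theorem singularSeries_lower_bound {d : ℕ} (hd : 5 ≤ d) :
    ∃ c : ℝ, 0 < c ∧ ∀ k, c ≤ ‖∑' q, singularTerm d k q‖ := by
  refine ⟨Real.exp (-4 * ∑' q : ℕ, (q : ℝ) ^ (-(3 / 2) : ℝ)), Real.exp_pos _, fun k => ?_⟩
  have h := EulerProduct.eulerProduct_hasProd (f := singularTerm d k) (singularTerm_one d k)
    (fun h => singularTerm_mul d k h) (summable_norm_singularTerm hd k) (by rw [singularTerm])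
  refine ge_of_tendsto h.norm (Filter.Eventually.of_forall fun s => ?_)
  calc Real.exp (-4 * ∑' q : ℕ, (q : ℝ) ^ (-(3 / 2) : ℝ))
      ≤ Real.exp (∑ p ∈ s, -4 * (p : ℝ) ^ (-(3 / 2) : ℝ)) := by
        apply Real.exp_le_exp.2
        rw [← Finset.mul_sum]
        have h2 : ∑ p ∈ s, ((p : ℕ) : ℝ) ^ (-(3 / 2) : ℝ) ≤ ∑' q : ℕ, (q : ℝ) ^ (-(3 / 2) : ℝ) := by
          have h3 := Finset.sum_map s ⟨fun p : Nat.Primes => (p : ℕ), Subtype.val_injective⟩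
            (fun q : ℕ => (q : ℝ) ^ (-(3 / 2) : ℝ))
          exact h3.symm.le.trans
            (summable_rpow_neg_three_half.sum_le_tsum _ fun _ _ => by positivity)
        linarith
    _ = ∏ p ∈ s, Real.exp (-4 * (p : ℝ) ^ (-(3 / 2) : ℝ)) := Real.exp_sum _ _
    _ ≤ _ := Finset.prod_le_prod (fun _ _ => (Real.exp_pos _).le) fun p _ =>
        norm_tsum_singularTerm_prime_ge hd k p.2

/-! ### Recovering spheres from Gaussian-weighted exponential sums -/

section CircleMethod

variable {d : ℕ}

/-- One-dimensional factor of the Gaussian-weighted kernel `e(t |m|²)`. -/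
def circleTerm (Λ t : ℝ) (m : ℤ) : ℂ :=
  (Λ : ℂ)⁻¹ * (Real.exp (-(2 * Real.pi * m ^ 2 / Λ ^ 2)) * cexp (2 * Real.pi * I * (m ^ 2 * t)))

theorem arcTerm_eq_circleTerm {Λ : ℝ} (hΛ : 0 < Λ) (q : ℕ) (a : ℤ) (u : ℝ) (m : ℤ) :
    arcTerm Λ q a u m = circleTerm Λ (a / q + u / Λ ^ 2) m := by
  have hΛ' : (Λ : ℂ) ≠ 0 := by exact_mod_cast hΛ.ne'
  have h : (a / q + I * ((1 - I * u) / Λ ^ 2) : ℂ) = (a / q + u / Λ ^ 2) + I * (1 / Λ ^ 2) := by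
    linear_combination (-(u / (Λ : ℂ) ^ 2)) * I_sq
  rw [arcTerm, circleTerm, thetaTerm, h, ofReal_exp, ← Complex.exp_add]
  congr 2
  push_cast
  linear_combination (2 * Real.pi * m ^ 2 / (Λ : ℂ) ^ 2) * I_sq

theorem norm_circleTerm {Λ : ℝ} (hΛ : 0 < Λ) (t : ℝ) (m : ℤ) :
    ‖circleTerm Λ t m‖ = Λ⁻¹ * Real.exp (-(2 * Real.pi * m ^ 2 / Λ ^ 2)) := by
  have h : (2 * Real.pi * I * (m ^ 2 * t) : ℂ) = ((2 * Real.pi * (m ^ 2 * t) : ℝ) : ℂ) * I := by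
    push_cast; ring
  rw [circleTerm, norm_mul, norm_mul, h, norm_exp_ofReal_mul_I, norm_inv, norm_real, norm_real,
    Real.norm_of_nonneg hΛ.le, Real.norm_of_nonneg (Real.exp_pos _).le, mul_one]

theorem summable_norm_circleTerm {Λ : ℝ} (hΛ : 0 < Λ) (t : ℝ) :
    Summable fun m => ‖circleTerm Λ t m‖ := by
  refine (summable_norm_arcTerm hΛ 1 0 (t * Λ ^ 2)).congr fun m => ?_
  rw [arcTerm_eq_circleTerm hΛ]
  congr 2
  field_simp
  simp

theorem continuous_circleTerm (Λ : ℝ) (m : ℤ) : Continuous fun t => circleTerm Λ t m := by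
  unfold circleTerm
  fun_prop

/-- The convolution operator with kernel a product of `circleTerm`s. -/
def circleOp (Λ t : ℝ) (f : (Fin d → ℤ) → ℂ) (n : Fin d → ℤ) : ℂ :=
  ∑' m : Fin d → ℤ, (∏ i, circleTerm Λ t (m i)) * f (n - m)

theorem arcOp_eq_circleOp {Λ : ℝ} (hΛ : 0 < Λ) (q : ℕ) (a : ℤ) (u : ℝ) (f : (Fin d → ℤ) → ℂ)
    (n : Fin d → ℤ) : arcOp Λ q a u f n = circleOp Λ (a / q + u / Λ ^ 2) f n := by
  simp_rw [arcOp, circleOp, arcTerm_eq_circleTerm hΛ]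

theorem summable_prod_circleTerm_mul {Λ : ℝ} (hΛ : 0 < Λ) (t : ℝ) {f : (Fin d → ℤ) → ℂ} {S : ℝ}
    (hf : ∀ n, ‖f n‖ ≤ S) (n : Fin d → ℤ) :
    Summable fun m : Fin d → ℤ => ‖(∏ i, circleTerm Λ t (m i)) * f (n - m)‖ := by
  have h := (hasSum_pi_prod (fun (_ : Fin d) m => circleTerm Λ t m)
    fun _ => summable_norm_circleTerm hΛ t).1
  refine Summable.of_nonneg_of_le (fun _ => norm_nonneg _) (fun m => ?_) (h.mul_right S)
  rw [norm_mul]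
  exact mul_le_mul_of_nonneg_left (hf _) (norm_nonneg _)

theorem continuous_circleOp {Λ : ℝ} (hΛ : 0 < Λ) {f : (Fin d → ℤ) → ℂ} {S : ℝ}
    (hf : ∀ n, ‖f n‖ ≤ S) (n : Fin d → ℤ) : Continuous fun t => circleOp Λ t f n := by
  unfold circleOp
  refine continuous_tsum (fun m => (continuous_finsetProd _ fun i _ =>
    continuous_circleTerm Λ (m i)).mul continuous_const)
    (summable_prod_circleTerm_mul hΛ 0 hf n) fun m t => le_of_eq ?_
  simp_rw [norm_mul, norm_prod, norm_circleTerm hΛ]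

theorem mem_latticeSphere_iff {r : ℝ} (hr : 0 ≤ r) {k : ℕ} (hk : r ^ 2 = k) (m : Fin d → ℤ) :
    m ∈ latticeSphere d r ↔ ∑ i, m i ^ 2 = (k : ℤ) := by
  have h0 : (0 : ℝ) ≤ ∑ i, (m i : ℝ) ^ 2 := Finset.sum_nonneg fun i _ => sq_nonneg _
  rw [latticeSphere, Set.Finite.mem_toFinset, Set.mem_ofPred_eq, Real.sqrt_eq_iff_mul_self_eq h0 hr,
    ← sq, hk]
  constructor
  · intro h
    have : ((∑ i, m i ^ 2 : ℤ) : ℝ) = ((k : ℤ) : ℝ) := by push_cast; exact h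
    exact_mod_cast this
  · intro h
    have : ((∑ i, m i ^ 2 : ℤ) : ℝ) = ((k : ℤ) : ℝ) := by rw [h]
    push_cast at this
    exact this

theorem integral_exp_int_mul (x : ℝ) (j : ℤ) :
    ∫ t in x..x + 1, cexp (2 * Real.pi * I * j * t) = if j = 0 then 1 else 0 := by
  split_ifs with h
  · simp [h]
  · have hc : (2 * Real.pi * I * j : ℂ) ≠ 0 := by
      have := Real.pi_ne_zero
      simp [h, this]
    rw [integral_exp_mul_complex hc]
    have : cexp (2 * Real.pi * I * j * ((x + 1 : ℝ) : ℂ)) = cexp (2 * Real.pi * I * j * x) := by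
      rw [Complex.exp_eq_exp_iff_exists_int]
      exact ⟨j, by push_cast; ring⟩
    rw [this]; simp

theorem prod_circleTerm (Λ t : ℝ) (m : Fin d → ℤ) : ∏ i, circleTerm Λ t (m i) =
    (Λ : ℂ)⁻¹ ^ d * (Real.exp (-(2 * Real.pi * (∑ i, m i ^ 2 : ℤ) / Λ ^ 2)) *
      cexp (2 * Real.pi * I * ((∑ i, m i ^ 2 : ℤ) * t))) := by
  simp_rw [circleTerm, Finset.prod_mul_distrib]
  congr 1
  · simp
  congr 1
  · rw [← ofReal_prod, ← Real.exp_sum]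
    congr 2
    push_cast
    rw [Finset.sum_neg_distrib, ← Finset.sum_div, Finset.mul_sum]
  · rw [← Complex.exp_sum]
    congr 1
    push_cast
    rw [Finset.sum_mul, Finset.mul_sum]

/-- Integration over one period keeps only the m with |m|² = k, and on that sphere the Gaussian
weight is constant. Any real starting point x is allowed, so the period can be placed to suit the
arcs. -/
theorem integral_circleOp {Λ : ℝ} (hΛ : 0 < Λ) {f : (Fin d → ℤ) → ℂ} {S : ℝ}
    (hf : ∀ n, ‖f n‖ ≤ S) (n : Fin d → ℤ) {r : ℝ} (hr : 0 ≤ r) {k : ℕ} (hk : r ^ 2 = k) (x : ℝ) :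
    ∫ t in x..x + 1, cexp (-(2 * Real.pi * I * k * t)) * circleOp Λ t f n =
      (Λ : ℂ)⁻¹ ^ d * Real.exp (-(2 * Real.pi * k / Λ ^ 2)) *
        ∑ m ∈ latticeSphere d r, f (n - m) := by
  set F : (Fin d → ℤ) → ℝ → ℂ := fun m t =>
    cexp (-(2 * Real.pi * I * k * t)) * ((∏ i, circleTerm Λ t (m i)) * f (n - m)) with hF
  have hFc : ∀ m, Continuous (F m) := fun m => by
    have := continuous_finsetProd Finset.univ fun (i : Fin d) _ => continuous_circleTerm Λ (m i)
    simp only [hF]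
    fun_prop
  have hnorm : ∀ m t, ‖F m t‖ = ‖(∏ i, circleTerm Λ 0 (m i)) * f (n - m)‖ := fun m t => by
    have h : (-(2 * Real.pi * I * k * t) : ℂ) = ((-(2 * Real.pi * k * t) : ℝ) : ℂ) * I := by
      push_cast; ring
    simp only [hF]
    rw [norm_mul, h, norm_exp_ofReal_mul_I, one_mul]
    simp_rw [norm_mul, norm_prod, norm_circleTerm hΛ]
  have hval : ∀ m, ∫ t in x..x + 1, F m t = if m ∈ latticeSphere d r then
      (Λ : ℂ)⁻¹ ^ d * Real.exp (-(2 * Real.pi * k / Λ ^ 2)) * f (n - m) else 0 := fun m => by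
    have h1 : ∀ t : ℝ, F m t = (Λ : ℂ)⁻¹ ^ d *
        Real.exp (-(2 * Real.pi * (∑ i, m i ^ 2 : ℤ) / Λ ^ 2)) * f (n - m) *
          cexp (2 * Real.pi * I * ((∑ i, m i ^ 2 - k : ℤ) : ℂ) * t) := fun t => by
      have h2 : cexp (2 * Real.pi * I * ((∑ i, m i ^ 2 - k : ℤ) : ℂ) * t) =
          cexp (-(2 * Real.pi * I * k * t)) *
            cexp (2 * Real.pi * I * ((∑ i, m i ^ 2 : ℤ) * t)) := by
        rw [← Complex.exp_add]
        congr 1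
        push_cast
        ring
      simp only [hF]
      rw [prod_circleTerm, h2]
      ring
    simp_rw [h1]
    rw [intervalIntegral.integral_const_mul, integral_exp_int_mul]
    by_cases h : ∑ i, m i ^ 2 = (k : ℤ)
    · rw [if_pos (sub_eq_zero.2 h), if_pos ((mem_latticeSphere_iff hr hk m).2 h), h]; simp
    · rw [if_neg (sub_ne_zero.2 h), if_neg (mt (mem_latticeSphere_iff hr hk m).1 h), mul_zero]
  have hsum := hasSum_integral_of_summable_integral_norm (F := F)
    (μ := volume.restrict (Set.Ioc x (x + 1))) (fun m => ((hFc m).integrableOn_Ioc))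
    (by
      simp_rw [hnorm]
      simpa using summable_prod_circleTerm_mul hΛ 0 hf n)
  have hle : x ≤ x + 1 := by linarith
  rw [intervalIntegral.integral_of_le hle]
  simp_rw [← intervalIntegral.integral_of_le hle, hval] at hsum
  rw [intervalIntegral.integral_of_le hle] at hsum
  have e1 : ∀ t : ℝ, cexp (-(2 * Real.pi * I * k * t)) * circleOp Λ t f n = ∑' m, F m t := fun t => by
    simp only [hF, circleOp, tsum_mul_left]
  simp_rw [e1]
  rw [← hsum.tsum_eq, tsum_eq_sum (s := latticeSphere d r) (fun m hm => if_neg hm), Finset.mul_sum]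
  exact Finset.sum_congr rfl fun m hm => if_pos hm

end CircleMethod

/-! ### Dirichlet dissection of the circle -/

/-- Reduced fractions with an integer shift: the index `⟨q, a, l⟩` stands for the fraction
`a / (q + 1) + (l - 2)`. -/
abbrev ArcIndex : Type := Σ q : ℕ, (ZMod (q + 1))ˣ × Fin 4

/-- The denominator of a fraction. -/
abbrev ArcIndex.den (i : ArcIndex) : ℕ := i.1 + 1

/-- The numerator of a fraction. -/
def ArcIndex.num (i : ArcIndex) : ℤ := (i.2.1 : ZMod (i.1 + 1)).val + (i.1 + 1 : ℕ) * ((i.2.2 : ℕ) - 2 : ℤ)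

theorem ArcIndex.num_cast (i : ArcIndex) : (i.num : ZMod i.den) = (i.2.1 : ZMod (i.1 + 1)) := by
  rw [ArcIndex.num, Int.cast_add, Int.cast_mul, Int.cast_natCast, Int.cast_natCast, ZMod.natCast_self, zero_mul, add_zero,
    ZMod.natCast_zmod_val]

theorem ArcIndex.isUnit_num (i : ArcIndex) : IsUnit (i.num : ZMod i.den) := by
  rw [i.num_cast]
  exact i.2.1.isUnit

theorem exists_arcIndex_of_rat {x : ℚ} (h1 : -2 ≤ x) (h2 : x < 2) :
    ∃ i : ArcIndex, i.den = x.den ∧ (i.num : ℝ) / i.den = x ∧ (i.2.2 : ℤ) = ⌊x⌋ + 2 := by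
  obtain ⟨q, hq⟩ : ∃ q, x.den = q + 1 := ⟨x.den - 1, by have := x.den_pos; omega⟩
  have hu : IsUnit (x.num : ZMod (q + 1)) := by
    rw [ZMod.coe_int_isUnit_iff_isCoprime, Int.isCoprime_iff_nat_coprime, Int.natAbs_natCast, ← hq]
    exact x.reduced.symm
  have hf1 : -2 ≤ ⌊x⌋ := Int.le_floor.2 (by exact_mod_cast h1)
  have hf2 : ⌊x⌋ < 2 := Int.floor_lt.2 (by exact_mod_cast h2)
  refine ⟨⟨q, hu.unit, ⟨(⌊x⌋ + 2).toNat, by omega⟩⟩, hq.symm, ?_, by simp; omega⟩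
  have hval : ((hu.unit : ZMod (q + 1)).val : ℤ) = x.num % ((q + 1 : ℕ) : ℤ) := by
    rw [IsUnit.unit_spec]
    exact ZMod.val_intCast _
  have hl : (((⌊x⌋ + 2).toNat : ℕ) : ℤ) - 2 = x.num / ((q + 1 : ℕ) : ℤ) := by
    rw [Int.toNat_of_nonneg (by omega), Rat.floor_def', hq]
    ring
  have hnum : ArcIndex.num ⟨q, hu.unit, ⟨(⌊x⌋ + 2).toNat, by omega⟩⟩ = x.num := by
    simp only [ArcIndex.num]
    rw [hval, hl, Int.emod_add_mul_ediv]
  rw [hnum, ArcIndex.den, ← hq]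
  exact (Rat.cast_def x).symm

theorem exists_arcIndex {Λ t : ℝ} (hΛ : 1 ≤ Λ) (h1 : -1 ≤ t) (h2 : t ≤ 1) :
    ∃ i : ArcIndex, (i.den : ℝ) ≤ Λ ∧ |t - i.num / i.den| < 1 / (i.den * Λ) ∧
      (i.2.2 : ℤ) = ⌊(i.num : ℝ) / i.den⌋ + 2 := by
  have hn : 0 < ⌊Λ⌋₊ := Nat.floor_pos.2 hΛ
  obtain ⟨x, hx1, hx2⟩ := Real.exists_rat_abs_sub_le_and_den_le t hn
  have hd : (0 : ℝ) < x.den := by exact_mod_cast x.den_pos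
  have hd1 : (1 : ℝ) ≤ x.den := by exact_mod_cast x.den_pos
  have hlt : |t - x| < 1 / (x.den * Λ) := by
    refine hx1.trans_lt (one_div_lt_one_div_of_lt (by positivity) ?_)
    rw [mul_comm]
    exact mul_lt_mul_of_pos_right (Nat.lt_floor_add_one Λ) hd
  -- For t in [-1,1] the approximant therefore lies in (-2,2), so four integer shifts of the
  -- fractions in [0,1) suffice.
  have hlt1 : |t - x| < 1 := hlt.trans_le (by
    rw [div_le_one (by positivity)]
    nlinarith)
  rw [abs_lt] at hlt1
  have hx3 : (-2 : ℝ) < x := by linarith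
  have hx4 : (x : ℝ) < 2 := by linarith
  obtain ⟨i, hi1, hi2, hi3⟩ := exists_arcIndex_of_rat (x := x) (by exact_mod_cast hx3.le)
    (by exact_mod_cast hx4)
  refine ⟨i, ?_, ?_, ?_⟩
  · rw [hi1]
    exact (Nat.cast_le.2 hx2).trans (Nat.floor_le (by linarith))
  · rw [hi2, hi1]; exact hlt
  · rw [hi2, hi3, Rat.floor_cast]

theorem lintegral_arc_le {Λ : ℝ} (hΛ : 0 < Λ) (i : ArcIndex) (g : ℝ → ℝ≥0∞) :
    ∫⁻ t in {t : ℝ | |t - i.num / i.den| ≤ 1 / (i.den * Λ)}, g t ≤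
      ENNReal.ofReal ((Λ ^ 2)⁻¹) * ∫⁻ u in {u : ℝ | i.den * |u| ≤ Λ},
        g (i.num / i.den + u / Λ ^ 2) := by
  have hd : (0 : ℝ) < i.den := by exact_mod_cast Nat.pos_of_ne_zero (NeZero.ne _)
  have hmeas : MeasurableSet {u : ℝ | i.den * |u| ≤ Λ} :=
    measurableSet_le (by fun_prop) measurable_const
  have himg : {t : ℝ | |t - i.num / i.den| ≤ 1 / (i.den * Λ)} ⊆
      (fun u : ℝ => i.num / i.den + u / Λ ^ 2) '' {u : ℝ | i.den * |u| ≤ Λ} := by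
    intro t ht
    refine ⟨(t - i.num / i.den) * Λ ^ 2, ?_, by field_simp; ring⟩
    have h : |t - i.num / i.den| ≤ 1 / (i.den * Λ) := ht
    change i.den * |(t - i.num / i.den) * Λ ^ 2| ≤ Λ
    rw [abs_mul, abs_of_pos (show 0 < Λ ^ 2 by positivity)]
    rw [le_div_iff₀ (by positivity)] at h
    nlinarith
  refine (lintegral_mono_set himg).trans (le_of_eq ?_)
  rw [lintegral_image_eq_lintegral_abs_deriv_mul hmeas (f' := fun _ => (Λ ^ 2)⁻¹)
    ?_ ?_, ← lintegral_const_mul' _ _ ENNReal.ofReal_ne_top]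
  · rw [abs_of_pos (by positivity)]
  · intro u _
    have := ((hasDerivAt_id u).div_const (Λ ^ 2)).const_add ((i.num : ℝ) / i.den)
    simpa using this.hasDerivWithinAt
  · intro u _ v _ h
    simpa [hΛ.ne'] using h

/-- Only an upper bound is sought, so the arcs may overlap; each is rescaled by u = Λ²(t - a/q). -/
theorem lintegral_le_tsum_arcs {Λ : ℝ} (hΛ : 0 < Λ) {s : Set ℝ} {T : Set ArcIndex}
    (hs : ∀ t ∈ s, ∃ i ∈ T, |t - i.num / i.den| ≤ 1 / (i.den * Λ)) (g : ℝ → ℝ≥0∞) :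
    ∫⁻ t in s, g t ≤ ∑' i : T, ENNReal.ofReal ((Λ ^ 2)⁻¹) *
      ∫⁻ u in {u : ℝ | (i : ArcIndex).den * |u| ≤ Λ},
        g ((i : ArcIndex).num / (i : ArcIndex).den + u / Λ ^ 2) := by
  have hsub : s ⊆ ⋃ i : T, {t : ℝ | |t - (i : ArcIndex).num / (i : ArcIndex).den| ≤
      1 / ((i : ArcIndex).den * Λ)} := by
    intro t ht
    obtain ⟨i, hi, h⟩ := hs t ht
    exact Set.mem_iUnion.2 ⟨⟨i, hi⟩, h⟩
  refine (lintegral_mono_set hsub).trans ((lintegral_iUnion_le _ _).trans ?_)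
  exact ENNReal.tsum_le_tsum fun i => lintegral_arc_le hΛ _ _

/-! ### Arc weights and the singular integral -/

theorem arcDecay_le_one (q : ℕ) [NeZero q] (u : ℝ) : arcDecay q u ≤ 1 := by
  have hq : (1 : ℝ) ≤ q := by exact_mod_cast Nat.pos_of_ne_zero (NeZero.ne q)
  unfold arcDecay
  exact mul_le_one₀ (Real.rpow_le_one_of_one_le_of_nonpos hq (by norm_num)) (by positivity)
    (Real.rpow_le_one_of_one_le_of_nonpos (by nlinarith [sq_nonneg u]) (by norm_num))

theorem arcDecay_pow_le {d : ℕ} (hd : 5 ≤ d) (q : ℕ) [NeZero q] (u : ℝ) :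
    arcDecay q u ^ d ≤ (q : ℝ) ^ (-(5 / 2) : ℝ) * (1 + u ^ 2) ^ (-(5 / 4) : ℝ) := by
  refine (pow_le_pow_of_le_one (arcDecay_pos q u).le (arcDecay_le_one q u) hd).trans (le_of_eq ?_)
  rw [arcDecay, mul_pow, ← Real.rpow_natCast, ← Real.rpow_natCast, ← Real.rpow_mul (by positivity),
    ← Real.rpow_mul (by positivity)]
  norm_num

/-- This is where d ≥ 5 is decisive: -5/4 + 1/2 = -3/4 is below -1/2, so the weight is integrable in
u, and q^{-5/2} stays summable after multiplication by the number of numerators. The exponent 4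
would give the non-integrable (1+u²)^{-1/2}. -/
theorem arcDecay_pow_mul_le {d : ℕ} (hd : 5 ≤ d) (q : ℕ) [NeZero q] (u : ℝ) :
    arcDecay q u ^ d * (1 + |u|) ≤
      2 * (q : ℝ) ^ (-(5 / 2) : ℝ) * (1 + u ^ 2) ^ (-(3 / 4) : ℝ) := by
  have h1 : 1 + |u| ≤ 2 * (1 + u ^ 2) ^ (1 / 2 : ℝ) := by
    rw [← Real.sqrt_eq_rpow]
    have h2 : |u| ≤ √(1 + u ^ 2) := Real.abs_le_sqrt (by linarith)
    have h3 : 1 ≤ √(1 + u ^ 2) := Real.one_le_sqrt.2 (by nlinarith [sq_nonneg u])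
    linarith
  have h2 : (1 + u ^ 2 : ℝ) ^ (-(5 / 4) : ℝ) * (1 + u ^ 2) ^ (1 / 2 : ℝ) =
      (1 + u ^ 2) ^ (-(3 / 4) : ℝ) := by
    rw [← Real.rpow_add (by positivity)]; norm_num
  refine (mul_le_mul (arcDecay_pow_le hd q u) h1 (by positivity) (by positivity)).trans
    (le_of_eq ?_)
  rw [← h2]; ring

theorem integrable_arcWeight : Integrable fun u : ℝ => (1 + u ^ 2) ^ (-(3 / 4) : ℝ) := by
  have h := integrable_rpow_neg_one_add_norm_sq (μ := (volume : Measure ℝ)) (r := 3 / 2)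
    (by norm_num)
  refine h.congr (Filter.Eventually.of_forall fun u => ?_)
  simp only [Real.norm_eq_abs, sq_abs]
  norm_num

/-- The mass of the weight `(1 + u²)^(-3/4)`. -/
def arcMass : ℝ := ∫ u : ℝ, (1 + u ^ 2) ^ (-(3 / 4) : ℝ)

theorem arcMass_nonneg : 0 ≤ arcMass := integral_nonneg fun u => by positivity

theorem continuous_arcFactor : Continuous arcFactor := by
  unfold arcFactor
  refine continuous_const.div (Continuous.cpow (by fun_prop) continuous_const fun u => ?_) fun u => ?_
  · left; simp
  · have h0 : (2 * (1 - I * u) : ℂ) ≠ 0 := mul_ne_zero two_ne_zero (one_sub_I_mul_ne_zero u)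
    simp [cpow_eq_zero_iff, h0]

/-- The singular integral. -/
def singularIntegral (d : ℕ) : ℂ := ∫ u : ℝ, cexp (-(2 * Real.pi * I * u)) * arcFactor u ^ d

theorem norm_cexp_neg_two_pi (x : ℝ) : ‖cexp (-(2 * Real.pi * I * x))‖ = 1 := by
  have h : (-(2 * Real.pi * I * x) : ℂ) = ((-(2 * Real.pi * x) : ℝ) : ℂ) * I := by
    push_cast; ring
  rw [h, norm_exp_ofReal_mul_I]

theorem circleOp_one {Λ : ℝ} (hΛ : 0 < Λ) (d q : ℕ) (a : ℤ) (u : ℝ) :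
    circleOp Λ (a / q + u / Λ ^ 2) (fun _ : Fin d → ℤ => 1) 0 = normTheta Λ q a u 0 ^ d := by
  rw [← arcOp_eq_circleOp hΛ, arcOp]
  simp_rw [mul_one]
  rw [(hasSum_pi_prod (fun (_ : Fin d) m => arcTerm Λ q a u m)
    fun _ => summable_norm_arcTerm hΛ q a u).2, ← tsum_arcTerm_mul]
  simp

theorem continuous_normTheta_pow {Λ : ℝ} (hΛ : 0 < Λ) (d q : ℕ) (a : ℤ) :
    Continuous fun u => normTheta Λ q a u 0 ^ d := by
  simp_rw [← circleOp_one hΛ]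
  exact (continuous_circleOp hΛ (f := fun _ : Fin d → ℤ => 1) (S := 1) (fun _ => by simp) 0).comp
    (show Continuous fun u : ℝ => (a : ℝ) / q + u / Λ ^ 2 by fun_prop)

theorem norm_normTheta_pow_sub_le {Λ : ℝ} (hΛ : 0 < Λ) (d : ℕ) {q : ℕ} [NeZero q] {a : ℤ} {u : ℝ}
    (ha : IsUnit (a : ZMod q)) (hqΛ : q ≤ Λ) (huΛ : q * |u| ≤ Λ) :
    ‖normTheta Λ q a u 0 ^ d - (arcFactor u * (q : ℂ)⁻¹ * quadGauss q a 0) ^ d‖ ≤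
      (arcConst * arcDecay q u) ^ d * (d * (q * (1 + |u|) / Λ)) := by
  have hB := arcDecay_pos q u
  have hT := thetaConst_nonneg
  have hC := arcConst_pos
  have hδ := arc_delta_le_two hΛ hqΛ huΛ
  have hδ0 : 0 ≤ q * (1 + |u|) / Λ := by positivity
  have h := norm_prod_sub_prod_le (Finset.univ : Finset (Fin d)) (M := arcConst * arcDecay q u)
    (x := fun _ => normTheta Λ q a u 0)
    (y := fun _ => arcFactor u * (q : ℂ)⁻¹ * quadGauss q a 0)
    (e := fun _ => q * (1 + |u|) / Λ) (by positivity) ?_ ?_ ?_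
  · simpa using h
  · intro i _
    refine (norm_normTheta_le hΛ ha hqΛ huΛ _).trans ?_
    unfold arcConst; gcongr <;> linarith
  · intro i _
    refine (norm_arcFactor_mul_quadGauss_le q a ha 0 u).trans ?_
    unfold arcConst; nlinarith [mul_nonneg hT hB.le]
  · intro i _
    have h1 := norm_normTheta_sub_le hΛ q a ha u 0
    simp only [mul_zero, round_zero, Int.cast_zero, sub_zero, neg_zero, arcGauss, ofReal_zero, ne_eq,
      OfNat.ofNat_ne_zero, not_false_eq_true, zero_pow, Complex.exp_zero, mul_one] at h1
    refine h1.trans ?_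
    have h2 : (q * (1 + |u|) / Λ) ^ 2 ≤ 2 * (q * (1 + |u|) / Λ) := by nlinarith
    calc _ ≤ thetaConst * arcDecay q u * (2 * (q * (1 + |u|) / Λ)) := by gcongr
      _ = (2 * thetaConst) * arcDecay q u * (q * (1 + |u|) / Λ) := by ring
      _ ≤ _ := by
        gcongr
        unfold arcConst; linarith

/-- The constant in `norm_arcIntegral_sub_le`. -/
def arcIntegralConst (d : ℕ) : ℝ := (2 * d * arcConst ^ d + 1) * arcMass

/-- Inside the arc, replacing the theta series by its main term costs a relative error
O(q(1+|u|)/Λ). Outside, where |u| ≥ Λ/q, completing the integral to the line costs (1+u²)^{-1/2} ≤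
q/Λ. Both leave the same integrable weight. -/
theorem norm_arcIntegral_sub_le {d : ℕ} (hd : 5 ≤ d) {Λ : ℝ} (hΛ : 0 < Λ) {q : ℕ} [NeZero q] {a : ℤ}
    (ha : IsUnit (a : ZMod q)) (hqΛ : q ≤ Λ) :
    ‖(∫ u in -(Λ / q)..Λ / q, cexp (-(2 * Real.pi * I * u)) * normTheta Λ q a u 0 ^ d) -
      ((q : ℂ)⁻¹ * quadGauss q a 0) ^ d * singularIntegral d‖ ≤
      arcIntegralConst d * ((q : ℝ) ^ (-(5 / 2) : ℝ) * (q / Λ)) := by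
  have hq : (0 : ℝ) < q := by exact_mod_cast Nat.pos_of_ne_zero (NeZero.ne q)
  have hC := arcConst_pos
  set U := Λ / q with hU
  have hU0 : 0 < U := by positivity
  have hbase : ∀ u : ℝ, 0 < 1 + u ^ 2 := fun u => by positivity
  have hcont1 : Continuous fun u : ℝ =>
      cexp (-(2 * Real.pi * I * u)) * normTheta Λ q a u 0 ^ d := by
    have := continuous_normTheta_pow hΛ d q a
    fun_prop
  have hcont2 : Continuous fun u : ℝ => cexp (-(2 * Real.pi * I * u)) *
      (arcFactor u * (q : ℂ)⁻¹ * quadGauss q a 0) ^ d := by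
    have := continuous_arcFactor
    fun_prop
  have hb2 : ∀ u : ℝ, ‖cexp (-(2 * Real.pi * I * u)) *
      (arcFactor u * (q : ℂ)⁻¹ * quadGauss q a 0) ^ d‖ ≤
        (q : ℝ) ^ (-(5 / 2) : ℝ) * (1 + u ^ 2) ^ (-(5 / 4) : ℝ) := fun u => by
    rw [norm_mul, norm_cexp_neg_two_pi, one_mul, norm_pow]
    exact (pow_le_pow_left₀ (norm_nonneg _) (norm_arcFactor_mul_quadGauss_le q a ha 0 u) d).trans
      (arcDecay_pow_le hd q u)
  have h_integrable : Integrable fun u : ℝ => cexp (-(2 * Real.pi * I * u)) *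
      (arcFactor u * (q : ℂ)⁻¹ * quadGauss q a 0) ^ d := by
    refine (integrable_arcWeight.const_mul ((q : ℝ) ^ (-(5 / 2) : ℝ))).mono'
      hcont2.aestronglyMeasurable (Filter.Eventually.of_forall fun u => (hb2 u).trans ?_)
    refine mul_le_mul_of_nonneg_left ?_ (by positivity)
    exact Real.rpow_le_rpow_of_exponent_le (by nlinarith [sq_nonneg u]) (by norm_num)
  have hJ : ((q : ℂ)⁻¹ * quadGauss q a 0) ^ d * singularIntegral d =
      ∫ u : ℝ, cexp (-(2 * Real.pi * I * u)) *
        (arcFactor u * (q : ℂ)⁻¹ * quadGauss q a 0) ^ d := by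
    rw [singularIntegral, ← integral_const_mul]
    refine integral_congr_ae (Filter.Eventually.of_forall fun u => ?_)
    simp only
    ring
  rw [hJ, intervalIntegral.integral_of_le (by linarith), ← integral_indicator measurableSet_Ioc,
    ← integral_sub ((hcont1.integrableOn_Ioc).integrable_indicator measurableSet_Ioc) h_integrable]
  have hbound := norm_integral_le_of_norm_le
    (integrable_arcWeight.const_mul
      ((2 * d * arcConst ^ d + 1) * ((q : ℝ) ^ (-(5 / 2) : ℝ) * (q / Λ))))
    (f := fun u => (Set.Ioc (-U) U).indicator
      (fun u : ℝ => cexp (-(2 * Real.pi * I * u)) * normTheta Λ q a u 0 ^ d) u -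
        cexp (-(2 * Real.pi * I * u)) * (arcFactor u * (q : ℂ)⁻¹ * quadGauss q a 0) ^ d)
    (Filter.Eventually.of_forall fun u => ?_)
  · refine hbound.trans (le_of_eq ?_)
    rw [integral_const_mul, arcIntegralConst, arcMass]
    ring
  · have hw : 0 ≤ (q : ℝ) ^ (-(5 / 2) : ℝ) * (q / Λ) * (1 + u ^ 2) ^ (-(3 / 4) : ℝ) := by positivity
    by_cases hu : u ∈ Set.Ioc (-U) U
    · rw [Set.indicator_of_mem hu, ← mul_sub, norm_mul, norm_cexp_neg_two_pi, one_mul]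
      have huU : |u| ≤ U := abs_le.2 ⟨hu.1.le, hu.2⟩
      have huΛ : q * |u| ≤ Λ := by
        rw [hU, le_div_iff₀ hq] at huU; linarith
      refine (norm_normTheta_pow_sub_le hΛ d ha hqΛ huΛ).trans ?_
      calc _ = arcConst ^ d * d * (q / Λ) * (arcDecay q u ^ d * (1 + |u|)) := by
            rw [mul_pow]; ring
        _ ≤ arcConst ^ d * d * (q / Λ) *
            (2 * (q : ℝ) ^ (-(5 / 2) : ℝ) * (1 + u ^ 2) ^ (-(3 / 4) : ℝ)) := by
            exact mul_le_mul_of_nonneg_left (arcDecay_pow_mul_le hd q u) (by positivity)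
        _ = 2 * d * arcConst ^ d *
            ((q : ℝ) ^ (-(5 / 2) : ℝ) * (q / Λ) * (1 + u ^ 2) ^ (-(3 / 4) : ℝ)) := by ring
        _ ≤ _ := by linarith
    · rw [Set.indicator_of_notMem hu, zero_sub, norm_neg]
      have huU : U ≤ |u| := by
        by_contra! h
        rw [abs_lt] at h
        exact hu ⟨h.1, h.2.le⟩
      have h1 : (1 + u ^ 2) ^ (-(1 / 2) : ℝ) ≤ q / Λ := by
        rw [Real.rpow_neg (hbase u).le, ← Real.sqrt_eq_rpow, ← inv_div]
        exact inv_anti₀ hU0 (huU.trans (Real.abs_le_sqrt (by linarith)))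
      have h2 : (1 + u ^ 2 : ℝ) ^ (-(5 / 4) : ℝ) =
          (1 + u ^ 2) ^ (-(1 / 2) : ℝ) * (1 + u ^ 2) ^ (-(3 / 4) : ℝ) := by
        rw [← Real.rpow_add (hbase u)]; norm_num
      have h3 : (q : ℝ) ^ (-(5 / 2) : ℝ) * (1 + u ^ 2) ^ (-(5 / 4) : ℝ) ≤
          (q : ℝ) ^ (-(5 / 2) : ℝ) * (q / Λ) * (1 + u ^ 2) ^ (-(3 / 4) : ℝ) := by
        rw [h2, ← mul_assoc]
        gcongr
      have h4 : 0 ≤ 2 * (d : ℝ) * arcConst ^ d := by positivity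
      refine ((hb2 u).trans h3).trans ?_
      nlinarith [mul_nonneg h4 hw]

/-- Trading q^{3/4} ≤ Λ^{3/4} gives decay in Λ while the power of q left over is still summable. -/
theorem mul_rpow_mul_div_le {q Λ : ℝ} (hq : 0 < q) (hqΛ : q ≤ Λ) :
    q * (q ^ (-(5 / 2) : ℝ) * (q / Λ)) ≤ q ^ (-(5 / 4) : ℝ) * Λ ^ (-(1 / 4) : ℝ) := by
  have hΛ : 0 < Λ := hq.trans_le hqΛ
  have h1 : q * (q ^ (-(5 / 2) : ℝ) * (q / Λ)) =
      q ^ (-(5 / 4) : ℝ) * (q ^ (3 / 4 : ℝ) * Λ ^ (-1 : ℝ)) := by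
    have h2 : q ^ (-(5 / 4) : ℝ) * q ^ (3 / 4 : ℝ) = q * q ^ (-(5 / 2) : ℝ) * q := by
      nth_rw 3 [← Real.rpow_one q]
      nth_rw 5 [← Real.rpow_one q]
      rw [← Real.rpow_add hq, ← Real.rpow_add hq, ← Real.rpow_add hq]
      norm_num
    rw [Real.rpow_neg_one]
    linear_combination (-Λ⁻¹) * h2
  have h3 : Λ ^ (-(1 / 4) : ℝ) = Λ ^ (3 / 4 : ℝ) * Λ ^ (-1 : ℝ) := by
    rw [← Real.rpow_add hΛ]; norm_num
  rw [h1, h3]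
  gcongr

theorem rpow_le_of_le_two_mul {q Λ : ℝ} (hΛ : 0 < Λ) (hqΛ : Λ ≤ 2 * q) :
    q ^ (-(3 / 2) : ℝ) ≤ 2 * (q ^ (-(5 / 4) : ℝ) * Λ ^ (-(1 / 4) : ℝ)) := by
  have hq : 0 < q := by linarith
  have h1 : q ^ (-(3 / 2) : ℝ) = q ^ (-(5 / 4) : ℝ) * q ^ (-(1 / 4) : ℝ) := by
    rw [← Real.rpow_add hq]; norm_num
  have h2 : q ^ (-(1 / 4) : ℝ) ≤ 2 * Λ ^ (-(1 / 4) : ℝ) := by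
    have h3 : (2 * q) ^ (-(1 / 4) : ℝ) ≤ Λ ^ (-(1 / 4) : ℝ) :=
      Real.rpow_le_rpow_of_nonpos hΛ hqΛ (by norm_num)
    rw [Real.mul_rpow (by norm_num) hq.le] at h3
    have h4 : (1 / 2 : ℝ) ≤ 2 ^ (-(1 / 4) : ℝ) := by
      have : (2 : ℝ) ^ (-1 : ℝ) ≤ 2 ^ (-(1 / 4) : ℝ) :=
        Real.rpow_le_rpow_of_exponent_le (by norm_num) (by norm_num)
      rw [Real.rpow_neg_one] at this
      linarith
    nlinarith [Real.rpow_nonneg hq.le (-(1 / 4) : ℝ)]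
  rw [h1]
  calc _ ≤ q ^ (-(5 / 4) : ℝ) * (2 * Λ ^ (-(1 / 4) : ℝ)) := by gcongr
    _ = _ := by ring

theorem tsum_arcIndex_le (h : ℕ → ℝ≥0∞) :
    ∑' i : ArcIndex, h i.den ≤ ∑' q : ℕ, 4 * ((q + 1 : ℕ) : ℝ≥0∞) * h (q + 1) := by
  rw [ENNReal.tsum_sigma']
  refine ENNReal.tsum_le_tsum fun q => ?_
  simp only [ArcIndex.den]
  rw [tsum_fintype, Finset.sum_const, Finset.card_univ, Fintype.card_prod, ZMod.card_units_eq_totient,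
    Fintype.card_fin, nsmul_eq_mul]
  gcongr
  rw [mul_comm]
  exact_mod_cast Nat.mul_le_mul_left 4 (Nat.totient_le (q + 1))

theorem summable_succ_rpow {s : ℝ} (hs : s < -1) : Summable fun q : ℕ => ((q + 1 : ℕ) : ℝ) ^ s :=
  (summable_nat_add_iff (f := fun q : ℕ => (q : ℝ) ^ s) 1).2 (Real.summable_nat_rpow.2 hs)

theorem lintegral_arcWeight_le {c : ℝ} (hc : 0 ≤ c) (s : Set ℝ) :
    ∫⁻ u in s, ENNReal.ofReal (c * (1 + u ^ 2) ^ (-(3 / 4) : ℝ)) ≤ ENNReal.ofReal (c * arcMass) := by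
  refine (setLIntegral_le_lintegral _ _).trans (le_of_eq ?_)
  rw [← ofReal_integral_eq_lintegral_ofReal (integrable_arcWeight.const_mul c)
    (Filter.Eventually.of_forall fun u => by positivity), integral_const_mul, arcMass]

theorem norm_normTheta_pow_le {d : ℕ} (hd : 5 ≤ d) {Λ : ℝ} (hΛ : 0 < Λ) {q : ℕ} [NeZero q] {a : ℤ}
    {u : ℝ} (ha : IsUnit (a : ZMod q)) (hqΛ : q ≤ Λ) (huΛ : q * |u| ≤ Λ) :
    ‖normTheta Λ q a u 0 ^ d‖ ≤
      arcConst ^ d * (q : ℝ) ^ (-(5 / 2) : ℝ) * (1 + u ^ 2) ^ (-(3 / 4) : ℝ) := by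
  have hT := thetaConst_nonneg
  have hC := arcConst_pos
  have hB := arcDecay_pos q u
  have h1 : ‖normTheta Λ q a u 0‖ ≤ arcConst * arcDecay q u := by
    refine (norm_normTheta_le hΛ ha hqΛ huΛ _).trans ?_
    unfold arcConst; gcongr <;> linarith
  rw [norm_pow]
  refine (pow_le_pow_left₀ (norm_nonneg _) h1 d).trans ?_
  rw [mul_pow, mul_assoc]
  refine mul_le_mul_of_nonneg_left ((arcDecay_pow_le hd q u).trans ?_) (by positivity)
  refine mul_le_mul_of_nonneg_left ?_ (by positivity)
  exact Real.rpow_le_rpow_of_exponent_le (by nlinarith [sq_nonneg u]) (by norm_num)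

/-! ### Major and minor arcs for the number of representations -/

/-- The integrand of the circle method for the number of representations of `k`. -/
def circleIntegrand (d k : ℕ) (Λ t : ℝ) : ℂ :=
  cexp (-(2 * Real.pi * I * k * t)) * circleOp Λ t (fun _ : Fin d → ℤ => 1) 0

theorem continuous_circleIntegrand (d k : ℕ) {Λ : ℝ} (hΛ : 0 < Λ) :
    Continuous (circleIntegrand d k Λ) := by
  have := continuous_circleOp hΛ (f := fun _ : Fin d → ℤ => 1) (S := 1) (fun _ => by simp) 0
  unfold circleIntegrand
  fun_prop

theorem norm_circleIntegrand (d k : ℕ) (Λ t : ℝ) :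
    ‖circleIntegrand d k Λ t‖ = ‖circleOp Λ t (fun _ : Fin d → ℤ => 1) 0‖ := by
  have h := norm_cexp_neg_two_pi (k * t)
  rw [circleIntegrand, norm_mul]
  push_cast at h
  rw [← mul_assoc] at h
  rw [h, one_mul]

/-- The sum of the series of `(q + 1)^(-5/4)`. -/
def denominatorSum : ℝ := ∑' q : ℕ, ((q + 1 : ℕ) : ℝ) ^ (-(5 / 4) : ℝ)

theorem denominatorSum_nonneg : 0 ≤ denominatorSum := tsum_nonneg fun q => by positivity

/-- No separate Weyl estimate is needed: the theta bound holds on every Dirichlet arc, and it is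
small here because the denominators are at least Λ/2. -/
theorem norm_minorArcs_le {d : ℕ} (hd : 5 ≤ d) (k : ℕ) {Λ : ℝ} (hΛ : 0 < Λ) {s : Set ℝ}
    (hs : ∀ t ∈ s, ∃ i : ArcIndex, (Λ ≤ 2 * i.den ∧ i.den ≤ Λ) ∧
      |t - i.num / i.den| ≤ 1 / (i.den * Λ)) :
    Λ ^ 2 * ‖∫ t in s, circleIntegrand d k Λ t‖ ≤
      8 * arcConst ^ d * arcMass * denominatorSum * Λ ^ (-(1 / 4) : ℝ) := by
  have hC := arcConst_pos
  have hM := arcMass_nonneg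
  have hZ := denominatorSum_nonneg
  set T : Set ArcIndex := {i | Λ ≤ 2 * i.den ∧ i.den ≤ Λ} with hT
  have h1 : ‖∫ t in s, circleIntegrand d k Λ t‖ₑ ≤ ENNReal.ofReal ((Λ ^ 2)⁻¹) *
      ENNReal.ofReal (8 * arcConst ^ d * arcMass * denominatorSum * Λ ^ (-(1 / 4) : ℝ)) := by
    refine (enorm_integral_le_lintegral_enorm _).trans
      ((lintegral_le_tsum_arcs hΛ (T := T) hs _).trans ?_)
    rw [ENNReal.tsum_mul_left]
    refine mul_le_mul_right ?_ _
    calc _ ≤ ∑' i : T, ENNReal.ofReal (2 * arcConst ^ d * arcMass *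
            (((i : ArcIndex).den : ℝ)⁻¹ * (((i : ArcIndex).den : ℝ) ^ (-(5 / 4) : ℝ) * Λ ^ (-(1 / 4) : ℝ)))) := by
          refine ENNReal.tsum_le_tsum fun ⟨i, hi⟩ => ?_
          have hden : (0 : ℝ) < i.den := by positivity
          have hmeas : MeasurableSet {u : ℝ | i.den * |u| ≤ Λ} :=
            measurableSet_le (by fun_prop) measurable_const
          calc _ ≤ ∫⁻ u in {u : ℝ | i.den * |u| ≤ Λ}, ENNReal.ofReal
                (arcConst ^ d * (i.den : ℝ) ^ (-(5 / 2) : ℝ) * (1 + u ^ 2) ^ (-(3 / 4) : ℝ)) := by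
                refine setLIntegral_mono' hmeas fun u hu => ?_
                rw [← ofReal_norm, norm_circleIntegrand, circleOp_one hΛ]
                exact ENNReal.ofReal_le_ofReal
                  (norm_normTheta_pow_le hd hΛ i.isUnit_num hi.2 hu)
            _ ≤ _ := lintegral_arcWeight_le (by positivity) _
            _ ≤ _ := by
                refine ENNReal.ofReal_le_ofReal ?_
                have h2 := rpow_le_of_le_two_mul hΛ hi.1
                have h3 : (i.den : ℝ) ^ (-(5 / 2) : ℝ) =
                    (i.den : ℝ)⁻¹ * (i.den : ℝ) ^ (-(3 / 2) : ℝ) := by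
                  rw [← Real.rpow_neg_one, ← Real.rpow_add hden]; norm_num
                rw [h3]
                calc _ ≤ arcConst ^ d * ((i.den : ℝ)⁻¹ *
                      (2 * ((i.den : ℝ) ^ (-(5 / 4) : ℝ) * Λ ^ (-(1 / 4) : ℝ)))) * arcMass := by gcongr
                  _ = _ := by ring
      _ ≤ ∑' i : ArcIndex, ENNReal.ofReal (2 * arcConst ^ d * arcMass *
            ((i.den : ℝ)⁻¹ * ((i.den : ℝ) ^ (-(5 / 4) : ℝ) * Λ ^ (-(1 / 4) : ℝ)))) :=
          ENNReal.tsum_comp_le_tsum_of_injective Subtype.val_injective _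
      _ ≤ _ := tsum_arcIndex_le fun q => ENNReal.ofReal (2 * arcConst ^ d * arcMass *
            ((q : ℝ)⁻¹ * ((q : ℝ) ^ (-(5 / 4) : ℝ) * Λ ^ (-(1 / 4) : ℝ))))
      _ = ∑' q : ℕ, ENNReal.ofReal (8 * arcConst ^ d * arcMass * Λ ^ (-(1 / 4) : ℝ) *
            ((q + 1 : ℕ) : ℝ) ^ (-(5 / 4) : ℝ)) := by
          refine tsum_congr fun q => ?_
          have hq : (0 : ℝ) < (q + 1 : ℕ) := by positivity
          rw [← ENNReal.ofReal_natCast, show (4 : ℝ≥0∞) = ENNReal.ofReal 4 by simp,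
            ← ENNReal.ofReal_mul (by norm_num), ← ENNReal.ofReal_mul (by positivity)]
          congr 1
          field_simp
          ring
      _ = _ := by
          rw [← ENNReal.ofReal_tsum_of_nonneg (fun q => by positivity)
            ((summable_succ_rpow (by norm_num)).mul_left _), tsum_mul_left, denominatorSum]
          congr 1
          ring
  rw [← ENNReal.ofReal_mul (by positivity), ← ofReal_norm,
    ENNReal.ofReal_le_ofReal_iff (by positivity), inv_mul_eq_div, le_div_iff₀ (by positivity)] at h1
  linarith

/-- The choice Λ = √k turns e(-kt) into e(-ka/q) e(-u), so the limiting integral over u does not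
depend on k. -/
theorem integral_majorArc (d : ℕ) {k : ℕ} (hk : 0 < k) (q : ℕ) [NeZero q] (a : ℤ) :
    (√k : ℂ) ^ 2 * ∫ t in (a / q - 1 / (q * √k) : ℝ)..(a / q + 1 / (q * √k) : ℝ),
      circleIntegrand d k (√k) t =
    ZMod.stdAddChar (-((k : ZMod q) * (a : ZMod q))) *
      ∫ u in -(√k / q)..√k / q, cexp (-(2 * Real.pi * I * u)) * normTheta (√k) q a u 0 ^ d := by
  have hΛ : 0 < √(k : ℝ) := Real.sqrt_pos.2 (by exact_mod_cast hk)
  have hsq : √(k : ℝ) ^ 2 = k := Real.sq_sqrt (by positivity)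
  have hq : (q : ℝ) ≠ 0 := by exact_mod_cast NeZero.ne q
  have hq' : (q : ℂ) ≠ 0 := by exact_mod_cast NeZero.ne q
  have hk' : (k : ℂ) ≠ 0 := by exact_mod_cast hk.ne'
  have hc : √(k : ℝ) ^ 2 ≠ 0 := by positivity
  have h := intervalIntegral.integral_comp_add_div (a := -(√(k : ℝ) / q)) (b := √(k : ℝ) / q)
    (circleIntegrand d k (√k)) hc (a / q)
  have e1 : (a : ℝ) / q + -(√(k : ℝ) / q) / √(k : ℝ) ^ 2 = a / q - 1 / (q * √k) := by
    field_simp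
    ring
  have e2 : (a : ℝ) / q + (√(k : ℝ) / q) / √(k : ℝ) ^ 2 = a / q + 1 / (q * √k) := by
    field_simp
  rw [e1, e2, real_smul, ofReal_pow] at h
  rw [← h, ← intervalIntegral.integral_const_mul]
  refine intervalIntegral.integral_congr fun u _ => ?_
  simp only [circleIntegrand]
  rw [circleOp_one hΛ, ← mul_assoc]
  congr 1
  have e3 : -((k : ZMod q) * (a : ZMod q)) = ((-(k * a) : ℤ) : ZMod q) := by push_cast; ring
  rw [e3, ZMod.stdAddChar_coe, ← Complex.exp_add, hsq]
  congr 1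
  push_cast
  field_simp
  ring

/-- The reduced fractions `a / (q + 1)` in `[0, 1)`. -/
abbrev MajorIndex : Type := Σ q : ℕ, (ZMod (q + 1))ˣ

/-- The numerator of a reduced fraction in `[0, 1)`. -/
def MajorIndex.num (p : MajorIndex) : ℕ := (p.2 : ZMod (p.1 + 1)).val

/-- The arc of length `2 / (q Λ)` around a reduced fraction with denominator `q`. -/
def majorArc (Λ : ℝ) (p : MajorIndex) : Set ℝ :=
  Set.Icc ((p.num : ℝ) / (p.1 + 1 : ℕ) - 1 / ((p.1 + 1 : ℕ) * Λ))
    ((p.num : ℝ) / (p.1 + 1 : ℕ) + 1 / ((p.1 + 1 : ℕ) * Λ))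

theorem MajorIndex.ext_of_mul_eq {p p' : MajorIndex}
    (h : p.num * (p'.1 + 1) = p'.num * (p.1 + 1)) : p = p' := by
  obtain ⟨q, a⟩ := p
  obtain ⟨q', a'⟩ := p'
  simp only [MajorIndex.num] at h
  have c1 := ZMod.val_coe_unit_coprime a
  have c2 := ZMod.val_coe_unit_coprime a'
  have d1 : q + 1 ∣ q' + 1 := c1.symm.dvd_of_dvd_mul_left ⟨_, by rw [h, mul_comm]⟩
  have d2 : q' + 1 ∣ q + 1 := c2.symm.dvd_of_dvd_mul_left ⟨_, by rw [← h, mul_comm]⟩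
  have hqq : q = q' := by have := Nat.dvd_antisymm d1 d2; omega
  subst hqq
  have hv := Nat.eq_of_mul_eq_mul_right (Nat.succ_pos q) h
  rw [Units.ext (ZMod.val_injective _ hv)]

/-- Distinct fractions are at least 1/(qq') apart, while the radii add up to (q+q')/(qq'Λ), which is
smaller since q, q' < Λ/2. -/
theorem disjoint_majorArc {Λ : ℝ} (hΛ : 0 < Λ) {p p' : MajorIndex} (hpp : p ≠ p')
    (h1 : 2 * ((p.1 + 1 : ℕ) : ℝ) < Λ) (h2 : 2 * ((p'.1 + 1 : ℕ) : ℝ) < Λ) :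
    Disjoint (majorArc Λ p) (majorArc Λ p') := by
  rw [Set.disjoint_left]
  intro t ht ht'
  have hq : (0 : ℝ) < (p.1 + 1 : ℕ) := by positivity
  have hq' : (0 : ℝ) < (p'.1 + 1 : ℕ) := by positivity
  have hne : (p.num * (p'.1 + 1) : ℤ) - p'.num * (p.1 + 1) ≠ 0 := by
    intro h
    refine hpp (MajorIndex.ext_of_mul_eq ?_)
    rw [sub_eq_zero] at h
    exact_mod_cast h
  have hge : (1 : ℝ) ≤ |(p.num : ℝ) * (p'.1 + 1 : ℕ) - p'.num * (p.1 + 1 : ℕ)| := by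
    have := Int.one_le_abs hne
    exact_mod_cast this
  have e1 : |(p.num : ℝ) / (p.1 + 1 : ℕ) - p'.num / (p'.1 + 1 : ℕ)| ≤
      1 / ((p.1 + 1 : ℕ) * Λ) + 1 / ((p'.1 + 1 : ℕ) * Λ) := by
    rw [abs_le]
    constructor <;> linarith [ht.1, ht.2, ht'.1, ht'.2]
  rw [div_sub_div _ _ hq.ne' hq'.ne', abs_div, abs_of_pos (mul_pos hq hq')] at e1
  have e2 : 1 / (((p.1 + 1 : ℕ) : ℝ) * Λ) + 1 / (((p'.1 + 1 : ℕ) : ℝ) * Λ) =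
      ((p.1 + 1 : ℕ) + (p'.1 + 1 : ℕ)) / Λ / ((p.1 + 1 : ℕ) * (p'.1 + 1 : ℕ)) := by
    field_simp
    ring
  rw [e2, div_le_div_iff_of_pos_right (mul_pos hq hq'), le_div_iff₀ hΛ,
    mul_comm ((p.1 + 1 : ℕ) : ℝ)] at e1
  nlinarith

/-- The period starts at -1/Λ so that the arc around 0 fits without wrapping; at the right end q + 1
≤ Λ suffices. -/
theorem majorArc_subset {Λ : ℝ} (hΛ : 2 ≤ Λ) {p : MajorIndex} (hp : 2 * ((p.1 + 1 : ℕ) : ℝ) < Λ) :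
    majorArc Λ p ⊆ Set.Icc (-(1 / Λ)) (-(1 / Λ) + 1) := by
  have hΛ0 : 0 < Λ := by linarith
  have hq : (1 : ℝ) ≤ (p.1 + 1 : ℕ) := by exact_mod_cast Nat.succ_pos _
  have hq0 : (0 : ℝ) < (p.1 + 1 : ℕ) := by positivity
  refine Set.Icc_subset_Icc ?_ ?_
  · have h1 : 1 / (((p.1 + 1 : ℕ) : ℝ) * Λ) ≤ 1 / Λ :=
      one_div_le_one_div_of_le hΛ0 (by nlinarith)
    have h2 : (0 : ℝ) ≤ (p.num : ℝ) / (p.1 + 1 : ℕ) := by positivity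
    linarith
  · have h3 : (p.num : ℝ) + 1 ≤ (p.1 + 1 : ℕ) := by
      exact_mod_cast ZMod.val_lt (p.2 : ZMod (p.1 + 1))
    have h4 : (p.num : ℝ) / (p.1 + 1 : ℕ) ≤ ((p.1 + 1 : ℕ) - 1) / (p.1 + 1 : ℕ) := by
      gcongr; linarith
    have h5 : (((p.1 + 1 : ℕ) : ℝ) - 1) / (p.1 + 1 : ℕ) + 1 / ((p.1 + 1 : ℕ) * Λ) ≤
        -(1 / Λ) + 1 := by
      rw [← sub_nonneg]
      have : -(1 / Λ) + 1 - ((((p.1 + 1 : ℕ) : ℝ) - 1) / (p.1 + 1 : ℕ) + 1 / ((p.1 + 1 : ℕ) * Λ)) =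
          (Λ - 1 - (p.1 + 1 : ℕ)) / ((p.1 + 1 : ℕ) * Λ) := by
        field_simp
        ring
      rw [this]
      refine div_nonneg ?_ (by positivity)
      linarith
    linarith

/-- A Dirichlet approximant of denominator below Λ/2 would lie in (-1/q, 1), hence in [0,1), and
would put t on a major arc. -/
theorem exists_minor_arcIndex {Λ t : ℝ} (hΛ : 2 ≤ Λ) (ht : t ∈ Set.Icc (-(1 / Λ)) (-(1 / Λ) + 1))
    (hmaj : ∀ p : MajorIndex, 2 * ((p.1 + 1 : ℕ) : ℝ) < Λ → t ∉ majorArc Λ p) :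
    ∃ i : ArcIndex, (Λ ≤ 2 * i.den ∧ i.den ≤ Λ) ∧ |t - i.num / i.den| ≤ 1 / (i.den * Λ) := by
  have hΛ0 : 0 < Λ := by linarith
  have hinv : 1 / Λ ≤ 1 := by rw [div_le_one hΛ0]; linarith
  have hinv0 : 0 < 1 / Λ := by positivity
  obtain ⟨i, h1, h2, h3⟩ := exists_arcIndex (Λ := Λ) (t := t) (by linarith) (by linarith [ht.1])
    (by linarith [ht.2])
  refine ⟨i, ⟨?_, h1⟩, h2.le⟩
  by_contra! hlt
  have hq : (1 : ℝ) ≤ i.den := by exact_mod_cast Nat.succ_pos _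
  have hq0 : (0 : ℝ) < i.den := by positivity
  have h2' := abs_lt.1 h2
  have hle : 1 / (i.den * Λ) ≤ 1 / Λ := one_div_le_one_div_of_le hΛ0 (by nlinarith)
  have hup : (i.num : ℝ) / i.den < 1 := by linarith [ht.2]
  have hlow : -(1 : ℝ) / i.den < i.num / i.den := by
    have e : 1 / Λ + 1 / (i.den * Λ) ≤ 1 / i.den := by
      rw [← sub_nonneg]
      have : 1 / (i.den : ℝ) - (1 / Λ + 1 / (i.den * Λ)) = (Λ - i.den - 1) / (i.den * Λ) := by
        field_simp
        ring
      rw [this]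
      exact div_nonneg (by linarith) (by positivity)
    rw [neg_div]
    linarith [ht.1]
  rw [div_lt_div_iff_of_pos_right hq0] at hlow
  have hnum0 : 0 ≤ i.num := by
    have : (-1 : ℤ) < i.num := by exact_mod_cast hlow
    omega
  have hfl : ⌊(i.num : ℝ) / i.den⌋ = 0 := by
    rw [Int.floor_eq_zero_iff]
    exact ⟨div_nonneg (by exact_mod_cast hnum0) hq0.le, hup⟩
  have hnum : (i.num : ℝ) = (MajorIndex.num ⟨i.1, i.2.1⟩ : ℕ) := by
    rw [hfl, zero_add] at h3
    rw [ArcIndex.num, MajorIndex.num, h3]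
    simp
  refine hmaj ⟨i.1, i.2.1⟩ hlt ?_
  rw [majorArc, ← hnum]
  constructor <;> linarith [h2'.1, h2'.2]

theorem singularTerm_tail_le {d : ℕ} (hd : 5 ≤ d) (k : ℕ) {Λ : ℝ} (hΛ : 0 < Λ) {s : Finset ℕ}
    (hs : ∀ q, q ∉ s → Λ ≤ 2 * ((q + 1 : ℕ) : ℝ)) :
    ‖∑ q ∈ s, singularTerm d k (q + 1) - ∑' q, singularTerm d k q‖ ≤
      2 * √2 ^ d * denominatorSum * Λ ^ (-(1 / 4) : ℝ) := by
  have hsum := (summable_norm_singularTerm hd k).of_norm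
  have hsum1 : Summable fun q => singularTerm d k (q + 1) := (summable_nat_add_iff 1).2 hsum
  rw [hsum.tsum_eq_zero_add, show singularTerm d k 0 = 0 from rfl, zero_add, norm_sub_rev]
  have e : ∑' q, singularTerm d k (q + 1) - ∑ q ∈ s, singularTerm d k (q + 1) =
      ∑' q : ((s : Set ℕ)ᶜ : Set ℕ), singularTerm d k (q + 1) := by
    rw [← hsum1.sum_add_tsum_compl (s := s)]
    ring
  rw [e]
  have hZ : Summable fun q : ℕ => 2 * √2 ^ d * Λ ^ (-(1 / 4) : ℝ) * ((q + 1 : ℕ) : ℝ) ^ (-(5 / 4) : ℝ) :=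
    (summable_succ_rpow (by norm_num)).mul_left _
  refine (tsum_of_norm_bounded ((hZ.subtype ((s : Set ℕ)ᶜ)).hasSum) fun q => ?_).trans ?_
  · refine (norm_singularTerm_le hd k _).trans ?_
    have h := rpow_le_of_le_two_mul hΛ (hs q fun h => q.2 h)
    calc _ ≤ √2 ^ d * (2 * (((q + 1 : ℕ) : ℝ) ^ (-(5 / 4) : ℝ) * Λ ^ (-(1 / 4) : ℝ))) := by gcongr
      _ = _ := by simp only [Function.comp]; ring
  · refine (Summable.tsum_subtype_le _ _ (fun q => by positivity) hZ).trans (le_of_eq ?_)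
    rw [tsum_mul_left, denominatorSum]
    ring

theorem norm_sum_majorArcs_sub_le {d : ℕ} (hd : 5 ≤ d) {k : ℕ} (hk : 0 < k) {s : Finset ℕ}
    (hs : ∀ q ∈ s, ((q + 1 : ℕ) : ℝ) ≤ √k) :
    ‖(√k : ℂ) ^ 2 * (∑ p ∈ s.sigma fun q => (Finset.univ : Finset (ZMod (q + 1))ˣ),
      ∫ t in majorArc (√k) p, circleIntegrand d k (√k) t) -
      singularIntegral d * ∑ q ∈ s, singularTerm d k (q + 1)‖ ≤
      arcIntegralConst d * denominatorSum * √k ^ (-(1 / 4) : ℝ) := by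
  have hΛ : 0 < √(k : ℝ) := Real.sqrt_pos.2 (by exact_mod_cast hk)
  have hA : 0 ≤ arcIntegralConst d := by
    have := arcMass_nonneg
    have := arcConst_pos
    unfold arcIntegralConst; positivity
  rw [Finset.sum_sigma, Finset.mul_sum, Finset.mul_sum, ← Finset.sum_sub_distrib]
  have hterm : ∀ q ∈ s, ‖(√k : ℂ) ^ 2 * (∑ a : (ZMod (q + 1))ˣ,
      ∫ t in majorArc (√k) ⟨q, a⟩, circleIntegrand d k (√k) t) -
      singularIntegral d * singularTerm d k (q + 1)‖ ≤
      arcIntegralConst d * √k ^ (-(1 / 4) : ℝ) * ((q + 1 : ℕ) : ℝ) ^ (-(5 / 4) : ℝ) := by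
    intro q hq
    have hq0 : (0 : ℝ) < (q + 1 : ℕ) := by positivity
    rw [singularTerm_eq, Finset.mul_sum, Finset.mul_sum, ← Finset.sum_sub_distrib]
    refine (norm_sum_le _ _).trans ?_
    have hone : ∀ a : (ZMod (q + 1))ˣ, ‖(√k : ℂ) ^ 2 *
        (∫ t in majorArc (√k) ⟨q, a⟩, circleIntegrand d k (√k) t) -
        singularIntegral d * ((((q + 1 : ℕ) : ℂ)⁻¹ * quadGauss (q + 1) a 0) ^ d *
          ZMod.stdAddChar (-((k : ZMod (q + 1)) * (a : ZMod (q + 1)))))‖ ≤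
        arcIntegralConst d * (((q + 1 : ℕ) : ℝ) ^ (-(5 / 2) : ℝ) * ((q + 1 : ℕ) / √k)) := by
      intro a
      set v : ℤ := ((a : ZMod (q + 1)).val : ℤ) with hv
      have hva : (v : ZMod (q + 1)) = (a : ZMod (q + 1)) := by
        rw [hv, Int.cast_natCast, ZMod.natCast_zmod_val]
      have hvu : IsUnit (v : ZMod (q + 1)) := by rw [hva]; exact a.isUnit
      have h1 := integral_majorArc d hk (q + 1) v
      have h2 := norm_arcIntegral_sub_le hd hΛ hvu (hs q hq)
      have h3 : ∫ t in majorArc (√k) ⟨q, a⟩, circleIntegrand d k (√k) t =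
          ∫ t in (v / (q + 1 : ℕ) - 1 / ((q + 1 : ℕ) * √k) : ℝ)..(v / (q + 1 : ℕ) +
            1 / ((q + 1 : ℕ) * √k) : ℝ), circleIntegrand d k (√k) t := by
        have hpos : 0 < 1 / (((q + 1 : ℕ) : ℝ) * √k) := by positivity
        rw [intervalIntegral.integral_of_le (by linarith), majorArc, integral_Icc_eq_integral_Ioc,
          hv, Int.cast_natCast]
        rfl
      rw [h3, h1, ← hva]
      have e : ∀ x y z w : ℂ, x * y - z * (w * x) = x * (y - w * z) := fun x y z w => by ring
      rw [e, norm_mul, norm_stdAddChar, one_mul]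
      exact h2
    refine (Finset.sum_le_card_nsmul _ _ _ fun a _ => hone a).trans ?_
    rw [Finset.card_univ, ZMod.card_units_eq_totient, nsmul_eq_mul]
    have h5 := mul_rpow_mul_div_le hq0 (hs q hq)
    calc _ ≤ ((q + 1 : ℕ) : ℝ) *
          (arcIntegralConst d * (((q + 1 : ℕ) : ℝ) ^ (-(5 / 2) : ℝ) * ((q + 1 : ℕ) / √k))) := by
          gcongr
          exact Nat.totient_le _
      _ = arcIntegralConst d * (((q + 1 : ℕ) : ℝ) *
          (((q + 1 : ℕ) : ℝ) ^ (-(5 / 2) : ℝ) * ((q + 1 : ℕ) / √k))) := by ring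
      _ ≤ arcIntegralConst d * (((q + 1 : ℕ) : ℝ) ^ (-(5 / 4) : ℝ) * √k ^ (-(1 / 4) : ℝ)) := by
          gcongr
      _ = _ := by ring
  refine (norm_sum_le _ _).trans ((Finset.sum_le_sum hterm).trans ?_)
  rw [← Finset.mul_sum]
  calc _ ≤ arcIntegralConst d * √k ^ (-(1 / 4) : ℝ) * denominatorSum := by
        gcongr
        exact (summable_succ_rpow (by norm_num)).sum_le_tsum s fun q _ => by positivity
    _ = _ := by ring

/-- The asymptotic formula. Its error has three sources: the major arc approximation, the minor
arcs, and the truncation of the singular series; each is O(k^{-1/8}). -/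
theorem norm_card_latticeSphere_sub_le {d : ℕ} (hd : 5 ≤ d) : ∃ K : ℝ, 0 ≤ K ∧ ∀ k : ℕ, 4 ≤ k →
    ‖(√k : ℂ) ^ 2 * ((√k : ℂ)⁻¹ ^ d * Real.exp (-(2 * Real.pi)) * (latticeSphere d √k).card) -
      singularIntegral d * ∑' q, singularTerm d k q‖ ≤ K * √k ^ (-(1 / 4) : ℝ) := by
  have hM := arcMass_nonneg
  have hC := arcConst_pos
  have hZ := denominatorSum_nonneg
  refine ⟨8 * arcConst ^ d * arcMass * denominatorSum + arcIntegralConst d * denominatorSum +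
    ‖singularIntegral d‖ * (2 * √2 ^ d * denominatorSum), ?_, fun k hk => ?_⟩
  · unfold arcIntegralConst; positivity
  have hk0 : 0 < k := by omega
  have hΛ : 2 ≤ √(k : ℝ) := Real.le_sqrt_of_sq_le (by norm_num; exact_mod_cast hk)
  have hΛ0 : 0 < √(k : ℝ) := by linarith
  have hsq : √(k : ℝ) ^ 2 = k := Real.sq_sqrt (by positivity)
  -- The range is only a finite container: 2(q+1) < √k already forces q < k.
  set s : Finset ℕ := (Finset.range k).filter fun q => 2 * ((q + 1 : ℕ) : ℝ) < √k with hs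
  have hs_mem : ∀ q, q ∈ s ↔ 2 * ((q + 1 : ℕ) : ℝ) < √k := fun q => by
    rw [hs, Finset.mem_filter, and_iff_right_iff_imp, Finset.mem_range]
    intro h
    have : ((q : ℕ) : ℝ) < k := by
      push_cast at h
      nlinarith
    exact_mod_cast this
  set F := s.sigma fun q => (Finset.univ : Finset (ZMod (q + 1))ˣ) with hF
  have hF_mem : ∀ p : MajorIndex, p ∈ F ↔ 2 * ((p.1 + 1 : ℕ) : ℝ) < √k := fun p => by
    rw [hF, Finset.mem_sigma, hs_mem]; simp
  set M : Set ℝ := ⋃ p ∈ F, majorArc (√k) p with hMdef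
  set x : ℝ := -(1 / √k) with hx
  have hcont := continuous_circleIntegrand d k hΛ0
  have hMm : MeasurableSet M := Finset.measurableSet_biUnion _ fun p _ => measurableSet_Icc
  have hMsub : M ⊆ Set.Icc x (x + 1) := by
    refine Set.iUnion₂_subset fun p hp => ?_
    exact majorArc_subset hΛ ((hF_mem p).1 hp)
  have htot := integral_circleOp hΛ0 (f := fun _ : Fin d → ℤ => (1 : ℂ)) (S := 1) (fun _ => by simp) 0
    (Real.sqrt_nonneg k) hsq x
  rw [hsq, mul_div_assoc, div_self (by positivity), mul_one, Finset.sum_const, nsmul_eq_mul,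
    mul_one] at htot
  have htot' : ∫ t in Set.Icc x (x + 1), circleIntegrand d k (√k) t =
      (√k : ℂ)⁻¹ ^ d * Real.exp (-(2 * Real.pi)) * (latticeSphere d √k).card := by
    rw [← htot, integral_Icc_eq_integral_Ioc, ← intervalIntegral.integral_of_le (by linarith)]
    rfl
  have hsplit := integral_inter_add_sdiff hMm (hcont.integrableOn_Icc (a := x) (b := x + 1) (μ := volume))
  rw [Set.inter_eq_right.2 hMsub, htot', hMdef, integral_biUnion_finset F
    (s := majorArc (√k)) (fun p _ => measurableSet_Icc) ?_ fun p _ => hcont.integrableOn_Icc] at hsplit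
  · rw [← hsplit]
    have h1 := norm_minorArcs_le hd k hΛ0 (s := Set.Icc x (x + 1) \ M) fun t ht =>
      exists_minor_arcIndex hΛ ht.1 fun p hp htp =>
        ht.2 (Set.mem_biUnion ((hF_mem p).2 hp) htp)
    have h2 := norm_sum_majorArcs_sub_le hd hk0 (s := s) fun q hq => by
      have := (hs_mem q).1 hq
      have : (0 : ℝ) ≤ (q + 1 : ℕ) := by positivity
      linarith
    have h3 := singularTerm_tail_le hd k hΛ0 (s := s) fun q hq => by
      rw [hs_mem] at hq
      exact not_lt.1 hq
    have e : ∀ A x y J S T : ℂ, A * (x + y) - J * T = (A * x - J * S) + A * y + J * (S - T) :=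
      fun A x y J S T => by ring
    rw [e _ _ _ _ (∑ q ∈ s, singularTerm d k (q + 1))]
    refine (norm_add₃_le).trans ?_
    have h4 : ‖(√k : ℂ) ^ 2‖ = √k ^ 2 := by
      rw [norm_pow, norm_real, Real.norm_of_nonneg (Real.sqrt_nonneg _)]
    rw [norm_mul ((√k : ℂ) ^ 2), h4, norm_mul (singularIntegral d)]
    have h5 := mul_le_mul_of_nonneg_left h3 (norm_nonneg (singularIntegral d))
    refine (add_le_add (add_le_add h2 h1) h5).trans (le_of_eq ?_)
    ring
  · intro p hp p' hp' hpp
    exact disjoint_majorArc hΛ0 hpp ((hF_mem p).1 hp) ((hF_mem p').1 hp')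

/-! ### Lower bound for the number of lattice points on a sphere -/

theorem latticeSphere_sqrt_nonempty {d : ℕ} (hd : 4 ≤ d) (k : ℕ) :
    (latticeSphere d √k).Nonempty := by
  obtain ⟨e, rfl⟩ : ∃ e, d = e + 4 := ⟨d - 4, by omega⟩
  obtain ⟨a, b, c, x, h⟩ := Nat.sum_four_squares k
  refine ⟨Fin.cons (a : ℤ) (Fin.cons (b : ℤ) (Fin.cons (c : ℤ) (Fin.cons (x : ℤ) 0))),
    (mem_latticeSphere_iff (Real.sqrt_nonneg _) (Real.sq_sqrt (by positivity)) _).2 ?_⟩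
  rw [← h]
  simp [Fin.sum_univ_succ]
  ring

/-- The cube [-s,s]^d is covered by the spheres with k ≤ ds². This forces the spheres to be large on
average. -/
theorem two_mul_add_one_pow_le_sum_card (d s : ℕ) :
    (2 * s + 1) ^ d ≤ ∑ k ∈ Finset.range (d * s ^ 2 + 1), (latticeSphere d √k).card := by
  set B : Finset (Fin d → ℤ) := Fintype.piFinset fun _ => Finset.Icc (-(s : ℤ)) s with hB
  have hcard : B.card = (2 * s + 1) ^ d := by
    rw [hB, Fintype.card_piFinset_const, Int.card_Icc]
    congr 1
    omega
  have hsum0 : ∀ m : Fin d → ℤ, 0 ≤ ∑ i, m i ^ 2 := fun m => Finset.sum_nonneg fun i _ => sq_nonneg _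
  rw [← hcard, Finset.card_eq_sum_card_fiberwise (f := fun m => (∑ i, m i ^ 2).toNat)
    (t := Finset.range (d * s ^ 2 + 1))]
  · refine Finset.sum_le_sum fun k _ => Finset.card_le_card fun m hm => ?_
    rw [Finset.mem_filter] at hm
    rw [mem_latticeSphere_iff (Real.sqrt_nonneg _) (Real.sq_sqrt (by positivity)), ← hm.2,
      Int.toNat_of_nonneg (hsum0 m)]
  · intro m hm
    have hm' := Fintype.mem_piFinset.1 (Finset.mem_coe.1 hm)
    have h1 : ∑ i, m i ^ 2 ≤ (d * s ^ 2 : ℕ) := by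
      calc ∑ i, m i ^ 2 ≤ ∑ _i : Fin d, (s : ℤ) ^ 2 := Finset.sum_le_sum fun i _ => by
            have := Finset.mem_Icc.1 (hm' i)
            exact sq_le_sq' this.1 this.2
        _ = _ := by simp
    simp only [Finset.coe_range, Set.mem_Iio]
    omega

theorem eventually_rpow_sqrt_le (K : ℝ) {ε : ℝ} (hε : 0 < ε) :
    ∃ k₀ : ℕ, ∀ k : ℕ, k₀ ≤ k → K * √k ^ (-(1 / 4) : ℝ) ≤ ε := by
  have h : Filter.Tendsto (fun k : ℕ => K * √(k : ℝ) ^ (-(1 / 4) : ℝ)) Filter.atTop (nhds (K * 0)) :=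
    ((tendsto_rpow_neg_atTop (y := 1 / 4) (by norm_num)).comp
      (Real.tendsto_sqrt_atTop.comp tendsto_natCast_atTop_atTop)).const_mul K
  rw [mul_zero] at h
  obtain ⟨k₀, hk⟩ := Filter.eventually_atTop.1 (h.eventually_lt_const hε)
  exact ⟨k₀, fun k hk' => (hk k hk').le⟩

theorem norm_sq_mul_inv_pow_mul {d : ℕ} (hd : 2 ≤ d) {Λ : ℝ} (hΛ : 0 < Λ) (N : ℕ) :
    ‖(Λ : ℂ) ^ 2 * ((Λ : ℂ)⁻¹ ^ d * Real.exp (-(2 * Real.pi)) * N)‖ =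
      Real.exp (-(2 * Real.pi)) * (N / Λ ^ (d - 2)) := by
  obtain ⟨e, rfl⟩ : ∃ e, d = e + 2 := ⟨d - 2, by omega⟩
  rw [norm_mul, norm_mul, norm_mul, norm_pow, norm_pow, norm_inv, norm_real, norm_real,
    Complex.norm_natCast, Real.norm_of_nonneg hΛ.le, Real.norm_of_nonneg (Real.exp_pos _).le,
    Nat.add_sub_cancel, inv_pow, pow_add]
  field_simp

/-- Instead of evaluating the integral, suppose that it vanishes. Then the asymptotic formula makes
the count on each sphere o(k^{(d-2)/2}), too few to fill a large cube. -/
theorem singularIntegral_ne_zero {d : ℕ} (hd : 5 ≤ d) : singularIntegral d ≠ 0 := by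
  intro hJ
  obtain ⟨K, hK, hmain⟩ := norm_card_latticeSphere_sub_le hd
  set E := Real.exp (-(2 * Real.pi)) with hE
  have hE0 : 0 < E := Real.exp_pos _
  -- Chosen so that at most 2ds² spheres with at most ε(√d s)^{d-2} points each contribute no more
  -- than s^d.
  set ε : ℝ := (2 * d * √d ^ (d - 2))⁻¹ with hε
  have hd0 : (0 : ℝ) < d := by exact_mod_cast (by omega : 0 < d)
  have hε0 : 0 < ε := by positivity
  obtain ⟨k₀, hk₀⟩ := eventually_rpow_sqrt_le K (mul_pos hE0 hε0)
  have hsmall : ∀ k : ℕ, max k₀ 4 ≤ k → ((latticeSphere d √k).card : ℝ) ≤ ε * √k ^ (d - 2) := by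
    intro k hk
    have hk4 : 4 ≤ k := (le_max_right _ _).trans hk
    have hΛ : 0 < √(k : ℝ) := Real.sqrt_pos.2 (by exact_mod_cast (by omega : 0 < k))
    have h := (hmain k hk4).trans (hk₀ k ((le_max_left _ _).trans hk))
    rw [hJ, zero_mul, sub_zero, norm_sq_mul_inv_pow_mul (by omega) hΛ] at h
    exact (div_le_iff₀ (by positivity)).1 (le_of_mul_le_mul_left h hE0)
  set A : ℝ := ∑ k ∈ Finset.range (max k₀ 4), ((latticeSphere d √k).card : ℝ) with hA
  have hA0 : 0 ≤ A := Finset.sum_nonneg fun _ _ => by positivity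
  -- The finitely many small k contribute A < s ≤ s^d in total, so (2s)^d < 2s^d, which is absurd.
  obtain ⟨s, hs⟩ := exists_nat_gt (A + 1)
  have hs1 : (1 : ℝ) ≤ s := by linarith
  have h1 : ((2 * s + 1 : ℕ) : ℝ) ^ d ≤
      ∑ k ∈ Finset.range (d * s ^ 2 + 1), ((latticeSphere d √k).card : ℝ) := by
    exact_mod_cast two_mul_add_one_pow_le_sum_card d s
  have h2 : ∀ k ∈ Finset.range (d * s ^ 2 + 1), ((latticeSphere d √k).card : ℝ) ≤
      (if k < max k₀ 4 then ((latticeSphere d √k).card : ℝ) else 0) +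
        ε * (√d * s) ^ (d - 2) := by
    intro k hk
    have hpos : 0 ≤ ε * (√d * s) ^ (d - 2) := by positivity
    split_ifs with hlt
    · linarith
    · refine (hsmall k (not_lt.1 hlt)).trans ?_
      rw [zero_add]
      have hk' : (k : ℝ) ≤ d * s ^ 2 := by
        exact_mod_cast Nat.lt_succ_iff.1 (Finset.mem_range.1 hk)
      have : √(k : ℝ) ≤ √d * s := by
        rw [← Real.sqrt_sq (zero_le_one.trans hs1), ← Real.sqrt_mul hd0.le]
        exact Real.sqrt_le_sqrt hk'
      gcongr
  have h3 : ∑ k ∈ Finset.range (d * s ^ 2 + 1),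
      (if k < max k₀ 4 then ((latticeSphere d √k).card : ℝ) else 0) ≤ A := by
    rw [← Finset.sum_filter, hA]
    refine Finset.sum_le_sum_of_subset_of_nonneg (fun k hk => ?_) fun _ _ _ => by positivity
    exact Finset.mem_range.2 (Finset.mem_filter.1 hk).2
  have h4 := h1.trans (Finset.sum_le_sum h2)
  rw [Finset.sum_add_distrib, Finset.sum_const, Finset.card_range, nsmul_eq_mul] at h4
  have h5 : ((d * s ^ 2 + 1 : ℕ) : ℝ) * (ε * (√d * s) ^ (d - 2)) ≤ s ^ d := by
    have h6 : ((d * s ^ 2 + 1 : ℕ) : ℝ) ≤ 2 * d * s ^ 2 := by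
      push_cast
      have : (1 : ℝ) ≤ d * s ^ 2 := by
        have hd1 : (1 : ℝ) ≤ d := by exact_mod_cast (by omega : 1 ≤ d)
        nlinarith
      linarith
    calc _ ≤ (2 * d * s ^ 2) * (ε * (√d * s) ^ (d - 2)) := by gcongr
      _ = (2 * d * √d ^ (d - 2)) * ε * (s ^ 2 * s ^ (d - 2)) := by rw [mul_pow]; ring
      _ = s ^ d := by
        rw [hε, mul_inv_cancel₀ (by positivity), one_mul, ← pow_add]
        congr 1
        omega
  have h7 : (2 * s : ℝ) ^ d ≤ ((2 * s + 1 : ℕ) : ℝ) ^ d := by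
    gcongr
    push_cast
    linarith
  have h8 : (s : ℝ) ≤ s ^ d := le_self_pow₀ hs1 (by omega)
  have h9 : (2 : ℝ) ≤ 2 ^ d := le_self_pow₀ (by norm_num) (by omega)
  rw [mul_pow] at h7
  nlinarith

/-- Large k are covered by the asymptotic formula, with half of the main term left after the error.
The finitely many others only need one point on the sphere, given by the four-square theorem. -/
theorem card_latticeSphere_ge {d : ℕ} (hd : 5 ≤ d) : ∃ c : ℝ, 0 < c ∧ ∀ k : ℕ, 1 ≤ k →
    c * √k ^ (d - 2) ≤ (latticeSphere d √k).card := by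
  obtain ⟨K, hK, hmain⟩ := norm_card_latticeSphere_sub_le hd
  obtain ⟨c, hc, hS⟩ := singularSeries_lower_bound hd
  have hJ : 0 < ‖singularIntegral d‖ := norm_pos_iff.2 (singularIntegral_ne_zero hd)
  set b := ‖singularIntegral d‖ * c / 2 with hb
  have hb0 : 0 < b := by positivity
  obtain ⟨k₀, hk₀⟩ := eventually_rpow_sqrt_le K hb0
  set k₁ := max k₀ 4 with hk₁
  have hk1pos : (0 : ℝ) < √(k₁ : ℝ) := Real.sqrt_pos.2 (by
    exact_mod_cast (by omega : 0 < k₁))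
  refine ⟨min b (√k₁ ^ (d - 2))⁻¹, lt_min hb0 (by positivity), fun k hk => ?_⟩
  have hΛ : 0 < √(k : ℝ) := Real.sqrt_pos.2 (by exact_mod_cast hk)
  rcases le_or_gt k₁ k with h | h
  · have h1 := (hmain k ((le_max_right _ _).trans h)).trans (hk₀ k ((le_max_left _ _).trans h))
    have h2 : 2 * b ≤ ‖singularIntegral d * ∑' q, singularTerm d k q‖ := by
      rw [norm_mul, hb]
      have := mul_le_mul_of_nonneg_left (hS k) hJ.le
      linarith
    have h3 := norm_sub_norm_le (singularIntegral d * ∑' q, singularTerm d k q)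
      ((√k : ℂ) ^ 2 * ((√k : ℂ)⁻¹ ^ d * Real.exp (-(2 * Real.pi)) * (latticeSphere d √k).card))
    rw [norm_sub_rev _ ((√k : ℂ) ^ 2 * _), norm_sq_mul_inv_pow_mul (by omega) hΛ] at h3
    have h4 : Real.exp (-(2 * Real.pi)) ≤ 1 := Real.exp_le_one_iff.2 (by
      have := Real.pi_pos; linarith)
    have h5 : b ≤ (latticeSphere d √k).card / √k ^ (d - 2) := by
      have : 0 ≤ ((latticeSphere d √k).card : ℝ) / √k ^ (d - 2) := by positivity
      nlinarith
    rw [le_div_iff₀ (by positivity)] at h5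
    refine le_trans ?_ h5
    gcongr
    exact min_le_left _ _
  · have h1 : (1 : ℝ) ≤ (latticeSphere d √k).card := by
      exact_mod_cast (latticeSphere_sqrt_nonempty (by omega) k).card_pos
    refine le_trans ?_ h1
    calc _ ≤ (√k₁ ^ (d - 2))⁻¹ * √k₁ ^ (d - 2) := by
          gcongr
          exact min_le_right _ _
      _ = 1 := inv_mul_cancel₀ (by positivity)

/-! ### From spherical averages to arcs, and summation over the arcs -/

section MaximalInequality

variable {d : ℕ}

open Classical in
/-- The dyadic maximal function over the scales `2 ^ j ≥ R` attached to the point `u` of an arc. -/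
def arcMaximal (R : ℝ) (i : ArcIndex) (u : ℝ) (f : (Fin d → ℤ) → ℂ) (n : Fin d → ℤ) : ℝ≥0∞ :=
  ⨆ j : ℕ, if ((i.den : ℝ) ≤ 2 ^ j ∧ i.den * |u| ≤ 2 ^ j) ∧ R ≤ 2 ^ j then
    ‖arcOp (2 ^ j) i.den i.num u f n‖ₑ else 0

theorem measurable_arcMaximal (R : ℝ) (i : ArcIndex) {f : (Fin d → ℤ) → ℂ} {S : ℝ}
    (hf : ∀ n, ‖f n‖ ≤ S) (n : Fin d → ℤ) : Measurable fun u => arcMaximal R i u f n := by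
  unfold arcMaximal
  refine Measurable.iSup fun j => Measurable.ite ?_ ?_ measurable_const
  · simp only [Set.ofPred_and]
    exact ((MeasurableSet.const _).inter (measurableSet_le (by fun_prop) measurable_const)).inter
      (MeasurableSet.const _)
  · have hc := continuous_circleOp (show (0 : ℝ) < 2 ^ j by positivity) hf n
    have he : (fun u => ‖arcOp (2 ^ j) i.den i.num u f n‖ₑ) =
        fun u : ℝ => ‖circleOp (2 ^ j) (i.num / i.den + u / (2 ^ j) ^ 2) f n‖ₑ := by
      ext u
      rw [arcOp_eq_circleOp (by positivity)]
    rw [he]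
    exact (hc.comp (show Continuous fun u : ℝ => (i.num : ℝ) / i.den + u / (2 ^ j) ^ 2 by
      fun_prop)).enorm.measurable

theorem enorm_arcOp_le_arcMaximal {R : ℝ} {i : ArcIndex} {u : ℝ} {j : ℕ} (h1 : (i.den : ℝ) ≤ 2 ^ j)
    (h2 : i.den * |u| ≤ 2 ^ j) (h3 : R ≤ 2 ^ j) (f : (Fin d → ℤ) → ℂ) (n : Fin d → ℤ) :
    ‖arcOp (2 ^ j) i.den i.num u f n‖ₑ ≤ arcMaximal R i u f n := by
  refine le_iSup_of_le j ?_
  rw [if_pos ⟨⟨h1, h2⟩, h3⟩]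

/-- The right side does not involve r: e(-kt) disappears in absolute value, and Λ^d/N_r = O(Λ²)
cancels the Jacobian of t = a/q + u/Λ². After that, the scale 2^j is absorbed in the supremum
defining `arcMaximal`. -/
theorem enorm_sphericalAverage_le {c : ℝ} (hc : 0 < c)
    (hcard : ∀ k : ℕ, 1 ≤ k → c * √k ^ (d - 2) ≤ (latticeSphere d √k).card) (hd : 2 ≤ d)
    {f : (Fin d → ℤ) → ℂ} {S : ℝ} (hf : ∀ n, ‖f n‖ ≤ S) (n : Fin d → ℤ) {R r : ℝ} (hR : 0 < R)
    (hr : R ≤ r) {k : ℕ} (hk : r ^ 2 = k) :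
    ‖sphericalAverage r f n‖ₑ ≤ ENNReal.ofReal (c⁻¹ * Real.exp (8 * Real.pi)) *
      ∑' i : ArcIndex, ∫⁻ u, arcMaximal (R / 2) i u f n := by
  have hr0 : 0 < r := hR.trans_le hr
  have hk1 : 1 ≤ k := by
    have : (0 : ℝ) < k := by rw [← hk]; positivity
    exact_mod_cast this
  have hrk : √(k : ℝ) = r := by rw [← hk, Real.sqrt_sq hr0.le]
  have hr1 : 1 ≤ r := by
    rw [← hrk]
    exact Real.one_le_sqrt.2 (by exact_mod_cast hk1)
  -- With 2^j ≤ r < 2^{j+1} the scale satisfies 2^j > R/2, hence the halved threshold.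
  obtain ⟨j, hj1, hj2⟩ := exists_nat_pow_near hr1 (one_lt_two)
  set Λ : ℝ := 2 ^ j with hΛdef
  have hΛ1 : 1 ≤ Λ := one_le_pow₀ (by norm_num)
  have hΛ : 0 < Λ := by linarith
  have hN := hcard k hk1
  rw [hrk] at hN
  set N : ℝ := ((latticeSphere d r).card : ℝ) with hNdef
  have hN' : c * Λ ^ (d - 2) ≤ N := le_trans (by gcongr) hN
  have hN0 : 0 < N := lt_of_lt_of_le (by positivity) hN'
  have h_integral := integral_circleOp hΛ hf n hr0.le hk 0
  -- Because r < 2Λ, undoing the Gaussian weight on the sphere costs at most exp(8π).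
  have hkΛ : 2 * Real.pi * k / Λ ^ 2 ≤ 8 * Real.pi := by
    rw [div_le_iff₀ (by positivity), ← hk]
    rw [pow_succ, ← hΛdef] at hj2
    have : r ^ 2 ≤ (Λ * 2) ^ 2 := by gcongr
    nlinarith [Real.pi_pos]
  have hA : sphericalAverage r f n = ((N⁻¹ * Λ ^ d * Real.exp (2 * Real.pi * k / Λ ^ 2) : ℝ) : ℂ) *
      ∫ t in (0 : ℝ)..0 + 1, cexp (-(2 * Real.pi * I * k * t)) * circleOp Λ t f n := by
    have hE : (Real.exp (2 * Real.pi * k / Λ ^ 2) : ℂ) * Real.exp (-(2 * Real.pi * k / Λ ^ 2)) = 1 := by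
      rw [← ofReal_mul, ← Real.exp_add, add_neg_cancel, Real.exp_zero, ofReal_one]
    have hΛd : (Λ : ℂ) ^ d * (Λ : ℂ)⁻¹ ^ d = 1 := by
      rw [← mul_pow, mul_inv_cancel₀ (by exact_mod_cast hΛ.ne'), one_pow]
    rw [h_integral, sphericalAverage, hNdef, ofReal_mul, ofReal_mul, ofReal_inv, ofReal_natCast, ofReal_pow]
    linear_combination (-(((latticeSphere d r).card : ℂ)⁻¹ * ∑ m ∈ latticeSphere d r, f (n - m))) *
      ((Λ : ℂ) ^ d * (Λ : ℂ)⁻¹ ^ d * hE + hΛd)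
  have hcoef : N⁻¹ * Λ ^ d * Real.exp (2 * Real.pi * k / Λ ^ 2) ≤
      c⁻¹ * Real.exp (8 * Real.pi) * Λ ^ 2 := by
    have h1 : N⁻¹ ≤ (c * Λ ^ (d - 2))⁻¹ := inv_anti₀ (by positivity) hN'
    have h2 : Λ ^ d = Λ ^ (d - 2) * Λ ^ 2 := by rw [← pow_add]; congr 1; omega
    calc _ ≤ (c * Λ ^ (d - 2))⁻¹ * Λ ^ d * Real.exp (8 * Real.pi) := by gcongr
      _ = _ := by rw [h2]; field_simp
  have hcover : ∫⁻ t in Set.Ioc (0 : ℝ) (0 + 1), ‖circleOp Λ t f n‖ₑ ≤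
      ENNReal.ofReal ((Λ ^ 2)⁻¹) * ∑' i : ArcIndex, ∫⁻ u, arcMaximal (R / 2) i u f n := by
    refine (lintegral_le_tsum_arcs hΛ (T := {i | (i.den : ℝ) ≤ Λ}) (fun t ht => ?_) _).trans ?_
    · obtain ⟨i, h1, h2, -⟩ := exists_arcIndex (t := t) hΛ1 (by linarith [ht.1]) (by linarith [ht.2])
      exact ⟨i, h1, h2.le⟩
    · rw [ENNReal.tsum_mul_left]
      refine mul_le_mul_right (le_trans (ENNReal.tsum_le_tsum fun i => ?_)
        (ENNReal.tsum_comp_le_tsum_of_injective (Subtype.val_injective (p := (· ∈ {i : ArcIndex | (i.den : ℝ) ≤ Λ}))) _)) _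
      have hmeas : MeasurableSet {u : ℝ | (i : ArcIndex).den * |u| ≤ Λ} :=
        measurableSet_le (by fun_prop) measurable_const
      refine (setLIntegral_mono' hmeas fun u hu => ?_).trans (setLIntegral_le_lintegral _ _)
      rw [← arcOp_eq_circleOp hΛ]
      refine enorm_arcOp_le_arcMaximal i.2 hu ?_ f n
      rw [pow_succ] at hj2
      linarith
  rw [hA, enorm_mul]
  have hI : ‖∫ t in (0 : ℝ)..0 + 1, cexp (-(2 * Real.pi * I * k * t)) * circleOp Λ t f n‖ₑ ≤
      ∫⁻ t in Set.Ioc (0 : ℝ) (0 + 1), ‖circleOp Λ t f n‖ₑ := by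
    rw [intervalIntegral.integral_of_le (by norm_num)]
    refine (enorm_integral_le_lintegral_enorm _).trans (lintegral_mono fun t => le_of_eq ?_)
    have h := norm_cexp_neg_two_pi (k * t)
    push_cast at h
    rw [← mul_assoc] at h
    rw [enorm_mul, ← ofReal_norm (cexp _), h, ENNReal.ofReal_one, one_mul]
  have hco : ‖((N⁻¹ * Λ ^ d * Real.exp (2 * Real.pi * k / Λ ^ 2) : ℝ) : ℂ)‖ₑ ≤
      ENNReal.ofReal (c⁻¹ * Real.exp (8 * Real.pi)) * ENNReal.ofReal (Λ ^ 2) := by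
    rw [← ofReal_norm, norm_real, Real.norm_of_nonneg (by positivity),
      ← ENNReal.ofReal_mul (by positivity)]
    exact ENNReal.ofReal_le_ofReal hcoef
  refine (mul_le_mul' hco (hI.trans hcover)).trans (le_of_eq ?_)
  rw [mul_assoc, ← mul_assoc (ENNReal.ofReal (Λ ^ 2)), ← ENNReal.ofReal_mul (by positivity),
    mul_inv_cancel₀ (by positivity), ENNReal.ofReal_one, one_mul]

theorem latticeL2Norm_sphericalMaximal_le {c : ℝ} (hc : 0 < c)
    (hcard : ∀ k : ℕ, 1 ≤ k → c * √k ^ (d - 2) ≤ (latticeSphere d √k).card) (hd : 2 ≤ d)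
    (f : LatticeL2 d) {R : ℝ} (hR : 0 < R) :
    latticeL2Norm (sphericalMaximal R f) ≤ ENNReal.ofReal (c⁻¹ * Real.exp (8 * Real.pi)) *
      ∑' i : ArcIndex, ∫⁻ u, latticeL2Norm (arcMaximal (R / 2) i u f) := by
  have hf : ∀ n, ‖f n‖ ≤ ‖f‖ := fun n => lp.norm_apply_le_norm (by norm_num) f n
  have h1 : ∀ n, sphericalMaximal R f n ≤ ENNReal.ofReal (c⁻¹ * Real.exp (8 * Real.pi)) *
      ∑' i : ArcIndex, ∫⁻ u, arcMaximal (R / 2) i u f n := fun n => by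
    refine iSup_le fun r => iSup_le fun hr => iSup_le fun ⟨k, hk⟩ => ?_
    exact enorm_sphericalAverage_le hc hcard hd hf n hR hr hk
  refine (latticeL2Norm_mono h1).trans ?_
  rw [latticeL2Norm_const_mul]
  refine mul_le_mul_right ((latticeL2Norm_tsum_le _).trans (ENNReal.tsum_le_tsum fun i => ?_)) _
  exact latticeL2Norm_lintegral_le volume fun n => measurable_arcMaximal _ i hf n

theorem lcmUpTo_pos (η : ℝ) : 0 < lcmUpTo η := by
  rw [lcmUpTo, Nat.pos_iff_ne_zero, Ne, Finset.lcm_eq_zero_iff]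
  rintro ⟨x, hx, h0⟩
  have := (Finset.mem_Icc.1 (Finset.mem_coe.1 hx)).1
  simp at h0
  omega

theorem dvd_lcmUpTo {η : ℝ} {q : ℕ} (hq : 0 < q) (h : (q : ℝ) ≤ η ^ (-2 : ℤ)) : q ∣ lcmUpTo η :=
  Finset.dvd_lcm (f := id) (Finset.mem_Icc.2 ⟨hq, Nat.le_floor h⟩)

/-- As q divides q_η, the grid q⁻¹ℤ lies in q_η⁻¹ℤ. If every coordinate were within 1/L of the
coarse grid, α would lie in the excluded set. -/
theorem exists_lt_of_notMem_majorArcs {η L : ℝ} {q : ℕ} (hq : 0 < q) (hqη : (q : ℝ) ≤ η ^ (-2 : ℤ))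
    {α : UnitAddTorus (Fin d)} (hα : α ∉ majorArcs d η L) :
    ∃ i, 1 / L < |q * circleRep (α i) - round (q * circleRep (α i))| / q := by
  by_contra! h
  obtain ⟨e, he⟩ := dvd_lcmUpTo hq hqη
  have hlcm := lcmUpTo_pos η
  have he0 : (e : ℝ) ≠ 0 := by
    rintro h0
    have : e = 0 := by exact_mod_cast h0
    rw [he, this] at hlcm
    simp at hlcm
  have hq0 : (0 : ℝ) < q := by exact_mod_cast hq
  refine hα ⟨fun i => circleRep (α i), fun i => round (q * circleRep (α i)) * e,
    fun i => coe_circleRep _, fun i => ?_⟩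
  have e1 : circleRep (α i) - ((round (q * circleRep (α i)) * e : ℤ) : ℝ) / (lcmUpTo η : ℝ) =
      (q * circleRep (α i) - round (q * circleRep (α i))) / q := by
    rw [he]
    push_cast
    field_simp
  have h2 := h i
  rw [one_div, ← abs_of_pos hq0, ← abs_div, abs_of_pos hq0] at h2
  rw [e1]
  exact abs_le.1 h2

theorem arcMaximal_le_iSup (R : ℝ) (i : ArcIndex) (u : ℝ) (f : (Fin d → ℤ) → ℂ) (n : Fin d → ℤ) :
    arcMaximal R i u f n ≤
      ⨆ j : {j : ℕ // ((i.den : ℝ) ≤ 2 ^ j ∧ i.den * |u| ≤ 2 ^ j) ∧ R ≤ 2 ^ j},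
        ‖arcOp (2 ^ (j : ℕ)) i.den i.num u f n‖ₑ := by
  refine iSup_le fun j => ?_
  split_ifs with h
  · exact le_iSup (fun j : {j : ℕ // ((i.den : ℝ) ≤ 2 ^ j ∧ i.den * |u| ≤ 2 ^ j) ∧ R ≤ 2 ^ j} =>
      ‖arcOp (2 ^ (j : ℕ)) i.den i.num u f n‖ₑ) ⟨j, h⟩
  · exact zero_le

/-- Large denominators, q > η⁻², use the general bound; their smallness will come from the tail of
the sum over q. Small denominators use the spectral hypothesis and gain a factor O(η) on each arc.
-/
theorem lintegral_latticeL2Norm_arcMaximal_le (hd : 5 ≤ d) : ∃ C : ℝ, 0 ≤ C ∧ ∀ η : ℝ, 0 < η →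
    ∀ L : ℝ, (lcmUpTo η : ℝ) ^ 4 ≤ L → ∀ f : LatticeL2 d,
    (∀ᵐ α ∂(torusHaar d), α ∈ majorArcs d η L → latticeFourier f α = 0) → ∀ i : ArcIndex,
    ∫⁻ u, latticeL2Norm (arcMaximal (η ^ (-2 : ℤ) * L / 2) i u f) ≤
      ENNReal.ofReal (C * ((i.den : ℝ) ^ (-(5 / 2) : ℝ) *
        (2 * η + if η ^ (-2 : ℤ) < (i.den : ℝ) then 1 else 0))) * ENNReal.ofReal ‖f‖ := by
  obtain ⟨C₁, hC₁, h₁⟩ := arcOp_maximal_le d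
  obtain ⟨C₂, hC₂, h₂⟩ := arcOp_maximal_le_of_spectrum d
  have hM := arcMass_nonneg
  refine ⟨2 * (C₁ + C₂) * arcMass, by positivity, fun η hη L hL f hf i => ?_⟩
  have hlcm := lcmUpTo_pos η
  have hlcm1 : (1 : ℝ) ≤ lcmUpTo η := by exact_mod_cast hlcm
  have hL1 : (lcmUpTo η : ℝ) ≤ L := (le_self_pow₀ hlcm1 (by norm_num)).trans hL
  have hL0 : 0 < L := by linarith
  have hR : 0 < η ^ (-2 : ℤ) * L / 2 := by positivity
  set w : ℝ := 2 * η + if η ^ (-2 : ℤ) < (i.den : ℝ) then 1 else 0 with hw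
  have hw0 : 0 ≤ w := by rw [hw]; split_ifs <;> linarith
  have key : ∀ u, latticeL2Norm (arcMaximal (η ^ (-2 : ℤ) * L / 2) i u f) ≤
      ENNReal.ofReal (2 * (C₁ + C₂) * (i.den : ℝ) ^ (-(5 / 2) : ℝ) * w *
        (1 + u ^ 2) ^ (-(3 / 4) : ℝ)) * ENNReal.ofReal ‖f‖ := by
    intro u
    have hdec := arcDecay_pow_mul_le hd i.den u
    have hdec0 : 0 ≤ arcDecay i.den u ^ d * (1 + |u|) :=
      mul_nonneg (pow_nonneg (arcDecay_pos _ _).le _) (by positivity)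
    by_cases hq : η ^ (-2 : ℤ) < (i.den : ℝ)
    · have hw1 : 1 ≤ w := by rw [hw, if_pos hq]; linarith
      refine (latticeL2Norm_mono fun n => ?_).trans ((h₁ i.den i.num i.isUnit_num u f).trans ?_)
      · refine (arcMaximal_le_iSup _ _ _ _ _).trans (iSup_le fun j => ?_)
        exact le_iSup (fun j : {j : ℕ // (i.den : ℝ) ≤ 2 ^ j ∧ i.den * |u| ≤ 2 ^ j} =>
          ‖arcOp (2 ^ (j : ℕ)) i.den i.num u f n‖ₑ) ⟨j, j.2.1⟩
      · gcongr ?_ * _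
        refine ENNReal.ofReal_le_ofReal ?_
        calc _ ≤ (C₁ + C₂) * (2 * (i.den : ℝ) ^ (-(5 / 2) : ℝ) * (1 + u ^ 2) ^ (-(3 / 4) : ℝ)) * 1 := by
              rw [mul_one]
              exact mul_le_mul (by linarith) hdec hdec0 (by positivity)
          _ ≤ (C₁ + C₂) * (2 * (i.den : ℝ) ^ (-(5 / 2) : ℝ) * (1 + u ^ 2) ^ (-(3 / 4) : ℝ)) * w := by
              gcongr
          _ = _ := by ring
    · have hqη := not_lt.1 hq
      have hden : 0 < i.den := Nat.succ_pos _
      -- A denominator 1 ≤ q ≤ η⁻² forces η ≤ 1, so the gain 2η² is at most 2η.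
      have hη1 : η ≤ 1 := by
        by_contra! h1
        have h2 : (1 : ℝ) ≤ i.den := by exact_mod_cast hden
        have h3 : η ^ (-2 : ℤ) < 1 := by
          rw [zpow_neg]
          exact inv_lt_one_of_one_lt₀ (one_lt_zpow₀ h1 (by norm_num))
        linarith
      -- q ≤ q_η by divisibility, and q_η ≤ q_η⁴ ≤ L.
      have hqL : (i.den : ℝ) ≤ L := by
        refine le_trans ?_ hL1
        exact_mod_cast Nat.le_of_dvd hlcm (dvd_lcmUpTo hden hqη)
      refine (latticeL2Norm_mono fun n => arcMaximal_le_iSup _ _ _ _ _).trans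
        ((h₂ i.den i.num i.isUnit_num u L _ hqL hR f ?_).trans ?_)
      · filter_upwards [hf] with α hα h0
        exact exists_lt_of_notMem_majorArcs hden hqη fun h => h0 (hα h)
      · gcongr ?_ * _
        refine ENNReal.ofReal_le_ofReal ?_
        have hratio : L / (η ^ (-2 : ℤ) * L / 2) = 2 * η ^ 2 := by
          rw [zpow_neg]
          field_simp
        have hw1 : 2 * η ^ 2 ≤ w := by
          rw [hw, if_neg hq]
          nlinarith
        rw [hratio]
        calc _ ≤ (C₁ + C₂) * (2 * (i.den : ℝ) ^ (-(5 / 2) : ℝ) * (1 + u ^ 2) ^ (-(3 / 4) : ℝ)) * w := by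
              refine mul_le_mul (mul_le_mul (by linarith) hdec hdec0 (by positivity)) hw1
                (by positivity) (by positivity)
          _ = _ := by ring
  refine (lintegral_mono key).trans ?_
  rw [lintegral_mul_const' _ _ ENNReal.ofReal_ne_top, ← Measure.restrict_univ (μ := volume)]
  gcongr ?_ * _
  refine (lintegral_arcWeight_le (by positivity) _).trans (le_of_eq ?_)
  congr 1
  ring

/-- A discrete derivative of x^{-1/2}: with s = √x and t = √(x+1), s⁻¹ - t⁻¹ = 1/(st(s+t)), and t ≤
3s/2 for x ≥ 1. -/
theorem rpow_neg_three_half_le_sub {x : ℝ} (hx : 1 ≤ x) :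
    x ^ (-(3 / 2) : ℝ) ≤ 4 * ((√x)⁻¹ - (√(x + 1))⁻¹) := by
  have hx0 : 0 < x := by linarith
  have hs : 0 < √x := Real.sqrt_pos.2 hx0
  have h1 : x ^ (-(3 / 2) : ℝ) = (x * √x)⁻¹ := by
    rw [Real.sqrt_eq_rpow, ← Real.rpow_one_add' hx0.le (by norm_num), ← Real.rpow_neg hx0.le]
    norm_num
  set s := √x with hsdef
  set t := √(x + 1) with htdef
  have ht : 0 < t := Real.sqrt_pos.2 (by linarith)
  have hs2 : s ^ 2 = x := Real.sq_sqrt hx0.le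
  have ht2 : t ^ 2 = x + 1 := Real.sq_sqrt (by linarith)
  have hts : t ≤ 3 / 2 * s := by
    rw [← abs_of_pos ht, ← abs_of_pos (show 0 < 3 / 2 * s by positivity)]
    refine sq_le_sq.1 ?_
    nlinarith
  have h2 : s⁻¹ - t⁻¹ = 1 / (s * t * (s + t)) := by
    rw [inv_sub_inv hs.ne' ht.ne', div_eq_div_iff (by positivity) (by positivity)]
    linear_combination (s * t) * (ht2 - hs2)
  rw [h1, h2, mul_one_div, le_div_iff₀ (by positivity), inv_mul_le_iff₀ (by positivity), ← hs2]
  have h3 : t * (s + t) ≤ 4 * s ^ 2 := by nlinarith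
  nlinarith

theorem tsum_rpow_tail_le {Y : ℝ} (hY : 0 < Y) :
    (Summable fun q : ℕ => if Y < (q + 1 : ℕ) then ((q + 1 : ℕ) : ℝ) ^ (-(3 / 2) : ℝ) else 0) ∧
    ∑' q : ℕ, (if Y < (q + 1 : ℕ) then ((q + 1 : ℕ) : ℝ) ^ (-(3 / 2) : ℝ) else 0) ≤ 4 * (√Y)⁻¹ := by
  -- Capping at Y^{-1/2} lets the telescoping start at q = 0 with a total decrease of at most
  -- Y^{-1/2}.
  set φ : ℕ → ℝ := fun q => min (√((q + 1 : ℕ) : ℝ))⁻¹ (√Y)⁻¹ with hφ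
  have hφ0 : ∀ q, 0 ≤ φ q := fun q => le_min (by positivity) (by positivity)
  have hmono : ∀ q, φ (q + 1) ≤ φ q := fun q => by
    refine min_le_min_right _ (inv_anti₀ (Real.sqrt_pos.2 (by positivity)) (Real.sqrt_le_sqrt ?_))
    push_cast
    linarith
  have hterm0 : ∀ q : ℕ, 0 ≤ if Y < (q + 1 : ℕ) then ((q + 1 : ℕ) : ℝ) ^ (-(3 / 2) : ℝ) else 0 :=
    fun q => by split_ifs <;> positivity
  have hterm : ∀ q : ℕ, (if Y < (q + 1 : ℕ) then ((q + 1 : ℕ) : ℝ) ^ (-(3 / 2) : ℝ) else 0) ≤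
      4 * (φ q - φ (q + 1)) := fun q => by
    split_ifs with h
    · have e1 : φ q = (√((q + 1 : ℕ) : ℝ))⁻¹ :=
        min_eq_left (inv_anti₀ (Real.sqrt_pos.2 hY) (Real.sqrt_le_sqrt h.le))
      have e2 : φ (q + 1) = (√(((q + 1 : ℕ) : ℝ) + 1))⁻¹ := by
        rw [hφ]
        simp only
        rw [min_eq_left (inv_anti₀ (Real.sqrt_pos.2 hY) (Real.sqrt_le_sqrt ?_))]
        · push_cast; rfl
        · push_cast at h ⊢
          linarith
      rw [e1, e2]
      exact rpow_neg_three_half_le_sub (by exact_mod_cast Nat.succ_pos q)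
    · linarith [hmono q]
  have hsum : ∀ n, ∑ q ∈ Finset.range n,
      (if Y < (q + 1 : ℕ) then ((q + 1 : ℕ) : ℝ) ^ (-(3 / 2) : ℝ) else 0) ≤ 4 * (√Y)⁻¹ := fun n => by
    refine (Finset.sum_le_sum fun q _ => hterm q).trans ?_
    rw [← Finset.mul_sum, Finset.sum_range_sub']
    have : φ 0 ≤ (√Y)⁻¹ := min_le_right _ _
    linarith [hφ0 n]
  exact ⟨summable_of_sum_range_le hterm0 hsum, Real.tsum_le_of_sum_range_le hterm0 hsum⟩

end MaximalInequality

/-- The condition that the Fourier transform is supported off `majorArcs d η L` is expressed as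
almost everywhere vanishing on that set. -/
theorem theorem2 (d : ℕ) (hd : 5 ≤ d) :
    ∃ C : ℝ, 0 < C ∧ ∀ η : ℝ, 0 < η → ∀ L : ℝ, (lcmUpTo η : ℝ) ^ 4 ≤ L →
      ∀ f : LatticeL2 d,
        (∀ᵐ α ∂(torusHaar d), α ∈ majorArcs d η L → latticeFourier f α = 0) →
        latticeL2Norm (sphericalMaximal (η ^ (-2 : ℤ) * L) f) ≤ ENNReal.ofReal (C * η * ‖f‖) := by
  obtain ⟨c, hc, hcard⟩ := card_latticeSphere_ge hd
  obtain ⟨K, hK, hmain⟩ := lintegral_latticeL2Norm_arcMaximal_le hd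
  set Z : ℝ := ∑' q : ℕ, ((q + 1 : ℕ) : ℝ) ^ (-(3 / 2) : ℝ) with hZ
  have hZ0 : 0 ≤ Z := tsum_nonneg fun q => by positivity
  have hZs : Summable fun q : ℕ => ((q + 1 : ℕ) : ℝ) ^ (-(3 / 2) : ℝ) :=
    summable_succ_rpow (by norm_num)
  set E : ℝ := c⁻¹ * Real.exp (8 * Real.pi) with hE
  have hE0 : 0 < E := by positivity
  -- E converts averages into arcs, and 4K counts integer shifts and the cost per arc. 2Z comes from
  -- the gain 2η summed over all q, the last 4 from the tail q > η⁻². The summand 1 only secures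
  -- positivity, since K may vanish.
  refine ⟨E * (4 * K * (2 * Z + 4)) + 1, by positivity, fun η hη L hL f hf => ?_⟩
  have hlcm1 : (1 : ℝ) ≤ lcmUpTo η := by exact_mod_cast lcmUpTo_pos η
  have hL0 : 0 < L := lt_of_lt_of_le (by positivity) hL
  have hY : 0 < η ^ (-2 : ℤ) := by positivity
  -- The cut-off η⁻² is balanced so that the tail of ∑ q^{-3/2} beyond it is a multiple of η.
  have hsqrt : (√(η ^ (-2 : ℤ)))⁻¹ = η := by
    rw [zpow_neg, Real.sqrt_inv, inv_inv, zpow_ofNat, Real.sqrt_sq hη.le]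
  obtain ⟨hts, htail⟩ := tsum_rpow_tail_le hY
  rw [hsqrt] at htail
  have hsum : ∑' i : ArcIndex, ∫⁻ u, latticeL2Norm (arcMaximal (η ^ (-2 : ℤ) * L / 2) i u f) ≤
      ENNReal.ofReal (4 * K * (2 * Z + 4) * η) * ENNReal.ofReal ‖f‖ := by
    refine (ENNReal.tsum_le_tsum fun i => hmain η hη L hL f hf i).trans ?_
    rw [ENNReal.tsum_mul_right]
    gcongr ?_ * _
    refine (tsum_arcIndex_le fun q => ENNReal.ofReal (K * ((q : ℝ) ^ (-(5 / 2) : ℝ) *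
        (2 * η + if η ^ (-2 : ℤ) < (q : ℝ) then 1 else 0)))).trans ?_
    have hterm : ∀ q : ℕ, 4 * ((q + 1 : ℕ) : ℝ≥0∞) * ENNReal.ofReal (K *
        (((q + 1 : ℕ) : ℝ) ^ (-(5 / 2) : ℝ) *
          (2 * η + if η ^ (-2 : ℤ) < ((q + 1 : ℕ) : ℝ) then 1 else 0))) =
        ENNReal.ofReal (4 * K * (2 * η * ((q + 1 : ℕ) : ℝ) ^ (-(3 / 2) : ℝ) +
          if η ^ (-2 : ℤ) < ((q + 1 : ℕ) : ℝ) then ((q + 1 : ℕ) : ℝ) ^ (-(3 / 2) : ℝ) else 0)) := by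
      intro q
      have hq : (0 : ℝ) < (q + 1 : ℕ) := by positivity
      have h3 : ((q + 1 : ℕ) : ℝ) ^ (-(3 / 2) : ℝ) =
          ((q + 1 : ℕ) : ℝ) * ((q + 1 : ℕ) : ℝ) ^ (-(5 / 2) : ℝ) := by
        rw [← Real.rpow_one_add' hq.le (by norm_num)]; norm_num
      rw [← ENNReal.ofReal_natCast, show (4 : ℝ≥0∞) = ENNReal.ofReal 4 by simp,
        ← ENNReal.ofReal_mul (by norm_num), ← ENNReal.ofReal_mul (by positivity), h3]
      congr 1
      split_ifs <;> ring
    simp_rw [hterm]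
    have hnn : ∀ q : ℕ, 0 ≤ 4 * K * (2 * η * ((q + 1 : ℕ) : ℝ) ^ (-(3 / 2) : ℝ) +
          if η ^ (-2 : ℤ) < ((q + 1 : ℕ) : ℝ) then ((q + 1 : ℕ) : ℝ) ^ (-(3 / 2) : ℝ) else 0) := by
      intro q
      split_ifs <;> positivity
    rw [← ENNReal.ofReal_tsum_of_nonneg hnn (((hZs.mul_left _).add hts).mul_left _), tsum_mul_left,
      (hZs.mul_left _).tsum_add hts, tsum_mul_left]
    refine ENNReal.ofReal_le_ofReal ?_
    calc _ ≤ 4 * K * (2 * η * Z + 4 * η) := by gcongr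
      _ = _ := by ring
  refine (latticeL2Norm_sphericalMaximal_le hc hcard (by omega) f (mul_pos hY hL0)).trans
    ((mul_le_mul_right hsum _).trans ?_)
  rw [← ENNReal.ofReal_mul (by positivity), ← ENNReal.ofReal_mul (by positivity)]
  refine ENNReal.ofReal_le_ofReal ?_
  have : 0 ≤ η * ‖f‖ := by positivity
  nlinarith

end
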